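/- \textbf{Notation.} Let $\mathbb{R}^m_s$ be $\mathbb{R}^m$ with $\langle x,x\rangle=\sum_{i\le m-s}x_i^2-\sum_{i>m-s}x_i^2$, and let $Q^n_r\subset\mathbb{R}P^{n+1}$ be the projectivized light cone of $\mathbb{R}^{n+2}_{r+1}$, where $n-r\ge 2$, $r\ge 0$. Let $M$ be a smooth surface, covered by the domains of a family $Z$ of smooth complex coordinates $z$. A \emph{canonical lift} of $y:M\to Q^n_r$ for $z$ is a smooth lift $Y$ of $y$ to the light cone, on the domain of $z$, with $|dY|^2=|dz|^2$ (it is unique up to sign on connected domains). Put $V=\mathrm{Span}\{Y,\mathrm{Re}\,Y_z,\mathrm{Im}\,Y_z,Y_{z\bar z}\}$, let $V^\perp$ be the conformal normal bundle, $D$ its normal connection (the $V^\perp$-component of the derivative), and write $Y_{zz}=-\frac s2Y+\kappa$ with $\kappa$ a section of $V^\perp\otimes\mathbb{C}$; $s$ is the Schwarzian derivative and $\kappa$ the conformal Hopf differential. The map $y$ is a \emph{spacelike isothermic surface with adapted coordinates $Z$} if for each $z\in Z$ a canonical lift exists and $\kappa$ is real-valued. Let $\tilde c\in\mathbb{R}$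 and let $y,y'$ be spacelike isothermic surfaces in the same projectivized light cone, both with adapted coordinates $Z$. Then $y'$ is a \emph{spectral transform of $y$ with parameter $\tilde c$} if there is a smooth isomorphism $\Phi$ over $M$ from the conformal normal bundle of $y$ to that of $y'$ which preserves the scalar product and the normal connection, such that for each $z\in Z$ there are canonical lifts of $y,y'$ for which $\langle\kappa',\Phi\xi\rangle=\langle\kappa,\xi\rangle$ for all normal vectors $\xi$, and $s'=s+\tilde c$. For $c\in\mathbb{R}$, a \emph{$c$-polar surface} of $y$ is given by a smooth section $\psi$ of $V^\perp$ over $M$ with $D\psi=0$ and $\langle\psi,\psi\rangle=c$ (and without zeros if $c=0$). It is regarded as the following map into a projectivized light cone: $[\psi]:M\to Q^n_r$ if $c=0$; $[(\psi,\sqrt c)]:M\to Q^{n+1}_{r+1}$ if $c>0$; $[(\sqrt{-c},\psi)]:M\to Q^{n+1}_{r}$ if $c<0$. (For $c\ne0$ this is $\psi$ followed by the conformal embedding of the quadric $\{x\in\mathbb{R}^{n+2}_{r+1}:\langle x,x\rangle=c\}$.) It is \emph{non-degenerate} if it is an immersion. \textbf{Theorem.} Let $y:M\to Q^n_r$ be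 a spacelike isothermic surface and let $y^{\tilde c}:M\to Q^n_r$ be a spectral transform of $y$ with parameter $\tilde c\in\mathbb{R}$, with respect to the common adapted coordinates $Z$. Let $c\in\mathbb{R}$, and let $\psi$ be a non-degenerate $c$-polar surface of $y$. Then there is a $c$-polar surface $\psi^{\tilde c}$ of $y^{\tilde c}$ such that $\psi$ and $\psi^{\tilde c}$ are spacelike isothermic surfaces with adapted coordinates $Z$ and $\psi^{\tilde c}$ is a spectral transform of $\psi$ with the same parameter $\tilde c$, with respect to $Z$. Thus the $c$-polar and spectral transforms commute. -/

import Mathlib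

open scoped Manifold ContDiff

noncomputable section

namespace PolarIsothermic

/-- The scalar product of the pseudo-Euclidean space `ℝ^m_s`:
`⟨x, y⟩ = ∑_{i ≤ m - s} xᵢ yᵢ - ∑_{i > m - s} xᵢ yᵢ`. -/
def form (m s : ℕ) : LinearMap.BilinForm ℝ (Fin m → ℝ) :=
  Matrix.toBilin' (Matrix.diagonal fun i : Fin m => if i.val + s < m then (1 : ℝ) else -1)

/-- The projectivized light cone of `ℝ^m_s`; for `m = n + 2` and `s = r + 1` this is `Q^n_r`. -/
def ProjCone (m s : ℕ) : Type :=
  {l : Projectivization ℝ (Fin m → ℝ) // ∀ x ∈ l.submodule, form m s x x = 0}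

/-- The map `y` into the projectivized light cone is `p ↦ [X p]`. -/
def Represents {α : Type*} {m s : ℕ} (X : α → Fin m → ℝ) (y : α → ProjCone m s) : Prop :=
  ∀ p, ∃ h : X p ≠ 0, (y p).1 = Projectivization.mk ℝ (X p) h

/-! ### Calculus in a complex coordinate `z = u + i v` -/

/-- A real vector valued function regarded as a complex vector valued one. -/
def toC {m : ℕ} (Y : ℂ → Fin m → ℝ) : ℂ → Fin m → ℂ := fun w i => (Y w i : ℂ)

/-- `f_z = (f_u - i f_v) / 2`. -/
def dz {m : ℕ} (f : ℂ → Fin m → ℂ) : ℂ → Fin m → ℂ := fun w =>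
  (1 / 2 : ℂ) • (fderiv ℝ f w 1 - Complex.I • fderiv ℝ f w Complex.I)

/-- `f_{\bar z} = (f_u + i f_v) / 2`. -/
def dzbar {m : ℕ} (f : ℂ → Fin m → ℂ) : ℂ → Fin m → ℂ := fun w =>
  (1 / 2 : ℂ) • (fderiv ℝ f w 1 + Complex.I • fderiv ℝ f w Complex.I)

/-- The fibre of the conformal tangent bundle, `V = Span {Y, Re Y_z, Im Y_z, Y_{z \bar z}}`.
The vector `Y_{z \bar z}` is real for real `Y`, so that it equals its real part. -/
def tangentV {m : ℕ} (Y : ℂ → Fin m → ℝ) (w : ℂ) : Submodule ℝ (Fin m → ℝ) :=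
  Submodule.span ℝ {Y w, fun i => (dz (toC Y) w i).re, fun i => (dz (toC Y) w i).im,
    fun i => (dzbar (dz (toC Y)) w i).re}

/-- The fibre `V^⊥` of the conformal normal bundle. -/
def normalV {m : ℕ} (s : ℕ) (Y : ℂ → Fin m → ℝ) (w : ℂ) : Submodule ℝ (Fin m → ℝ) :=
  (form m s).orthogonal (tangentV Y w)

/-- `η = D_h ξ` at `w`: the vector `η` is the component in `V^⊥` of the derivative of `ξ` in the
direction `h`. (For a canonical lift `Y` the space `ℝ^m_s` is the direct sum of `V` and `V^⊥`, and
`D_z = (D_1 - i D_i) / 2`.) -/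
def IsNormalDeriv {m : ℕ} (s : ℕ) (Y ξ : ℂ → Fin m → ℝ) (w h : ℂ) (η : Fin m → ℝ) : Prop :=
  η ∈ normalV s Y w ∧ fderiv ℝ ξ w h - η ∈ tangentV Y w

/-! ### Surfaces in the projectivized light cone -/

section Surface

variable {M : Type*} [TopologicalSpace M]

/-- `Y` is a canonical lift of `y` on the domain of the coordinate `z`: it is smooth, it lifts `y`,
and `|dY|² = |dz|²`. Here `Y` is written as a function of the coordinate. The existence of such a
lift says in particular that `y` is a smooth spacelike immersion with conformal coordinate `z`. -/
structure IsCanonicalLift {m s : ℕ} (z : OpenPartialHomeomorph M ℂ) (y : M → ProjCone m s)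
    (Y : ℂ → Fin m → ℝ) : Prop where
  smooth : ContDiffOn ℝ ∞ Y z.target
  lift : ∀ w ∈ z.target, ∃ h : Y w ≠ 0, (y (z.symm w)).1 = Projectivization.mk ℝ (Y w) h
  metric : ∀ w ∈ z.target, ∀ h : ℂ,
    form m s (fderiv ℝ Y w h) (fderiv ℝ Y w h) = ‖h‖ ^ 2

/-- `z` is an adapted coordinate of `y`, with canonical lift `Y`, Schwarzian derivative `S` and
real valued conformal Hopf differential `κ`: `Y_{zz} = -(S/2) Y + κ` with `κ` in `V^⊥`. -/
structure IsAdaptedLift {m s : ℕ} (z : OpenPartialHomeomorph M ℂ) (y : M → ProjCone m s)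
    (Y : ℂ → Fin m → ℝ) (S : ℂ → ℂ) (κ : ℂ → Fin m → ℝ) : Prop where
  canonical : IsCanonicalLift z y Y
  normal : ∀ w ∈ z.target, κ w ∈ normalV s Y w
  eq : ∀ w ∈ z.target, dz (dz (toC Y)) w = -(S w / 2) • toC Y w + toC κ w

/-- The spacelike surface `y` is isothermic, and all the coordinates in `Z` are adapted
coordinates of it. -/
def IsIsothermic {m s : ℕ} (Z : Set (OpenPartialHomeomorph M ℂ)) (y : M → ProjCone m s) : Prop :=
  ∀ z ∈ Z, ∃ Y S κ, IsAdaptedLift z y Y S κ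

/-- On the domain of `z`, the fibrewise linear maps `Φ p` restrict to an isomorphism from the normal
bundle of `Y` to that of `Y'` which preserves the scalar product, the pairing with the conformal
Hopf differentials, and the normal connection. (Only the values of `Φ` on the normal bundle of `Y`
matter.) -/
structure IsNormalCorrespondence {m : ℕ} (s : ℕ) (z : OpenPartialHomeomorph M ℂ)
    (Φ : M → (Fin m → ℝ) →ₗ[ℝ] (Fin m → ℝ)) (Y κ Y' κ' : ℂ → Fin m → ℝ) : Prop where
  map_eq : ∀ w ∈ z.target, (normalV s Y w).map (Φ (z.symm w)) = normalV s Y' w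
  isometry : ∀ w ∈ z.target, ∀ ξ ∈ normalV s Y w,
    form m s (Φ (z.symm w) ξ) (Φ (z.symm w) ξ) = form m s ξ ξ
  hopf : ∀ w ∈ z.target, ∀ ξ ∈ normalV s Y w,
    form m s (κ' w) (Φ (z.symm w) ξ) = form m s (κ w) ξ
  smooth : ∀ ξ : ℂ → Fin m → ℝ, ContDiffOn ℝ ∞ ξ z.target →
    (∀ w ∈ z.target, ξ w ∈ normalV s Y w) →
    ContDiffOn ℝ ∞ (fun w => Φ (z.symm w) (ξ w)) z.target
  connection : ∀ ξ : ℂ → Fin m → ℝ, ContDiffOn ℝ ∞ ξ z.target →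
    (∀ w ∈ z.target, ξ w ∈ normalV s Y w) →
    ∀ w ∈ z.target, ∀ (h : ℂ) (η : Fin m → ℝ), IsNormalDeriv s Y ξ w h η →
      IsNormalDeriv s Y' (fun w => Φ (z.symm w) (ξ w)) w h (Φ (z.symm w) η)

/-- The isothermic surface `y'` is a spectral transform, with parameter `a`, of the isothermic
surface `y`, with respect to the common adapted coordinates in `Z`: there is an identification `Φ`
of the normal bundles over `M` that preserves scalar product, conformal Hopf differential and
normal connection, while the Schwarzian derivative changes by the constant `a`. Canonical lifts
exist up to sign, so they are chosen in each coordinate. -/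
def IsSpectralTransform {m s : ℕ} (Z : Set (OpenPartialHomeomorph M ℂ)) (a : ℝ)
    (y y' : M → ProjCone m s) : Prop :=
  ∃ Φ : M → (Fin m → ℝ) →ₗ[ℝ] (Fin m → ℝ), ∀ z ∈ Z, ∃ Y S κ Y' S' κ',
    IsAdaptedLift z y Y S κ ∧ IsAdaptedLift z y' Y' S' κ' ∧
    IsNormalCorrespondence s z Φ Y κ Y' κ' ∧ ∀ w ∈ z.target, S' w = S w + (a : ℂ)

/-- `ψ` gives a `c`-polar surface of the isothermic surface `y`: it is a smooth parallel section of
the conformal normal bundle with `⟨ψ, ψ⟩ = c`, and it has no zeros if `c = 0`, so that `[ψ]` makes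
sense. (The bundle `V` does not depend on the coordinate or on the sign of the canonical lift.) -/
structure IsPolar {m s : ℕ} (Z : Set (OpenPartialHomeomorph M ℂ)) (y : M → ProjCone m s)
    (c : ℝ) (ψ : M → Fin m → ℝ) : Prop where
  isothermic : IsIsothermic Z y
  smooth : ∀ z ∈ Z, ContDiffOn ℝ ∞ (fun w => ψ (z.symm w)) z.target
  normal : ∀ z ∈ Z, ∀ Y, IsCanonicalLift z y Y → ∀ w ∈ z.target, ψ (z.symm w) ∈ normalV s Y w
  parallel : ∀ z ∈ Z, ∀ Y, IsCanonicalLift z y Y → ∀ w ∈ z.target, ∀ h : ℂ,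
    IsNormalDeriv s Y (fun w => ψ (z.symm w)) w h 0
  length : ∀ p, form m s (ψ p) (ψ p) = c
  ne_zero : c = 0 → ∀ p, ψ p ≠ 0

/-- The `c`-polar surface is non-degenerate, that is, an immersion: `ψ` is an immersion into the
quadric `⟨x, x⟩ = c` if `c ≠ 0`, and `[ψ]` is an immersion into the projectivized light cone if
`c = 0`. -/
structure IsNondegenerate {m : ℕ} (Z : Set (OpenPartialHomeomorph M ℂ)) (c : ℝ)
    (ψ : M → Fin m → ℝ) : Prop where
  of_ne_zero : c ≠ 0 → ∀ z ∈ Z, ∀ w ∈ z.target, ∀ h : ℂ,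
    fderiv ℝ (fun w => ψ (z.symm w)) w h = 0 → h = 0
  of_eq_zero : c = 0 → ∀ z ∈ Z, ∀ w ∈ z.target, ∀ (h : ℂ) (t : ℝ),
    fderiv ℝ (fun w => ψ (z.symm w)) w h = t • ψ (z.symm w) → h = 0

/-- The polar surface `ψ'` is a spectral transform, with parameter `a`, of the polar surface `ψ`.
If `c = 0` these are the surfaces `[ψ]`, `[ψ']` in the projectivized light cone of `ℝ^m_s`. If
`c ≠ 0` they lie in the quadric `⟨x, x⟩ = c` of `ℝ^m_s`, which is conformally embedded into the
projectivized light cone of `ℝ^{m+1}_{s+1}` by `x ↦ [(x, √c)]` for `c > 0`, and into that of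
`ℝ^{m+1}_s` by `x ↦ [(√(-c), x)]` for `c < 0`. -/
structure IsPolarSpectralTransform {m : ℕ} (s : ℕ) (Z : Set (OpenPartialHomeomorph M ℂ))
    (a c : ℝ) (ψ ψ' : M → Fin m → ℝ) : Prop where
  of_eq_zero : c = 0 → ∃ f f' : M → ProjCone m s,
    Represents ψ f ∧ Represents ψ' f' ∧ IsSpectralTransform Z a f f'
  of_pos : 0 < c → ∃ f f' : M → ProjCone (m + 1) (s + 1),
    Represents (fun p => Fin.snoc (α := fun _ => ℝ) (ψ p) (√c)) f ∧
    Represents (fun p => Fin.snoc (α := fun _ => ℝ) (ψ' p) (√c)) f' ∧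
    IsSpectralTransform Z a f f'
  of_neg : c < 0 → ∃ f f' : M → ProjCone (m + 1) s,
    Represents (fun p => Fin.cons (α := fun _ => ℝ) (√(-c)) (ψ p)) f ∧
    Represents (fun p => Fin.cons (α := fun _ => ℝ) (√(-c)) (ψ' p)) f' ∧
    IsSpectralTransform Z a f f'

end Surface

/-- `Z` is a set of smooth coordinates of the smooth surface `M` whose domains cover `M`. -/
structure IsCoordinateCover {M : Type*} [TopologicalSpace M] [ChartedSpace ℂ M]
    (Z : Set (OpenPartialHomeomorph M ℂ)) : Prop where
  smooth : ∀ z ∈ Z, z ∈ IsManifold.maximalAtlas 𝓘(ℝ, ℂ) ∞ M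
  cover : ∀ p : M, ∃ z ∈ Z, p ∈ z.source

end PolarIsothermic

end

set_option linter.unusedSectionVars false

/-! Write z = u + iv, ΔY = Y_uu + Y_vv and S = s + it. That κ is real means Y_uv = tY and Y_uu -
Y_vv = -2sY + 4κ. Exchanging u and v keeps these equations and reverses the signs of κ, s and the
parameter a, so most computations are done in one direction and carried over by the lemmas `swap`.

Let c = 0 and ρ = ⟨κ, ψ⟩. As ψ is parallel, dψ lies in V, and ψ_uv = ψ_vu gives ψ_u = 2ρ_u Y - 2ρ
Y_u, ψ_v = -2ρ_v Y + 2ρ Y_v and ρ_uv = tρ (`IsParallelNull.integrability`). Non-degeneracy forces ρ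
≠ 0 (`IsParallelSection.pairing_ne`), and Ψ = ψ/(2ρ) is a canonical lift: modulo the null plane
spanned by Y and Ψ, which is orthogonal to dY, dΨ is -Y_u du + Y_v dv. The polar surface is
isothermic with Schwarzian (s + p_u - q_v) + i(2pq - t), where p = ρ_u/ρ and q = ρ_v/ρ
(`IsParallelNull.isothermicLift_polarLift`). A spectral transform preserves t and ρ and adds a to s.
So for ψ' = Φψ the new Schwarzian is also shifted by a.

It remains to identify the normal bundles of Ψ and Ψ'. Let G (`transport`) be the isometry of the
ambient space that carries Y, dY, ΔY to Y', dY', ΔY' and equals Φ on V^⊥. With ω = Y_u du - Y_v dv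
and ω' likewise, d(Gξ) = G dξ + a(⟨Y, ξ⟩ω' - ⟨ω, ξ⟩Y') (`SpectralPair.pd_left_transport`). G carries
Ψ and dΨ to Ψ' and dΨ', but ΔΨ to ΔΨ' - 2aY'. The corrected map x ↦ Gx + (a/(2ρ))⟨Y, x⟩ψ'
(`polarMap`) does carry normal vectors to normal vectors. It preserves scalar products because ψ' is
null and orthogonal to Gx. It preserves the connection because normal vectors of Ψ satisfy ⟨Y_u, x⟩
= p⟨Y, x⟩ and ⟨Y_v, x⟩ = q⟨Y, x⟩, and those of Ψ' the same relations with Y' and the same p and q,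
which makes the error term of d(Gξ) orthogonal to them.

The correction is built in a coordinate, so its independence of the coordinate must be shown
(`SpectralPair.polarMap_change`). The danger is that canonical lifts are only unique up to sign.
However ρ is nonzero, common to y and y', and scales with the lift, so the lifts of y and y' change
by the same factor.

If c ≠ 0, add a dimension spanned by u with ⟨u, u⟩ = -c. Then ψ + u is a parallel null section of
the normal bundle of y in the larger space, the spectral transform extends by the identity on u, and
[ψ + u] is the embedded polar surface. All values of c are treated together in
`exists_isSpectralTransform`, with u = 0 for c = 0. -/

namespace PolarIsothermic

/-! ### Directional derivatives of smooth maps on an open subset of the plane -/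

section Calculus

variable {E : Type*} [NormedAddCommGroup E] [NormedSpace ℝ E]

/-- The derivative of `f` in the constant direction `e`. -/
noncomputable def pd (e : ℂ) (f : ℂ → E) : ℂ → E := fun w => fderiv ℝ f w e

variable {U : Set ℂ} {w : ℂ}

theorem differentiableAt_of_smooth (hU : IsOpen U) {f : ℂ → E} (hf : ContDiffOn ℝ ∞ f U)
    (hw : w ∈ U) : DifferentiableAt ℝ f w :=
  (hf.contDiffAt (hU.mem_nhds hw)).differentiableAt (by simp)

theorem smooth_pd (hU : IsOpen U) {f : ℂ → E} (hf : ContDiffOn ℝ ∞ f U) (e : ℂ) :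
    ContDiffOn ℝ ∞ (pd e f) U :=
  (hf.fderiv_of_isOpen hU (m := ∞) (by simp)).clm_apply contDiffOn_const

theorem pd_congr (hU : IsOpen U) {f g : ℂ → E} (h : ∀ w ∈ U, f w = g w) (hw : w ∈ U) (e : ℂ) :
    pd e f w = pd e g w := by
  have : f =ᶠ[nhds w] g := Filter.eventually_of_mem (hU.mem_nhds hw) h
  simp only [pd, this.fderiv_eq]

theorem pd_const (e : ℂ) (x : E) : pd e (fun _ : ℂ => x) w = 0 := by
  simp [pd]

theorem pd_add (hU : IsOpen U) {f g : ℂ → E} (hf : ContDiffOn ℝ ∞ f U) (hg : ContDiffOn ℝ ∞ g U)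
    (hw : w ∈ U) (e : ℂ) : pd e (fun w => f w + g w) w = pd e f w + pd e g w := by
  simp only [pd]
  rw [fderiv_fun_add (differentiableAt_of_smooth hU hf hw) (differentiableAt_of_smooth hU hg hw)]
  rfl

theorem pd_sub (hU : IsOpen U) {f g : ℂ → E} (hf : ContDiffOn ℝ ∞ f U) (hg : ContDiffOn ℝ ∞ g U)
    (hw : w ∈ U) (e : ℂ) : pd e (fun w => f w - g w) w = pd e f w - pd e g w := by
  simp only [pd]
  rw [fderiv_fun_sub (differentiableAt_of_smooth hU hf hw) (differentiableAt_of_smooth hU hg hw)]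
  rfl

theorem pd_neg (e : ℂ) (f : ℂ → E) : pd e (fun w => -f w) w = -pd e f w := by
  simp only [pd]
  rw [fderiv_fun_neg]
  rfl

theorem pd_smul (hU : IsOpen U) {a : ℂ → ℝ} {f : ℂ → E} (ha : ContDiffOn ℝ ∞ a U)
    (hf : ContDiffOn ℝ ∞ f U) (hw : w ∈ U) (e : ℂ) :
    pd e (fun w => a w • f w) w = pd e a w • f w + a w • pd e f w := by
  simp only [pd]
  rw [fderiv_fun_smul (differentiableAt_of_smooth hU ha hw) (differentiableAt_of_smooth hU hf hw)]
  simp [add_comm]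

theorem pd_inv (hU : IsOpen U) {a : ℂ → ℝ} (ha : ContDiffOn ℝ ∞ a U) (hw : w ∈ U) (h0 : a w ≠ 0)
    (e : ℂ) : pd e (fun w => (a w)⁻¹) w = -pd e a w / a w ^ 2 := by
  have := ((hasDerivAt_inv h0).comp_hasFDerivAt w
    (differentiableAt_of_smooth hU ha hw).hasFDerivAt).fderiv
  simp only [pd]
  refine (congrArg (fun S => S e) this).trans ?_
  simp
  ring

theorem pd_clm {F : Type*} [NormedAddCommGroup F] [NormedSpace ℝ F] (hU : IsOpen U) {f : ℂ → E}
    (hf : ContDiffOn ℝ ∞ f U) (T : E →L[ℝ] F) (hw : w ∈ U) (e : ℂ) :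
    pd e (fun w => T (f w)) w = T (pd e f w) := by
  have := (T.hasFDerivAt.comp w (differentiableAt_of_smooth hU hf hw).hasFDerivAt).fderiv
  simp only [pd]
  exact congrArg (fun S => S e) this

theorem smooth_form (B : E →L[ℝ] E →L[ℝ] ℝ) {f g : ℂ → E} (hf : ContDiffOn ℝ ∞ f U)
    (hg : ContDiffOn ℝ ∞ g U) : ContDiffOn ℝ ∞ (fun w => B (f w) (g w)) U :=
  (B.contDiff.comp_contDiffOn hf).clm_apply hg

theorem smooth_smul {a : ℂ → ℝ} {f : ℂ → E} (ha : ContDiffOn ℝ ∞ a U)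
    (hf : ContDiffOn ℝ ∞ f U) : ContDiffOn ℝ ∞ (fun w => a w • f w) U := ha.smul hf

theorem smooth_add {f g : ℂ → E} (hf : ContDiffOn ℝ ∞ f U) (hg : ContDiffOn ℝ ∞ g U) :
    ContDiffOn ℝ ∞ (fun w => f w + g w) U := hf.add hg

theorem smooth_sub {f g : ℂ → E} (hf : ContDiffOn ℝ ∞ f U) (hg : ContDiffOn ℝ ∞ g U) :
    ContDiffOn ℝ ∞ (fun w => f w - g w) U := hf.sub hg

theorem pd_form (B : E →L[ℝ] E →L[ℝ] ℝ) (hU : IsOpen U) {f g : ℂ → E}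
    (hf : ContDiffOn ℝ ∞ f U) (hg : ContDiffOn ℝ ∞ g U) (hw : w ∈ U) (e : ℂ) :
    pd e (fun w => B (f w) (g w)) w = B (pd e f w) (g w) + B (f w) (pd e g w) := by
  have := (B.hasFDerivAt_of_bilinear (differentiableAt_of_smooth hU hf hw).hasFDerivAt
    (differentiableAt_of_smooth hU hg hw).hasFDerivAt).fderiv
  simp only [pd]
  rw [this]
  simp [add_comm]

theorem pd_form_eq_zero (B : E →L[ℝ] E →L[ℝ] ℝ) (hU : IsOpen U) {f g : ℂ → E}
    (hf : ContDiffOn ℝ ∞ f U) (hg : ContDiffOn ℝ ∞ g U) {x : ℝ}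
    (h : ∀ w ∈ U, B (f w) (g w) = x) (hw : w ∈ U) (e : ℂ) :
    B (pd e f w) (g w) + B (f w) (pd e g w) = 0 := by
  rw [← pd_form B hU hf hg hw e, pd_congr hU h hw, pd_const]

theorem pd_pd (hU : IsOpen U) {f : ℂ → E} (hf : ContDiffOn ℝ ∞ f U) (hw : w ∈ U) (e h : ℂ) :
    pd h (pd e f) w = fderiv ℝ (fderiv ℝ f) w h e := by
  have h1 : DifferentiableAt ℝ (fderiv ℝ f) w :=
    differentiableAt_of_smooth hU (hf.fderiv_of_isOpen hU (m := ∞) (by simp)) hw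
  have := (h1.hasFDerivAt.clm_apply (hasFDerivAt_const e w)).fderiv
  change fderiv ℝ (fun w => fderiv ℝ f w e) w h = _
  rw [this]
  simp

theorem pd_comm (hU : IsOpen U) {f : ℂ → E} (hf : ContDiffOn ℝ ∞ f U) (hw : w ∈ U) (e h : ℂ) :
    pd h (pd e f) w = pd e (pd h f) w := by
  rw [pd_pd hU hf hw, pd_pd hU hf hw]
  exact (hf.contDiffAt (hU.mem_nhds hw)).isSymmSndFDerivAt
    (by simpa using WithTop.coe_le_coe.2 (le_top (a := (2 : ℕ∞)))) h e

theorem pd_eq_re_im (f : ℂ → E) (h : ℂ) :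
    pd h f w = h.re • pd 1 f w + h.im • pd Complex.I f w := by
  simp only [pd]
  rw [← map_smul, ← map_smul, ← map_add]
  congr 1
  apply Complex.ext <;> simp

/-- The sum of the second derivatives in the directions `e` and `f`. -/
noncomputable def lap (e f : ℂ) (Y : ℂ → E) : ℂ → E := fun w => pd e (pd e Y) w + pd f (pd f Y) w

theorem lap_swap (e f : ℂ) (Y : ℂ → E) : lap e f Y = lap f e Y := by
  funext w
  exact add_comm _ _

theorem smooth_lap (hU : IsOpen U) {Y : ℂ → E} (hY : ContDiffOn ℝ ∞ Y U) (e f : ℂ) :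
    ContDiffOn ℝ ∞ (lap e f Y) U :=
  (smooth_pd hU (smooth_pd hU hY e) e).add (smooth_pd hU (smooth_pd hU hY f) f)

end Calculus

/-! ### Canonical lifts in real form: structure equations and the Gram matrix of the frame -/

section Lift

variable {E : Type*} [NormedAddCommGroup E] [NormedSpace ℝ E]

/-- A null lift `Y`, on the open set `U`, with `|dY|²` equal to the standard metric with respect to
the directions `e`, `f`. -/
structure ConformalLift (B : E →L[ℝ] E →L[ℝ] ℝ) (U : Set ℂ) (e f : ℂ) (Y : ℂ → E) : Prop where
  isOpen : IsOpen U
  smooth : ContDiffOn ℝ ∞ Y U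
  null : ∀ w ∈ U, B (Y w) (Y w) = 0
  unit_left : ∀ w ∈ U, B (pd e Y w) (pd e Y w) = 1
  unit_right : ∀ w ∈ U, B (pd f Y w) (pd f Y w) = 1
  ortho : ∀ w ∈ U, B (pd e Y w) (pd f Y w) = 0

/-- A conformal lift whose Hopf differential `κ` is real; `s` and `t` are the real and the imaginary
part of the Schwarzian derivative. -/
structure IsothermicLift (B : E →L[ℝ] E →L[ℝ] ℝ) (U : Set ℂ) (e f : ℂ) (Y κ : ℂ → E)
    (s t : ℂ → ℝ) : Prop extends ConformalLift B U e f Y where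
  hopf : ∀ w ∈ U, pd e (pd e Y) w - pd f (pd f Y) w = (-2 * s w) • Y w + (4 : ℝ) • κ w
  mixed : ∀ w ∈ U, pd e (pd f Y) w = t w • Y w
  lap_kappa : ∀ w ∈ U, B (lap e f Y w) (κ w) = 0

/-- The vector `x` is orthogonal to `Y` and its derivatives `Y_e`, `Y_f`, `Y_ee + Y_ff` at `w`. -/
structure IsNormal (B : E →L[ℝ] E →L[ℝ] ℝ) (e f : ℂ) (Y : ℂ → E) (w : ℂ) (x : E) : Prop where
  point : B (Y w) x = 0
  left : B (pd e Y w) x = 0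
  right : B (pd f Y w) x = 0
  lap : B (lap e f Y w) x = 0

theorem IsNormal.swap {B : E →L[ℝ] E →L[ℝ] ℝ} {e f : ℂ} {Y : ℂ → E} {w : ℂ} {x : E}
    (h : IsNormal B e f Y w x) : IsNormal B f e Y w x :=
  ⟨h.point, h.right, h.left, by rw [lap_swap]; exact h.lap⟩

theorem IsNormal.add {B : E →L[ℝ] E →L[ℝ] ℝ} {e f : ℂ} {Y : ℂ → E} {w : ℂ} {x y : E}
    (hx : IsNormal B e f Y w x) (hy : IsNormal B e f Y w y) : IsNormal B e f Y w (x + y) :=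
  ⟨by rw [map_add, hx.point, hy.point, add_zero], by rw [map_add, hx.left, hy.left, add_zero],
    by rw [map_add, hx.right, hy.right, add_zero], by rw [map_add, hx.lap, hy.lap, add_zero]⟩

theorem IsNormal.smul {B : E →L[ℝ] E →L[ℝ] ℝ} {e f : ℂ} {Y : ℂ → E} {w : ℂ} {x : E} (a : ℝ)
    (hx : IsNormal B e f Y w x) : IsNormal B e f Y w (a • x) :=
  ⟨by rw [map_smul, hx.point, smul_zero], by rw [map_smul, hx.left, smul_zero],
    by rw [map_smul, hx.right, smul_zero], by rw [map_smul, hx.lap, smul_zero]⟩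

theorem IsNormal.sub {B : E →L[ℝ] E →L[ℝ] ℝ} {e f : ℂ} {Y : ℂ → E} {w : ℂ} {x y : E}
    (hx : IsNormal B e f Y w x) (hy : IsNormal B e f Y w y) : IsNormal B e f Y w (x - y) := by
  have := hx.add (hy.smul (-1))
  rwa [neg_one_smul, ← sub_eq_add_neg] at this

namespace ConformalLift

variable {B : E →L[ℝ] E →L[ℝ] ℝ} {U : Set ℂ} {e f : ℂ} {Y : ℂ → E} {w : ℂ}

theorem swap (H : ConformalLift B U e f Y) (hB : ∀ x y, B x y = B y x) :
    ConformalLift B U f e Y where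
  isOpen := H.isOpen
  smooth := H.smooth
  null := H.null
  unit_left := H.unit_right
  unit_right := H.unit_left
  ortho w hw := by rw [hB, H.ortho w hw]

variable (H : ConformalLift B U e f Y) (hB : ∀ x y, B x y = B y x)
include H

theorem smooth_left : ContDiffOn ℝ ∞ (pd e Y) U := smooth_pd H.isOpen H.smooth e

theorem smooth_right : ContDiffOn ℝ ∞ (pd f Y) U := smooth_pd H.isOpen H.smooth f

include hB

theorem form_point_pd (h : ℂ) (hw : w ∈ U) : B (Y w) (pd h Y w) = 0 := by
  have := pd_form_eq_zero B H.isOpen H.smooth H.smooth H.null hw h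
  rw [hB] at this
  linarith

theorem form_point_ee (hw : w ∈ U) : B (Y w) (pd e (pd e Y) w) = -1 := by
  have := pd_form_eq_zero B H.isOpen H.smooth H.smooth_left
    (fun w hw => H.form_point_pd hB e hw) hw e
  rw [H.unit_left w hw] at this
  linarith

theorem form_point_ff (hw : w ∈ U) : B (Y w) (pd f (pd f Y) w) = -1 :=
  (H.swap hB).form_point_ee hB hw

theorem form_point_lap (hw : w ∈ U) : B (Y w) (lap e f Y w) = -2 := by
  rw [lap, map_add, H.form_point_ee hB hw, H.form_point_ff hB hw]
  norm_num

end ConformalLift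

namespace IsothermicLift

variable {B : E →L[ℝ] E →L[ℝ] ℝ} {U : Set ℂ} {e f : ℂ} {Y κ : ℂ → E} {s t : ℂ → ℝ} {w : ℂ}

theorem mixed' (H : IsothermicLift B U e f Y κ s t) (hw : w ∈ U) :
    pd f (pd e Y) w = t w • Y w := by
  rw [pd_comm H.isOpen H.smooth hw, H.mixed w hw]

/-- The exchange of directions fixes ΔY and Y_ef and reverses Y_ee - Y_ff, hence κ and s. -/
theorem swap (H : IsothermicLift B U e f Y κ s t) (hB : ∀ x y, B x y = B y x) :
    IsothermicLift B U f e Y (fun w => -κ w) (fun w => -s w) t where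
  toConformalLift := H.toConformalLift.swap hB
  hopf w hw := by
    have := H.hopf w hw
    rw [← neg_sub, this]
    module
  mixed w hw := H.mixed' hw
  lap_kappa w hw := by rw [lap_swap, map_neg, H.lap_kappa w hw, neg_zero]

variable (H : IsothermicLift B U e f Y κ s t) (hB : ∀ x y, B x y = B y x)
include H

theorem smooth_ee : ContDiffOn ℝ ∞ (pd e (pd e Y)) U := smooth_pd H.isOpen H.smooth_left e

theorem smooth_ff : ContDiffOn ℝ ∞ (pd f (pd f Y)) U := smooth_pd H.isOpen H.smooth_right f

include hB

theorem form_left_ee (hw : w ∈ U) : B (pd e Y w) (pd e (pd e Y) w) = 0 := by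
  have := pd_form_eq_zero B H.isOpen H.smooth_left H.smooth_left H.unit_left hw e
  rw [hB] at this
  linarith

theorem form_left_ff (hw : w ∈ U) : B (pd e Y w) (pd f (pd f Y) w) = 0 := by
  have := pd_form_eq_zero B H.isOpen H.smooth_left H.smooth_right H.ortho hw f
  rw [H.mixed' hw, map_smul, smul_apply, H.form_point_pd hB f hw, smul_zero,
    zero_add] at this
  exact this

theorem form_right_ff (hw : w ∈ U) : B (pd f Y w) (pd f (pd f Y) w) = 0 :=
  (H.swap hB).form_left_ee hB hw

theorem form_right_ee (hw : w ∈ U) : B (pd f Y w) (pd e (pd e Y) w) = 0 :=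
  (H.swap hB).form_left_ff hB hw

/-- Differentiate ⟨Y_e, Y_ff⟩ = 0 along e and ⟨Y_e, Y_ef⟩ = 0 along f. The third order terms agree,
and ⟨Y_ef, Y_ef⟩ = t²⟨Y, Y⟩ = 0. -/
theorem form_ee_ff (hw : w ∈ U) : B (pd e (pd e Y) w) (pd f (pd f Y) w) = 0 := by
  have h1 := pd_form_eq_zero B H.isOpen H.smooth_left H.smooth_ff
    (fun w hw => H.form_left_ff hB hw) hw e
  have h2 := pd_form_eq_zero B H.isOpen H.smooth_left (smooth_pd H.isOpen H.smooth_left f)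
    (x := 0) (fun w hw => by
      rw [H.mixed' hw, map_smul, hB, H.form_point_pd hB e hw, smul_zero]) hw f
  have h3 : pd e (pd f (pd f Y)) w = pd f (pd f (pd e Y)) w := by
    rw [pd_comm H.isOpen H.smooth_right hw]
    exact pd_congr H.isOpen (fun w hw => pd_comm H.isOpen H.smooth hw f e) hw f
  rw [h3] at h1
  rw [H.mixed' hw] at h2
  simp only [map_smul, smul_apply, H.null w hw, smul_zero, zero_add] at h2
  linarith

theorem form_left_lap (hw : w ∈ U) : B (pd e Y w) (lap e f Y w) = 0 := by
  rw [lap, map_add, H.form_left_ee hB hw, H.form_left_ff hB hw, add_zero]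

theorem form_right_lap (hw : w ∈ U) : B (pd f Y w) (lap e f Y w) = 0 := by
  rw [lap, map_add, H.form_right_ee hB hw, H.form_right_ff hB hw, add_zero]

omit hB in
theorem kappa_eq (hw : w ∈ U) :
    κ w = (1 / 4 : ℝ) • (pd e (pd e Y) w - pd f (pd f Y) w) + (s w / 2) • Y w := by
  rw [H.hopf w hw]
  module

omit hB in
theorem ee_eq (hw : w ∈ U) :
    pd e (pd e Y) w = (1 / 2 : ℝ) • lap e f Y w - s w • Y w + (2 : ℝ) • κ w := by
  rw [H.kappa_eq hw, lap]
  module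

omit hB in
theorem ff_eq (hw : w ∈ U) :
    pd f (pd f Y) w = (1 / 2 : ℝ) • lap e f Y w + s w • Y w - (2 : ℝ) • κ w := by
  rw [H.kappa_eq hw, lap]
  module

theorem kappa_normal (hw : w ∈ U) : IsNormal B e f Y w (κ w) where
  point := by
    rw [H.kappa_eq hw]
    simp [H.form_point_ee hB hw, H.form_point_ff hB hw, H.null w hw]
  left := by
    rw [H.kappa_eq hw]
    simp [H.form_left_ee hB hw, H.form_left_ff hB hw, hB (pd e Y w) (Y w),
      H.form_point_pd hB e hw]
  right := by
    rw [H.kappa_eq hw]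
    simp [H.form_right_ee hB hw, H.form_right_ff hB hw, hB (pd f Y w) (Y w),
      H.form_point_pd hB f hw]
  lap := H.lap_kappa w hw

/-- Expand ⟨Y_ee, Y_ff⟩ = 0 in ΔY, Y and κ. This completes the Gram matrix of the frame, which
depends on the surface only through ⟨κ, κ⟩; that is why a spectral transform carries frames
isometrically. -/
theorem form_lap_lap (hw : w ∈ U) :
    B (lap e f Y w) (lap e f Y w) = 16 * B (κ w) (κ w) := by
  have h1 := H.form_ee_ff hB hw
  rw [H.ee_eq hw, H.ff_eq hw] at h1
  have hk := H.kappa_normal hB hw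
  have h2 := H.form_point_lap hB hw
  have h3 := hB (lap e f Y w) (Y w)
  have h4 := hk.point
  have h5 := hB (κ w) (Y w)
  have h6 := hk.lap
  have h7 := hB (κ w) (lap e f Y w)
  simp only [map_add, map_sub, map_smul, add_apply, sub_apply, smul_apply, smul_eq_mul,
    H.null w hw] at h1
  rw [h3, h5, h7, h2, h4, h6] at h1
  linarith

/-- Expresses s through Y, which makes s and then κ smooth although neither is assumed to be. -/
theorem form_lap_sub (hw : w ∈ U) :
    B (lap e f Y w) (pd e (pd e Y) w - pd f (pd f Y) w) = 4 * s w := by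
  rw [H.hopf w hw]
  rw [map_add, map_smul, map_smul, H.lap_kappa w hw, hB (lap e f Y w), H.form_point_lap hB hw]
  simp only [smul_eq_mul]
  ring

theorem smooth_s : ContDiffOn ℝ ∞ s U := by
  have h := (contDiffOn_const (c := (1 / 4 : ℝ))).mul (smooth_form B
    (smooth_lap H.isOpen H.smooth e f) (H.smooth_ee.sub H.smooth_ff))
  refine h.congr fun w hw => ?_
  have := H.form_lap_sub hB hw
  change s w = 1 / 4 * B (lap e f Y w) (pd e (pd e Y) w - pd f (pd f Y) w)
  rw [this]
  ring

theorem smooth_kappa : ContDiffOn ℝ ∞ κ U := by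
  have h := (contDiffOn_const (c := (1 / 4 : ℝ))).smul (H.smooth_ee.sub H.smooth_ff) |>.add
    (((H.smooth_s hB).div_const 2).smul H.smooth)
  refine h.congr fun w hw => ?_
  exact H.kappa_eq hw

end IsothermicLift

end Lift

/-! ### The splitting into V and its complement -/

section Frame

variable {E : Type*} [NormedAddCommGroup E] [NormedSpace ℝ E]

/-- The linear map which takes the frame `Y`, `Y_e`, `Y_f`, `Y_ee + Y_ff` to that of `Y'` and the
orthogonal complement of the former to zero. -/
noncomputable def frameComb (B : E →L[ℝ] E →L[ℝ] ℝ) (e f : ℂ) (Y κ Y' : ℂ → E) (w : ℂ) :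
    E →ₗ[ℝ] E where
  -- The coefficients invert the Gram matrix: ⟨Y, ΔY⟩ = -2 and ⟨ΔY, ΔY⟩ = 16⟨κ, κ⟩, while Y_e, Y_f
  -- are orthonormal and orthogonal to the null vector Y and to ΔY.
  toFun x := (-(1 / 2) * B (lap e f Y w) x - 4 * B (κ w) (κ w) * B (Y w) x) • Y' w +
    B (pd e Y w) x • pd e Y' w + B (pd f Y w) x • pd f Y' w +
    (-(1 / 2) * B (Y w) x) • lap e f Y' w
  map_add' x y := by
    simp only [map_add]
    module
  map_smul' a x := by
    simp only [map_smul, smul_eq_mul, RingHom.id_apply]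
    module

theorem frameComb_apply (B : E →L[ℝ] E →L[ℝ] ℝ) (e f : ℂ) (Y κ Y' : ℂ → E) (w : ℂ) (x : E) :
    frameComb B e f Y κ Y' w x =
      (-(1 / 2) * B (lap e f Y w) x - 4 * B (κ w) (κ w) * B (Y w) x) • Y' w +
      B (pd e Y w) x • pd e Y' w + B (pd f Y w) x • pd f Y' w +
      (-(1 / 2) * B (Y w) x) • lap e f Y' w := rfl

theorem frameComb_of_isNormal {B : E →L[ℝ] E →L[ℝ] ℝ} {e f : ℂ} {Y κ Y' : ℂ → E} {w : ℂ} {x : E}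
    (h : IsNormal B e f Y w x) : frameComb B e f Y κ Y' w x = 0 := by
  rw [frameComb_apply, h.point, h.left, h.right, h.lap]
  simp

theorem frameComb_swap {B : E →L[ℝ] E →L[ℝ] ℝ} {e f : ℂ} {Y κ Y' : ℂ → E} {w : ℂ} :
    frameComb B f e Y (fun w => -κ w) Y' w = frameComb B e f Y κ Y' w := by
  ext x
  rw [frameComb_apply, frameComb_apply, lap_swap f e Y, lap_swap f e Y']
  simp only [map_neg, neg_apply, neg_neg]
  abel

namespace IsothermicLift

variable {B : E →L[ℝ] E →L[ℝ] ℝ} {U : Set ℂ} {e f : ℂ} {Y κ Y' κ' : ℂ → E} {s t s' t' : ℂ → ℝ}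
  {w : ℂ}

variable (H : IsothermicLift B U e f Y κ s t) (H' : IsothermicLift B U e f Y' κ' s' t')
  (hB : ∀ x y, B x y = B y x) (hN : ∀ x, (∀ y, B x y = 0) → x = 0)

include H' hB

theorem form_point_frameComb (hw : w ∈ U) (x : E) :
    B (Y' w) (frameComb B e f Y κ Y' w x) = B (Y w) x := by
  rw [frameComb_apply]
  simp only [map_add, map_smul, smul_eq_mul, H'.null w hw, H'.form_point_pd hB _ hw,
    H'.form_point_lap hB hw]
  ring

theorem form_left_frameComb (hw : w ∈ U) (x : E) :
    B (pd e Y' w) (frameComb B e f Y κ Y' w x) = B (pd e Y w) x := by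
  rw [frameComb_apply]
  simp only [map_add, map_smul, smul_eq_mul, hB _ (Y' w), H'.form_point_pd hB _ hw,
    H'.unit_left w hw, H'.ortho w hw, H'.form_left_lap hB hw]
  ring

theorem form_right_frameComb (hw : w ∈ U) (x : E) :
    B (pd f Y' w) (frameComb B e f Y κ Y' w x) = B (pd f Y w) x := by
  rw [frameComb_apply]
  simp only [map_add, map_smul, smul_eq_mul, hB _ (Y' w), H'.form_point_pd hB _ hw,
    H'.unit_right w hw, hB _ (pd e Y' w), H'.ortho w hw, H'.form_right_lap hB hw]
  ring

theorem form_lap_frameComb (hk : B (κ' w) (κ' w) = B (κ w) (κ w)) (hw : w ∈ U) (x : E) :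
    B (lap e f Y' w) (frameComb B e f Y κ Y' w x) = B (lap e f Y w) x := by
  rw [frameComb_apply]
  have h1 := hB (lap e f Y' w) (Y' w)
  have h2 := hB (lap e f Y' w) (pd e Y' w)
  have h3 := hB (lap e f Y' w) (pd f Y' w)
  simp only [map_add, map_smul, smul_eq_mul, H'.form_lap_lap hB hw]
  rw [h1, h2, h3, H'.form_point_lap hB hw, H'.form_left_lap hB hw, H'.form_right_lap hB hw, hk]
  ring

omit H' hB in
theorem form_frameComb_normal {n : E} (hn : IsNormal B e f Y' w n) (hB : ∀ x y, B x y = B y x)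
    (x : E) : B n (frameComb B e f Y κ Y' w x) = 0 := by
  rw [hB, frameComb_apply]
  simp only [map_add, map_smul, add_apply, smul_apply, smul_eq_mul, hn.point, hn.left, hn.right, hn.lap]
  ring

omit H'
include H

/-- With Y' = Y the map `frameComb` is the projection onto V along the normal vectors. -/
theorem isNormal_sub_frameComb (hw : w ∈ U) (x : E) :
    IsNormal B e f Y w (x - frameComb B e f Y κ Y w x) where
  point := by rw [map_sub, H.form_point_frameComb hB hw, sub_self]
  left := by rw [map_sub, H.form_left_frameComb hB hw, sub_self]
  right := by rw [map_sub, H.form_right_frameComb hB hw, sub_self]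
  lap := by rw [map_sub, H.form_lap_frameComb hB rfl hw, sub_self]

include hN

/-- Every vector is the sum of one in V and a normal one, so nondegeneracy passes from the whole
space to the normal vectors. -/
theorem eq_zero_of_normal (hw : w ∈ U) {x : E} (hx : IsNormal B e f Y w x)
    (h : ∀ n, IsNormal B e f Y w n → B x n = 0) : x = 0 := by
  refine hN x fun y => ?_
  have := h _ (H.isNormal_sub_frameComb hB hw y)
  rw [map_sub, form_frameComb_normal hx hB, sub_zero] at this
  exact this

theorem ext_frame (hw : w ∈ U) {x y : E} (h0 : B (Y w) x = B (Y w) y)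
    (h1 : B (pd e Y w) x = B (pd e Y w) y) (h2 : B (pd f Y w) x = B (pd f Y w) y)
    (h3 : B (lap e f Y w) x = B (lap e f Y w) y)
    (h : ∀ n, IsNormal B e f Y w n → B n x = B n y) : x = y := by
  refine sub_eq_zero.1 (H.eq_zero_of_normal hB hN hw ⟨?_, ?_, ?_, ?_⟩ fun n hn => ?_)
  · rw [map_sub, h0, sub_self]
  · rw [map_sub, h1, sub_self]
  · rw [map_sub, h2, sub_self]
  · rw [map_sub, h3, sub_self]
  · rw [hB, map_sub, h n hn, sub_self]

theorem eq_frameComb (hw : w ∈ U) {x : E} (h : ∀ n, IsNormal B e f Y w n → B x n = 0) :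
    x = frameComb B e f Y κ Y w x := by
  refine H.ext_frame hB hN hw ?_ ?_ ?_ ?_ fun n hn => ?_
  · rw [H.form_point_frameComb hB hw]
  · rw [H.form_left_frameComb hB hw]
  · rw [H.form_right_frameComb hB hw]
  · rw [H.form_lap_frameComb hB rfl hw]
  · rw [form_frameComb_normal hn hB, hB, h n hn]

end IsothermicLift

/-! ### Parallel normal sections and their derivatives -/

/-- `ψ` is a smooth parallel section of the bundle of normal vectors of `Y` on `U`. -/
structure IsParallelSection (B : E →L[ℝ] E →L[ℝ] ℝ) (U : Set ℂ) (e f : ℂ) (Y ψ : ℂ → E) :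
    Prop where
  smooth : ContDiffOn ℝ ∞ ψ U
  normal : ∀ w ∈ U, IsNormal B e f Y w (ψ w)
  parallel_left : ∀ w ∈ U, ∀ n, IsNormal B e f Y w n → B (pd e ψ w) n = 0
  parallel_right : ∀ w ∈ U, ∀ n, IsNormal B e f Y w n → B (pd f ψ w) n = 0

/-- A parallel null section whose pairing with the Hopf differential `κ` has no zeros. -/
structure IsParallelNull (B : E →L[ℝ] E →L[ℝ] ℝ) (U : Set ℂ) (e f : ℂ) (Y κ ψ : ℂ → E) :
    Prop extends IsParallelSection B U e f Y ψ where
  null : ∀ w ∈ U, B (ψ w) (ψ w) = 0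
  pairing_ne : ∀ w ∈ U, B (κ w) (ψ w) ≠ 0

namespace IsParallelSection

variable {B : E →L[ℝ] E →L[ℝ] ℝ} {U : Set ℂ} {e f : ℂ} {Y κ ψ : ℂ → E} {s t : ℂ → ℝ}
  {w : ℂ}

theorem swap (P : IsParallelSection B U e f Y ψ) : IsParallelSection B U f e Y ψ where
  smooth := P.smooth
  normal w hw := (P.normal w hw).swap
  parallel_left w hw n hn := P.parallel_right w hw n hn.swap
  parallel_right w hw n hn := P.parallel_left w hw n hn.swap

variable (P : IsParallelSection B U e f Y ψ) (H : IsothermicLift B U e f Y κ s t)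
  (hB : ∀ x y, B x y = B y x) (hN : ∀ x, (∀ y, B x y = 0) → x = 0)

include P H hB

theorem smooth_pairing : ContDiffOn ℝ ∞ (fun w => B (κ w) (ψ w)) U :=
  smooth_form B (H.smooth_kappa hB) P.smooth

theorem form_ee (hw : w ∈ U) : B (pd e (pd e Y) w) (ψ w) = 2 * B (κ w) (ψ w) := by
  rw [H.ee_eq hw]
  simp only [add_apply, sub_apply, smul_apply, map_add, map_sub, map_smul, smul_eq_mul,
    (P.normal w hw).point, (P.normal w hw).lap]
  ring

theorem form_ff (hw : w ∈ U) : B (pd f (pd f Y) w) (ψ w) = -2 * B (κ w) (ψ w) := by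
  have := P.swap.form_ee (H.swap hB) hB hw
  rw [this]
  simp

theorem form_point_pd (h : ℂ) (hY : ∀ w ∈ U, B (pd h Y w) (ψ w) = 0) (hw : w ∈ U) :
    B (Y w) (pd h ψ w) = 0 := by
  have := pd_form_eq_zero B H.isOpen H.smooth P.smooth (fun w hw => (P.normal w hw).point) hw h
  rw [hY w hw] at this
  linarith

theorem form_point_left (hw : w ∈ U) : B (Y w) (pd e ψ w) = 0 :=
  P.form_point_pd H hB e (fun w hw => (P.normal w hw).left) hw

theorem form_left_left (hw : w ∈ U) : B (pd e Y w) (pd e ψ w) = -2 * B (κ w) (ψ w) := by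
  have := pd_form_eq_zero B H.isOpen H.smooth_left P.smooth
    (fun w hw => (P.normal w hw).left) hw e
  rw [P.form_ee H hB hw] at this
  linarith

theorem form_right_left (hw : w ∈ U) : B (pd f Y w) (pd e ψ w) = 0 := by
  have := pd_form_eq_zero B H.isOpen H.smooth_right P.smooth
    (fun w hw => (P.normal w hw).right) hw e
  rw [H.mixed w hw, map_smul, smul_apply, (P.normal w hw).point, smul_zero] at this
  linarith

include hN

/-- A parallel section has its derivative in V, so ψ_e is its own frame combination. Differentiating
the orthogonality of ψ to Y, Y_e and Y_f gives every coefficient except that of Y, which the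
integrability condition supplies later. -/
theorem pd_left_eq (hw : w ∈ U) : pd e ψ w =
    (-(1 / 2) * B (lap e f Y w) (pd e ψ w)) • Y w - (2 * B (κ w) (ψ w)) • pd e Y w := by
  conv_lhs => rw [H.eq_frameComb hB hN hw (P.parallel_left w hw)]
  rw [frameComb_apply, P.form_point_left H hB hw, P.form_left_left H hB hw,
    P.form_right_left H hB hw]
  module

theorem pd_right_eq (hw : w ∈ U) : pd f ψ w =
    (-(1 / 2) * B (lap e f Y w) (pd f ψ w)) • Y w + (2 * B (κ w) (ψ w)) • pd f Y w := by
  have := P.swap.pd_left_eq (H.swap hB) hB hN hw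
  rw [lap_swap f e, map_neg, neg_apply] at this
  conv_lhs => rw [this]
  module

end IsParallelSection

namespace IsParallelNull

variable {B : E →L[ℝ] E →L[ℝ] ℝ} {U : Set ℂ} {e f : ℂ} {Y κ ψ : ℂ → E} {s t : ℂ → ℝ}
  {w : ℂ}

theorem swap (P : IsParallelNull B U e f Y κ ψ) :
    IsParallelNull B U f e Y (fun w => -κ w) ψ where
  toIsParallelSection := P.toIsParallelSection.swap
  null := P.null
  pairing_ne w hw := by simpa using P.pairing_ne w hw

variable (P : IsParallelNull B U e f Y κ ψ) (H : IsothermicLift B U e f Y κ s t)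
  (hB : ∀ x y, B x y = B y x) (hN : ∀ x, (∀ y, B x y = 0) → x = 0)

include P H hB

include hN

/-- These are the coefficients of Y_e, Y_f and Y in ψ_ef = ψ_fe. -/
theorem integrability (hw : w ∈ U) :
    -(1 / 2) * B (lap e f Y w) (pd f ψ w) = -2 * pd f (fun w => B (κ w) (ψ w)) w ∧
    -(1 / 2) * B (lap e f Y w) (pd e ψ w) = 2 * pd e (fun w => B (κ w) (ψ w)) w ∧
    pd f (fun w => -(1 / 2) * B (lap e f Y w) (pd e ψ w)) w -
      pd e (fun w => -(1 / 2) * B (lap e f Y w) (pd f ψ w)) w =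
        4 * (B (κ w) (ψ w) * t w) := by
  have hU := H.isOpen
  have h2 : ContDiffOn ℝ ∞ (fun w => 2 * B (κ w) (ψ w)) U :=
    contDiffOn_const.mul (P.smooth_pairing H hB)
  have hm : ∀ h, ContDiffOn ℝ ∞ (fun w => -(1 / 2) * B (lap e f Y w) (pd h ψ w)) U := fun h =>
    contDiffOn_const.mul (smooth_form B (smooth_lap hU H.smooth e f) (smooth_pd hU P.smooth h))
  have key := pd_comm hU P.smooth hw e f
  rw [pd_congr hU (fun w hw => P.pd_left_eq H hB hN hw) hw f,
    pd_congr hU (fun w hw => P.pd_right_eq H hB hN hw) hw e,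
    pd_sub hU (smooth_smul (hm e) H.smooth) (smooth_smul h2 H.smooth_left) hw,
    pd_add hU (smooth_smul (hm f) H.smooth) (smooth_smul h2 H.smooth_right) hw,
    pd_smul hU (hm e) H.smooth hw, pd_smul hU (hm f) H.smooth hw,
    pd_smul hU h2 H.smooth_left hw, pd_smul hU h2 H.smooth_right hw,
    H.mixed w hw, H.mixed' hw] at key
  have hd : ∀ h, pd h (fun w => 2 * B (κ w) (ψ w)) w = 2 * pd h (fun w => B (κ w) (ψ w)) w := by
    intro h
    have := pd_smul hU (a := fun _ => 2) contDiffOn_const (P.smooth_pairing H hB) hw h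
    rw [pd_const] at this
    simpa using this
  rw [hd, hd] at key
  -- Both sides lie in the span of Y, Y_e and Y_f. Pairing with Y_e and Y_f isolates the
  -- coefficients of these vectors, and pairing with ΔY isolates that of Y.
  have k1 := congrArg (B (pd e Y w)) key
  have k2 := congrArg (B (pd f Y w)) key
  have k3 := congrArg (B (lap e f Y w)) key
  have e0 := hB (pd e Y w) (Y w)
  have f0 := hB (pd f Y w) (Y w)
  have l0 := hB (lap e f Y w) (Y w)
  have le := hB (lap e f Y w) (pd e Y w)
  have lf := hB (lap e f Y w) (pd f Y w)
  have fe := hB (pd f Y w) (pd e Y w)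
  rw [H.form_point_pd hB _ hw] at e0 f0
  rw [H.form_point_lap hB hw] at l0
  rw [H.form_left_lap hB hw] at le
  rw [H.form_right_lap hB hw] at lf
  rw [H.ortho w hw] at fe
  simp only [map_add, map_sub, map_smul, smul_eq_mul, e0, f0, l0, le, lf, fe, H.unit_left w hw,
    H.unit_right w hw, H.ortho w hw] at k1 k2 k3
  refine ⟨?_, ?_, ?_⟩ <;> linarith

/-- The derivative of a parallel normal section in the first direction. -/
theorem pd_left (hw : w ∈ U) : pd e ψ w =
    (2 * pd e (fun w => B (κ w) (ψ w)) w) • Y w - (2 * B (κ w) (ψ w)) • pd e Y w := by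
  conv_lhs => rw [P.pd_left_eq H hB hN hw, (P.integrability H hB hN hw).2.1]

/-- The derivative of a parallel normal section in the second direction. -/
theorem pd_right (hw : w ∈ U) : pd f ψ w =
    (-2 * pd f (fun w => B (κ w) (ψ w)) w) • Y w + (2 * B (κ w) (ψ w)) • pd f Y w := by
  conv_lhs => rw [P.pd_right_eq H hB hN hw, (P.integrability H hB hN hw).1]

/-- Insert the first two identities of `integrability` into the third: ρ solves the same equation as
the lift, Y_ef = tY. -/
theorem pd_pairing_mixed (hw : w ∈ U) :
    pd f (pd e (fun w => B (κ w) (ψ w))) w = B (κ w) (ψ w) * t w := by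
  have hU := H.isOpen
  have h := (P.integrability H hB hN hw).2.2
  rw [pd_congr hU (fun w hw => (P.integrability H hB hN hw).1) hw e,
    pd_congr hU (fun w hw => (P.integrability H hB hN hw).2.1) hw f] at h
  have hd : ∀ (c : ℝ) (h h' : ℂ), pd h' (fun w => c * pd h (fun w => B (κ w) (ψ w)) w) w =
      c * pd h' (pd h (fun w => B (κ w) (ψ w))) w := by
    intro c h h'
    have := pd_smul hU (a := fun _ => c) contDiffOn_const
      (smooth_pd hU (P.smooth_pairing H hB) h) hw h'
    rw [pd_const] at this
    simpa using this
  rw [hd, hd, pd_comm hU (P.smooth_pairing H hB) hw f e] at h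
  linarith

end IsParallelNull

end Frame

/-! ### The polar surface of a parallel null section is isothermic -/

section Polar

variable {E : Type*} [NormedAddCommGroup E] [NormedSpace ℝ E]

/-- The logarithmic derivative, in the direction `h`, of the pairing of `κ` and `ψ`. -/
noncomputable def logPd (B : E →L[ℝ] E →L[ℝ] ℝ) (κ ψ : ℂ → E) (h : ℂ) : ℂ → ℝ := fun w =>
  pd h (fun w => B (κ w) (ψ w)) w * (B (κ w) (ψ w))⁻¹

/-- The canonical lift of the polar surface given by the parallel null section `ψ`. -/
noncomputable def polarLift (B : E →L[ℝ] E →L[ℝ] ℝ) (κ ψ : ℂ → E) : ℂ → E := fun w =>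
  (2 * B (κ w) (ψ w))⁻¹ • ψ w

/-- The real part of the Schwarzian derivative of the polar surface. -/
noncomputable def polarS (B : E →L[ℝ] E →L[ℝ] ℝ) (e f : ℂ) (κ ψ : ℂ → E) (s : ℂ → ℝ) : ℂ → ℝ :=
  fun w => s w + pd e (logPd B κ ψ e) w - pd f (logPd B κ ψ f) w

/-- The imaginary part of the Schwarzian derivative of the polar surface. -/
noncomputable def polarT (B : E →L[ℝ] E →L[ℝ] ℝ) (e f : ℂ) (κ ψ : ℂ → E) (t : ℂ → ℝ) : ℂ → ℝ :=
  fun w => 2 * (logPd B κ ψ e w * logPd B κ ψ f w) - t w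

/-- The Hopf differential of the polar surface. -/
noncomputable def polarKappa (B : E →L[ℝ] E →L[ℝ] ℝ) (e f : ℂ) (κ ψ : ℂ → E) (s : ℂ → ℝ) :
    ℂ → E := fun w =>
  (1 / 4 : ℝ) • (pd e (pd e (polarLift B κ ψ)) w - pd f (pd f (polarLift B κ ψ)) w) +
    (polarS B e f κ ψ s w / 2) • polarLift B κ ψ w

namespace IsParallelNull

variable {B : E →L[ℝ] E →L[ℝ] ℝ} {U : Set ℂ} {e f : ℂ} {Y κ ψ : ℂ → E} {s t : ℂ → ℝ}
  {w : ℂ}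

variable (P : IsParallelNull B U e f Y κ ψ) (H : IsothermicLift B U e f Y κ s t)
  (hB : ∀ x y, B x y = B y x) (hN : ∀ x, (∀ y, B x y = 0) → x = 0)

include P H hB

theorem smooth_logPd (h : ℂ) : ContDiffOn ℝ ∞ (logPd B κ ψ h) U :=
  (smooth_pd H.isOpen (P.smooth_pairing H hB) h).mul ((P.smooth_pairing H hB).inv P.pairing_ne)

theorem smooth_inv_pairing : ContDiffOn ℝ ∞ (fun w => (2 * B (κ w) (ψ w))⁻¹) U :=
  (contDiffOn_const.mul (P.smooth_pairing H hB)).inv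
    fun w hw => mul_ne_zero two_ne_zero (P.pairing_ne w hw)

theorem smooth_polarLift : ContDiffOn ℝ ∞ (polarLift B κ ψ) U :=
  smooth_smul (P.smooth_inv_pairing H hB) P.smooth

theorem pd_pairing (h : ℂ) (hw : w ∈ U) :
    pd h (fun w => B (κ w) (ψ w)) w = logPd B κ ψ h w * B (κ w) (ψ w) := by
  rw [logPd, inv_mul_cancel_right₀ (P.pairing_ne w hw)]

theorem pd_polarLift (h : ℂ) (hw : w ∈ U) : pd h (polarLift B κ ψ) w =
    (2 * B (κ w) (ψ w))⁻¹ • pd h ψ w - logPd B κ ψ h w • polarLift B κ ψ w := by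
  have hU := H.isOpen
  have hρ := P.smooth_pairing H hB
  have h0 := P.pairing_ne w hw
  have h2 : ContDiffOn ℝ ∞ (fun w => 2 * B (κ w) (ψ w)) U := contDiffOn_const.mul hρ
  have hd : pd h (fun w => 2 * B (κ w) (ψ w)) w = 2 * pd h (fun w => B (κ w) (ψ w)) w := by
    have := pd_smul hU (a := fun _ => 2) contDiffOn_const hρ hw h
    rw [pd_const] at this
    simpa using this
  have h3 : pd h (fun w => (2 * B (κ w) (ψ w))⁻¹) w =
      -(logPd B κ ψ h w * (2 * B (κ w) (ψ w))⁻¹) := by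
    rw [pd_inv hU h2 hw (mul_ne_zero two_ne_zero h0), hd, P.pd_pairing H hB h hw]
    field_simp
  have h4 := pd_smul hU (P.smooth_inv_pairing H hB) P.smooth hw h
  rw [h3] at h4
  change pd h (polarLift B κ ψ) w = _ at h4
  rw [h4, polarLift]
  module

include hN

/-- Riccati form of ρ_ef = tρ. -/
theorem pd_logPd (hw : w ∈ U) :
    pd f (logPd B κ ψ e) w = t w - logPd B κ ψ e w * logPd B κ ψ f w := by
  have hU := H.isOpen
  have hρ := P.smooth_pairing H hB
  have h0 := P.pairing_ne w hw
  have h1 := pd_smul hU (smooth_pd hU hρ e) (f := fun w => (B (κ w) (ψ w))⁻¹)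
    (hρ.inv P.pairing_ne) hw f
  rw [pd_inv hU hρ hw h0, P.pd_pairing_mixed H hB hN hw, P.pd_pairing H hB e hw,
    P.pd_pairing H hB f hw] at h1
  change pd f (logPd B κ ψ e) w = _ at h1
  rw [h1]
  simp only [smul_eq_mul]
  field_simp
  ring

theorem pd_logPd' (hw : w ∈ U) :
    pd e (logPd B κ ψ f) w = t w - logPd B κ ψ e w * logPd B κ ψ f w := by
  have h := P.swap.pd_logPd (H.swap hB) hB hN hw
  have hl : ∀ h, logPd B (fun w => -κ w) ψ h = logPd B κ ψ h := by
    intro h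
    funext w
    simp only [logPd, map_neg, neg_apply]
    rw [pd_neg, inv_neg, neg_mul_neg]
  rw [hl, hl] at h
  rw [h, mul_comm]

/-- The factor 1/(2ρ) normalises the coefficient of Y_e to -1, and that of Y_f in the other
direction to +1. -/
theorem polarLift_left (hw : w ∈ U) : pd e (polarLift B κ ψ) w =
    logPd B κ ψ e w • (Y w - polarLift B κ ψ w) - pd e Y w := by
  have h0 := P.pairing_ne w hw
  rw [P.pd_polarLift H hB e hw, P.pd_left H hB hN hw, P.pd_pairing H hB e hw, smul_sub, smul_smul,
    smul_smul, inv_mul_cancel₀ (mul_ne_zero two_ne_zero h0)]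
  have : (2 * B (κ w) (ψ w))⁻¹ * (2 * (logPd B κ ψ e w * B (κ w) (ψ w))) = logPd B κ ψ e w := by
    field_simp
  rw [this]
  module

theorem polarLift_right (hw : w ∈ U) : pd f (polarLift B κ ψ) w =
    pd f Y w - logPd B κ ψ f w • (Y w + polarLift B κ ψ w) := by
  have h0 := P.pairing_ne w hw
  rw [P.pd_polarLift H hB f hw, P.pd_right H hB hN hw, P.pd_pairing H hB f hw, smul_add, smul_smul,
    smul_smul, inv_mul_cancel₀ (mul_ne_zero two_ne_zero h0)]
  have : (2 * B (κ w) (ψ w))⁻¹ * (-2 * (logPd B κ ψ f w * B (κ w) (ψ w))) =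
      -logPd B κ ψ f w := by
    field_simp
  rw [this]
  module

theorem polarLift_left_left (hw : w ∈ U) : pd e (pd e (polarLift B κ ψ)) w =
    (logPd B κ ψ e w ^ 2 - pd e (logPd B κ ψ e) w) • (polarLift B κ ψ w - Y w) +
      (2 * logPd B κ ψ e w) • pd e Y w - pd e (pd e Y) w := by
  have hU := H.isOpen
  have hp := P.smooth_logPd H hB e
  have hΨ := P.smooth_polarLift H hB
  rw [pd_congr hU (fun w hw => P.polarLift_left H hB hN hw) hw e,
    pd_sub hU (smooth_smul hp (smooth_sub H.smooth hΨ)) H.smooth_left hw,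
    pd_smul hU hp (smooth_sub H.smooth hΨ) hw, pd_sub hU H.smooth hΨ hw,
    P.polarLift_left H hB hN hw]
  module

theorem polarLift_right_right (hw : w ∈ U) : pd f (pd f (polarLift B κ ψ)) w =
    (logPd B κ ψ f w ^ 2 - pd f (logPd B κ ψ f) w) • (polarLift B κ ψ w + Y w) -
      (2 * logPd B κ ψ f w) • pd f Y w + pd f (pd f Y) w := by
  have hU := H.isOpen
  have hp := P.smooth_logPd H hB f
  have hΨ := P.smooth_polarLift H hB
  rw [pd_congr hU (fun w hw => P.polarLift_right H hB hN hw) hw f,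
    pd_sub hU H.smooth_right (smooth_smul hp (smooth_add H.smooth hΨ)) hw,
    pd_smul hU hp (smooth_add H.smooth hΨ) hw, pd_add hU H.smooth hΨ hw,
    P.polarLift_right H hB hN hw]
  module

theorem polarLift_mixed (hw : w ∈ U) : pd e (pd f (polarLift B κ ψ)) w =
    polarT B e f κ ψ t w • polarLift B κ ψ w := by
  have hU := H.isOpen
  have hp := P.smooth_logPd H hB f
  have hΨ := P.smooth_polarLift H hB
  rw [pd_congr hU (fun w hw => P.polarLift_right H hB hN hw) hw e,
    pd_sub hU H.smooth_right (smooth_smul hp (smooth_add H.smooth hΨ)) hw,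
    pd_smul hU hp (smooth_add H.smooth hΨ) hw, pd_add hU H.smooth hΨ hw,
    P.polarLift_left H hB hN hw, P.pd_logPd' H hB hN hw, H.mixed w hw, polarT]
  module

omit hN H hB in
theorem form_normal_polarLift (hw : w ∈ U) : IsNormal B e f Y w (polarLift B κ ψ w) :=
  (P.normal w hw).smul _

omit hN H hB in
theorem form_polarLift_self (hw : w ∈ U) : B (polarLift B κ ψ w) (polarLift B κ ψ w) = 0 := by
  simp [polarLift, P.null w hw]

omit hN in
theorem form_ee_polarLift (hw : w ∈ U) : B (pd e (pd e Y) w) (polarLift B κ ψ w) = 1 := by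
  have h0 := P.pairing_ne w hw
  rw [polarLift, map_smul, P.form_ee H hB hw, smul_eq_mul]
  field_simp

omit hN in
theorem form_ff_polarLift (hw : w ∈ U) : B (pd f (pd f Y) w) (polarLift B κ ψ w) = -1 := by
  have h0 := P.pairing_ne w hw
  rw [polarLift, map_smul, P.form_ff H hB hw, smul_eq_mul]
  field_simp

/-- The polar surface is isothermic. -/
theorem isothermicLift_polarLift :
    IsothermicLift B U e f (polarLift B κ ψ) (polarKappa B e f κ ψ s) (polarS B e f κ ψ s)
      (polarT B e f κ ψ t) where
  isOpen := H.isOpen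
  smooth := P.smooth_polarLift H hB
  null w hw := P.form_polarLift_self hw
  -- Y and Ψ are null, orthogonal to each other and orthogonal to Y_e; modulo them, Ψ_e is -Y_e. The
  -- next two fields work in the same way.
  unit_left w hw := by
    have h1 := P.form_normal_polarLift hw
    have h2 := P.form_polarLift_self hw
    have h3 := hB (polarLift B κ ψ w) (Y w)
    have h4 := hB (polarLift B κ ψ w) (pd e Y w)
    have h5 := H.form_point_pd hB e hw
    have h6 := hB (pd e Y w) (Y w)
    rw [h1.point] at h3
    rw [h1.left] at h4
    rw [h5] at h6
    rw [P.polarLift_left H hB hN hw]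
    simp only [map_sub, map_smul, sub_apply, smul_apply, smul_eq_mul, h1.point, h1.left, h2, h3, h4,
      h5, h6, H.null w hw, H.unit_left w hw]
    ring
  unit_right w hw := by
    have h1 := P.form_normal_polarLift hw
    have h2 := P.form_polarLift_self hw
    have h3 := hB (polarLift B κ ψ w) (Y w)
    have h4 := hB (polarLift B κ ψ w) (pd f Y w)
    have h5 := H.form_point_pd hB f hw
    have h6 := hB (pd f Y w) (Y w)
    rw [h1.point] at h3
    rw [h1.right] at h4
    rw [h5] at h6
    rw [P.polarLift_right H hB hN hw]
    simp only [map_sub, map_add, map_smul, sub_apply, add_apply, smul_apply, smul_eq_mul, h1.point,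
      h1.right, h2, h3, h4, h5, h6, H.null w hw, H.unit_right w hw]
    ring
  ortho w hw := by
    have h1 := P.form_normal_polarLift hw
    have h2 := P.form_polarLift_self hw
    have h3 := hB (polarLift B κ ψ w) (Y w)
    have h4 := hB (polarLift B κ ψ w) (pd f Y w)
    have h5 := H.form_point_pd hB f hw
    have h6 := hB (pd e Y w) (Y w)
    rw [h1.point] at h3
    rw [h1.right] at h4
    rw [H.form_point_pd hB e hw] at h6
    rw [P.polarLift_left H hB hN hw, P.polarLift_right H hB hN hw]
    simp only [map_sub, map_add, map_smul, sub_apply, smul_apply, smul_eq_mul, h1.point,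
      h1.left, h2, h3, h4, h5, h6, H.null w hw, H.ortho w hw]
    ring
  -- `polarKappa` solves this equation by definition. The content is in `lap_kappa`, which singles
  -- out the value of `polarS`.
  hopf w hw := by
    rw [polarKappa]
    module
  mixed w hw := P.polarLift_mixed H hB hN hw
  lap_kappa w hw := by
    have h1 := P.form_normal_polarLift hw
    have h2 := P.form_polarLift_self hw
    have h3 := hB (polarLift B κ ψ w) (Y w)
    have h4 := hB (polarLift B κ ψ w) (pd e Y w)
    have h5 := hB (polarLift B κ ψ w) (pd f Y w)
    have h6 := hB (pd e Y w) (Y w)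
    have h7 := hB (pd f Y w) (Y w)
    have h8 := hB (pd e (pd e Y) w) (Y w)
    have h9 := hB (pd f (pd f Y) w) (Y w)
    have h10 := hB (polarLift B κ ψ w) (pd e (pd e Y) w)
    have h11 := hB (polarLift B κ ψ w) (pd f (pd f Y) w)
    have h12 := hB (pd e (pd e Y) w) (pd e Y w)
    have h13 := hB (pd f (pd f Y) w) (pd f Y w)
    have h14 := hB (pd f (pd f Y) w) (pd e Y w)
    have h15 := hB (pd e (pd e Y) w) (pd f Y w)
    have h16 := hB (pd f (pd f Y) w) (pd e (pd e Y) w)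
    have h17 := hB (pd f Y w) (pd e Y w)
    rw [h1.point] at h3
    rw [h1.left] at h4
    rw [h1.right] at h5
    rw [H.form_point_pd hB e hw] at h6
    rw [H.form_point_pd hB f hw] at h7
    rw [H.form_point_ee hB hw] at h8
    rw [H.form_point_ff hB hw] at h9
    rw [P.form_ee_polarLift H hB hw] at h10
    rw [P.form_ff_polarLift H hB hw] at h11
    rw [H.form_left_ee hB hw] at h12
    rw [H.form_right_ff hB hw] at h13
    rw [H.form_left_ff hB hw] at h14
    rw [H.form_right_ee hB hw] at h15
    rw [H.form_ee_ff hB hw] at h16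
    rw [H.ortho w hw] at h17
    -- Since ⟨Y_ee, Y_ff⟩ = 0, this becomes ⟨Y_ee, Y_ee⟩ - ⟨Y_ff, Y_ff⟩ = 4s, which is how s enters
    -- `e2`.
    have key := H.form_lap_sub hB hw
    simp only [lap, map_sub, map_add, add_apply, H.form_ee_ff hB hw, h16] at key
    have e1 : B (lap e f (polarLift B κ ψ) w) (polarLift B κ ψ w) = -2 := by
      rw [lap, P.polarLift_left_left H hB hN hw, P.polarLift_right_right H hB hN hw]
      simp only [map_sub, map_add, map_smul, sub_apply, add_apply, smul_apply, smul_eq_mul,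
        h1.point, h1.left, h1.right, h2, P.form_ee_polarLift H hB hw, P.form_ff_polarLift H hB hw]
      ring
    have e2 : B (lap e f (polarLift B κ ψ) w)
        (pd e (pd e (polarLift B κ ψ)) w - pd f (pd f (polarLift B κ ψ)) w) =
        4 * polarS B e f κ ψ s w := by
      rw [lap, P.polarLift_left_left H hB hN hw, P.polarLift_right_right H hB hN hw, polarS]
      simp only [map_sub, map_add, map_smul, sub_apply, add_apply, smul_apply, smul_eq_mul,
        h1.point, h1.left, h1.right, h2, h3, h4, h5, h6, h7, h8, h9, h10, h11, h12, h13, h14, h15,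
        h16, h17, H.null w hw, H.form_point_pd hB _ hw, H.form_point_ee hB hw,
        H.form_point_ff hB hw, H.unit_left w hw, H.unit_right w hw, H.ortho w hw,
        P.form_ee_polarLift H hB hw, P.form_ff_polarLift H hB hw, H.form_left_ee hB hw,
        H.form_left_ff hB hw, H.form_right_ee hB hw, H.form_right_ff hB hw, H.form_ee_ff hB hw]
      linear_combination key
    rw [polarKappa, map_add, map_smul, map_smul, e1, e2]
    simp only [smul_eq_mul]
    ring

end IsParallelNull

end Polar

/-! ### The spectral transform as an isometry of the ambient space, and its derivative -/

section Spectral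

variable {E : Type*} [NormedAddCommGroup E] [NormedSpace ℝ E]

/-- The maps `A w` restrict to an isomorphism of the bundles of normal vectors of `Y` and `Y'`
which preserves the scalar product, the pairing with the Hopf differentials and the normal
connection. -/
structure NormalCorr (B : E →L[ℝ] E →L[ℝ] ℝ) (U : Set ℂ) (e f : ℂ) (A : ℂ → E →ₗ[ℝ] E)
    (Y κ Y' κ' : ℂ → E) : Prop where
  map_normal : ∀ w ∈ U, ∀ x, IsNormal B e f Y w x → IsNormal B e f Y' w (A w x)
  surj : ∀ w ∈ U, ∀ x', IsNormal B e f Y' w x' → ∃ x, IsNormal B e f Y w x ∧ A w x = x'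
  isometry : ∀ w ∈ U, ∀ x, IsNormal B e f Y w x → ∀ y, IsNormal B e f Y w y →
    B (A w x) (A w y) = B x y
  hopf : ∀ w ∈ U, ∀ x, IsNormal B e f Y w x → B (κ' w) (A w x) = B (κ w) x
  smooth : ∀ ξ : ℂ → E, ContDiffOn ℝ ∞ ξ U → (∀ w ∈ U, IsNormal B e f Y w (ξ w)) →
    ContDiffOn ℝ ∞ (fun w => A w (ξ w)) U
  connection_left : ∀ ξ : ℂ → E, ContDiffOn ℝ ∞ ξ U → (∀ w ∈ U, IsNormal B e f Y w (ξ w)) →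
    ∀ w ∈ U, ∀ n, IsNormal B e f Y w n →
      B (pd e (fun w => A w (ξ w)) w) (A w n) = B (pd e ξ w) n
  connection_right : ∀ ξ : ℂ → E, ContDiffOn ℝ ∞ ξ U → (∀ w ∈ U, IsNormal B e f Y w (ξ w)) →
    ∀ w ∈ U, ∀ n, IsNormal B e f Y w n →
      B (pd f (fun w => A w (ξ w)) w) (A w n) = B (pd f ξ w) n

/-- The lift `Y'` is a spectral transform of the lift `Y` with parameter `a`. -/
structure SpectralPair (B : E →L[ℝ] E →L[ℝ] ℝ) (U : Set ℂ) (e f : ℂ) (a : ℝ) (A : ℂ → E →ₗ[ℝ] E)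
    (Y κ : ℂ → E) (s t : ℂ → ℝ) (Y' κ' : ℂ → E) (s' t' : ℂ → ℝ) : Prop where
  source : IsothermicLift B U e f Y κ s t
  target : IsothermicLift B U e f Y' κ' s' t'
  corr : NormalCorr B U e f A Y κ Y' κ'
  re_eq : ∀ w ∈ U, s' w = s w + a
  im_eq : ∀ w ∈ U, t' w = t w

/-- The linear map which takes the frame `Y`, `Y_e`, `Y_f`, `Y_ee + Y_ff` to that of `Y'`, and
which equals `A` on the normal vectors of `Y`. -/
noncomputable def transport (B : E →L[ℝ] E →L[ℝ] ℝ) (e f : ℂ) (A : ℂ → E →ₗ[ℝ] E) (Y κ Y' : ℂ → E)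
    (w : ℂ) : E →ₗ[ℝ] E :=
  frameComb B e f Y κ Y' w + A w ∘ₗ (LinearMap.id - frameComb B e f Y κ Y w)

theorem transport_apply (B : E →L[ℝ] E →L[ℝ] ℝ) (e f : ℂ) (A : ℂ → E →ₗ[ℝ] E) (Y κ Y' : ℂ → E)
    (w : ℂ) (x : E) : transport B e f A Y κ Y' w x =
      frameComb B e f Y κ Y' w x + A w (x - frameComb B e f Y κ Y w x) := rfl

theorem transport_swap {B : E →L[ℝ] E →L[ℝ] ℝ} {e f : ℂ} {A : ℂ → E →ₗ[ℝ] E} {Y κ Y' : ℂ → E} :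
    transport B f e A Y (fun w => -κ w) Y' = transport B e f A Y κ Y' := by
  funext w
  simp only [transport, frameComb_swap]

theorem transport_of_isNormal {B : E →L[ℝ] E →L[ℝ] ℝ} {e f : ℂ} {A : ℂ → E →ₗ[ℝ] E}
    {Y κ Y' : ℂ → E} {w : ℂ} {x : E} (h : IsNormal B e f Y w x) :
    transport B e f A Y κ Y' w x = A w x := by
  rw [transport_apply, frameComb_of_isNormal h, frameComb_of_isNormal h, zero_add, sub_zero]

theorem IsothermicLift.smooth_t {B : E →L[ℝ] E →L[ℝ] ℝ} {U : Set ℂ} {e f : ℂ} {Y κ : ℂ → E}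
    {s t : ℂ → ℝ} (H : IsothermicLift B U e f Y κ s t) (hB : ∀ x y, B x y = B y x) :
    ContDiffOn ℝ ∞ t U := by
  have h := (contDiffOn_const (c := (-1 / 2 : ℝ))).mul (smooth_form B
    (smooth_lap H.isOpen H.smooth e f) (smooth_pd H.isOpen H.smooth_right e))
  refine h.congr fun w hw => ?_
  change t w = -1 / 2 * B (lap e f Y w) (pd e (pd f Y) w)
  rw [H.mixed w hw, map_smul, hB, H.form_point_lap hB hw, smul_eq_mul]
  ring

theorem IsothermicLift.smooth_frameComb {B : E →L[ℝ] E →L[ℝ] ℝ} {U : Set ℂ} {e f : ℂ}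
    {Y κ Y' : ℂ → E} {s t : ℂ → ℝ} (H : IsothermicLift B U e f Y κ s t)
    (hB : ∀ x y, B x y = B y x) (hY' : ContDiffOn ℝ ∞ Y' U) {ξ : ℂ → E}
    (hξ : ContDiffOn ℝ ∞ ξ U) : ContDiffOn ℝ ∞ (fun w => frameComb B e f Y κ Y' w (ξ w)) U := by
  have hU := H.isOpen
  have hL := smooth_form B (smooth_lap hU H.smooth e f) hξ
  have hk := smooth_form B (H.smooth_kappa hB) (H.smooth_kappa hB)
  have hY := smooth_form B H.smooth hξ
  exact smooth_add (smooth_add (smooth_add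
    (smooth_smul ((contDiffOn_const.mul hL).sub ((contDiffOn_const.mul hk).mul hY)) hY')
    (smooth_smul (smooth_form B H.smooth_left hξ) (smooth_pd hU hY' e)))
    (smooth_smul (smooth_form B H.smooth_right hξ) (smooth_pd hU hY' f)))
    (smooth_smul (contDiffOn_const.mul hY) (smooth_lap hU hY' e f))

/-- The derivative of `Y_ee + Y_ff` paired with a normal vector. -/
theorem IsothermicLift.form_pd_lap {B : E →L[ℝ] E →L[ℝ] ℝ} {U : Set ℂ} {e f : ℂ} {Y κ : ℂ → E}
    {s t : ℂ → ℝ} {w : ℂ} (H : IsothermicLift B U e f Y κ s t) (hB : ∀ x y, B x y = B y x)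
    (hw : w ∈ U) {n : E} (hn : IsNormal B e f Y w n) :
    B (pd e (lap e f Y) w) n = 4 * B (pd e κ w) n := by
  have hU := H.isOpen
  -- Eliminating Y_ee rather than Y_ff makes the third derivative ∂_e Y_ff = ∂_f(tY) a combination
  -- of Y and Y_f. Against a normal vector only the derivative of κ survives.
  have hlap : ∀ w ∈ U, lap e f Y w =
      (2 : ℝ) • pd f (pd f Y) w + (-2 * s w) • Y w + (4 : ℝ) • κ w := by
    intro w hw
    rw [H.ff_eq hw]
    module
  have h2 : pd e (pd f (pd f Y)) w = pd f t w • Y w + t w • pd f Y w := by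
    rw [pd_comm hU H.smooth_right hw, pd_congr hU H.mixed hw f,
      pd_smul hU (H.smooth_t hB) H.smooth hw]
  have hs : ContDiffOn ℝ ∞ (fun w => -2 * s w) U := contDiffOn_const.mul (H.smooth_s hB)
  have c2 : ContDiffOn ℝ ∞ (fun _ : ℂ => (2 : ℝ)) U := contDiffOn_const
  have c4 : ContDiffOn ℝ ∞ (fun _ : ℂ => (4 : ℝ)) U := contDiffOn_const
  have hκ := H.smooth_kappa hB
  rw [pd_congr hU hlap hw e,
    pd_add hU (smooth_add (smooth_smul c2 H.smooth_ff) (smooth_smul hs H.smooth))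
      (smooth_smul c4 hκ) hw,
    pd_add hU (smooth_smul c2 H.smooth_ff) (smooth_smul hs H.smooth) hw,
    pd_smul hU c2 H.smooth_ff hw, pd_smul hU hs H.smooth hw, pd_smul hU c4 hκ hw, h2, pd_const,
    pd_const]
  simp only [map_add, map_smul, map_zero, zero_smul, zero_apply, add_apply, smul_apply, smul_eq_mul, hn.point,
    hn.left, hn.right]
  ring

theorem NormalCorr.swap {B : E →L[ℝ] E →L[ℝ] ℝ} {U : Set ℂ} {e f : ℂ} {A : ℂ → E →ₗ[ℝ] E}
    {Y κ Y' κ' : ℂ → E} (C : NormalCorr B U e f A Y κ Y' κ') :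
    NormalCorr B U f e A Y (fun w => -κ w) Y' (fun w => -κ' w) where
  map_normal w hw x hx := (C.map_normal w hw x hx.swap).swap
  surj w hw x' hx' := by
    obtain ⟨x, hx, h⟩ := C.surj w hw x' hx'.swap
    exact ⟨x, hx.swap, h⟩
  isometry w hw x hx y hy := C.isometry w hw x hx.swap y hy.swap
  hopf w hw x hx := by simpa using C.hopf w hw x hx.swap
  smooth ξ h hξ := C.smooth ξ h fun w hw => (hξ w hw).swap
  connection_left ξ h hξ w hw n hn :=
    C.connection_right ξ h (fun w hw => (hξ w hw).swap) w hw n hn.swap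
  connection_right ξ h hξ w hw n hn :=
    C.connection_left ξ h (fun w hw => (hξ w hw).swap) w hw n hn.swap

namespace SpectralPair

variable {B : E →L[ℝ] E →L[ℝ] ℝ} {U : Set ℂ} {e f : ℂ} {a : ℝ} {A : ℂ → E →ₗ[ℝ] E}
  {Y κ Y' κ' : ℂ → E} {s t s' t' : ℂ → ℝ} {w : ℂ}

theorem swap (Q : SpectralPair B U e f a A Y κ s t Y' κ' s' t') (hB : ∀ x y, B x y = B y x) :
    SpectralPair B U f e (-a) A Y (fun w => -κ w) (fun w => -s w) t Y' (fun w => -κ' w)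
      (fun w => -s' w) t' where
  source := Q.source.swap hB
  target := Q.target.swap hB
  corr := Q.corr.swap
  re_eq w hw := by rw [Q.re_eq w hw, neg_add]
  im_eq := Q.im_eq

variable (Q : SpectralPair B U e f a A Y κ s t Y' κ' s' t')
  (hB : ∀ x y, B x y = B y x) (hN : ∀ x, (∀ y, B x y = 0) → x = 0)

include Q hB hN

/-- Both sides are normal and pair equally with all normal vectors, where the form is nondegenerate.
-/
theorem map_kappa (hw : w ∈ U) : A w (κ w) = κ' w := by
  have hk := Q.source.kappa_normal hB hw
  refine sub_eq_zero.1 (Q.target.eq_zero_of_normal hB hN hw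
    ((Q.corr.map_normal w hw _ hk).sub (Q.target.kappa_normal hB hw)) fun n' hn' => ?_)
  obtain ⟨n, hn, rfl⟩ := Q.corr.surj w hw n' hn'
  rw [map_sub, sub_apply, Q.corr.isometry w hw _ hk n hn, Q.corr.hopf w hw n hn, sub_self]

theorem form_kappa (hw : w ∈ U) : B (κ' w) (κ' w) = B (κ w) (κ w) := by
  have hk := Q.source.kappa_normal hB hw
  rw [← Q.map_kappa hB hN hw, Q.corr.isometry w hw _ hk _ hk]

omit hN in
theorem form_point_transport (hw : w ∈ U) (x : E) :
    B (Y' w) (transport B e f A Y κ Y' w x) = B (Y w) x := by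
  have h := Q.corr.map_normal w hw _ (Q.source.isNormal_sub_frameComb hB hw x)
  rw [transport_apply, map_add, h.point, Q.target.form_point_frameComb hB hw, add_zero]

omit hN in
theorem form_left_transport (hw : w ∈ U) (x : E) :
    B (pd e Y' w) (transport B e f A Y κ Y' w x) = B (pd e Y w) x := by
  have h := Q.corr.map_normal w hw _ (Q.source.isNormal_sub_frameComb hB hw x)
  rw [transport_apply, map_add, h.left, Q.target.form_left_frameComb hB hw, add_zero]

omit hN in
theorem form_right_transport (hw : w ∈ U) (x : E) :
    B (pd f Y' w) (transport B e f A Y κ Y' w x) = B (pd f Y w) x := by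
  have h := Q.corr.map_normal w hw _ (Q.source.isNormal_sub_frameComb hB hw x)
  rw [transport_apply, map_add, h.right, Q.target.form_right_frameComb hB hw, add_zero]

theorem form_lap_transport (hw : w ∈ U) (x : E) :
    B (lap e f Y' w) (transport B e f A Y κ Y' w x) = B (lap e f Y w) x := by
  have h := Q.corr.map_normal w hw _ (Q.source.isNormal_sub_frameComb hB hw x)
  rw [transport_apply, map_add, h.lap,
    Q.target.form_lap_frameComb hB (Q.form_kappa hB hN hw) hw, add_zero]

omit hN in
theorem form_normal_transport (hw : w ∈ U) {n : E} (hn : IsNormal B e f Y w n) (x : E) :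
    B (A w n) (transport B e f A Y κ Y' w x) = B n x := by
  rw [transport_apply, map_add,
    IsothermicLift.form_frameComb_normal (Q.corr.map_normal w hw n hn) hB,
    Q.corr.isometry w hw _ hn _ (Q.source.isNormal_sub_frameComb hB hw x), map_sub,
    IsothermicLift.form_frameComb_normal hn hB, zero_add, sub_zero]

/-- A vector is determined by its pairings with the frame and with the normal vectors, and
`transport` preserves these. The formulas for `transport` and its derivative are checked through
this criterion. -/
theorem eq_transport (hw : w ∈ U) {x x' : E} (h0 : B (Y' w) x' = B (Y w) x)
    (h1 : B (pd e Y' w) x' = B (pd e Y w) x) (h2 : B (pd f Y' w) x' = B (pd f Y w) x)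
    (h3 : B (lap e f Y' w) x' = B (lap e f Y w) x)
    (h : ∀ n, IsNormal B e f Y w n → B (A w n) x' = B n x) :
    x' = transport B e f A Y κ Y' w x := by
  refine Q.target.ext_frame hB hN hw ?_ ?_ ?_ ?_ fun n' hn' => ?_
  · rw [Q.form_point_transport hB hw, h0]
  · rw [Q.form_left_transport hB hw, h1]
  · rw [Q.form_right_transport hB hw, h2]
  · rw [Q.form_lap_transport hB hN hw, h3]
  · obtain ⟨n, hn, rfl⟩ := Q.corr.surj w hw n' hn'
    rw [h n hn, Q.form_normal_transport hB hw hn]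

theorem form_transport (hw : w ∈ U) (x y : E) :
    B (transport B e f A Y κ Y' w x) (transport B e f A Y κ Y' w y) = B x y := by
  have hn := Q.source.isNormal_sub_frameComb hB hw x
  have hx : x = frameComb B e f Y κ Y w x + (x - frameComb B e f Y κ Y w x) := by abel
  have h1 : B (transport B e f A Y κ Y' w x) (transport B e f A Y κ Y' w y) =
      B (frameComb B e f Y κ Y w x) y + B (x - frameComb B e f Y κ Y w x) y := by
    rw [transport_apply B e f A Y κ Y' w x, map_add, add_apply,
      Q.form_normal_transport hB hw hn, frameComb_apply, frameComb_apply]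
    simp only [map_add, map_smul, add_apply, smul_apply, Q.form_point_transport hB hw,
      Q.form_left_transport hB hw, Q.form_right_transport hB hw, Q.form_lap_transport hB hN hw]
  rw [h1, ← add_apply, ← map_add, ← hx]

theorem transport_surjective (hw : w ∈ U) (x' : E) :
    ∃ x, transport B e f A Y κ Y' w x = x' := by
  obtain ⟨n, hn, h⟩ := Q.corr.surj w hw _ (Q.target.isNormal_sub_frameComb hB hw x')
  refine ⟨frameComb B e f Y' κ' Y w x' + n, (Q.eq_transport hB hN hw ?_ ?_ ?_ ?_
    fun m hm => ?_).symm⟩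
  · rw [map_add, hn.point, Q.source.form_point_frameComb hB hw, add_zero]
  · rw [map_add, hn.left, Q.source.form_left_frameComb hB hw, add_zero]
  · rw [map_add, hn.right, Q.source.form_right_frameComb hB hw, add_zero]
  · rw [map_add, hn.lap, Q.source.form_lap_frameComb hB (Q.form_kappa hB hN hw).symm hw, add_zero]
  · rw [map_add, IsothermicLift.form_frameComb_normal hm hB, zero_add,
      ← Q.corr.isometry w hw m hm n hn, h, map_sub,
      IsothermicLift.form_frameComb_normal (Q.corr.map_normal w hw m hm) hB, sub_zero]

theorem transport_point (hw : w ∈ U) : transport B e f A Y κ Y' w (Y w) = Y' w := by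
  refine (Q.eq_transport hB hN hw ?_ ?_ ?_ ?_ fun n hn => ?_).symm
  · rw [Q.source.null w hw, Q.target.null w hw]
  · rw [hB, Q.target.form_point_pd hB e hw, hB, Q.source.form_point_pd hB e hw]
  · rw [hB, Q.target.form_point_pd hB f hw, hB, Q.source.form_point_pd hB f hw]
  · rw [hB, Q.target.form_point_lap hB hw, hB, Q.source.form_point_lap hB hw]
  · rw [hB, (Q.corr.map_normal w hw n hn).point, hB, hn.point]

theorem transport_left (hw : w ∈ U) : transport B e f A Y κ Y' w (pd e Y w) = pd e Y' w := by
  refine (Q.eq_transport hB hN hw ?_ ?_ ?_ ?_ fun n hn => ?_).symm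
  · rw [Q.target.form_point_pd hB e hw, Q.source.form_point_pd hB e hw]
  · rw [Q.target.unit_left w hw, Q.source.unit_left w hw]
  · rw [hB, Q.target.ortho w hw, hB, Q.source.ortho w hw]
  · rw [hB, Q.target.form_left_lap hB hw, hB, Q.source.form_left_lap hB hw]
  · rw [hB, (Q.corr.map_normal w hw n hn).left, hB, hn.left]

theorem transport_right (hw : w ∈ U) : transport B e f A Y κ Y' w (pd f Y w) = pd f Y' w := by
  have := (Q.swap hB).transport_left hB hN hw
  rwa [transport_swap] at this

theorem transport_lap (hw : w ∈ U) :
    transport B e f A Y κ Y' w (lap e f Y w) = lap e f Y' w := by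
  refine (Q.eq_transport hB hN hw ?_ ?_ ?_ ?_ fun n hn => ?_).symm
  · rw [Q.target.form_point_lap hB hw, Q.source.form_point_lap hB hw]
  · rw [Q.target.form_left_lap hB hw, Q.source.form_left_lap hB hw]
  · rw [Q.target.form_right_lap hB hw, Q.source.form_right_lap hB hw]
  · rw [Q.target.form_lap_lap hB hw, Q.source.form_lap_lap hB hw, Q.form_kappa hB hN hw]
  · rw [hB, (Q.corr.map_normal w hw n hn).lap, hB, hn.lap]

theorem transport_kappa (hw : w ∈ U) : transport B e f A Y κ Y' w (κ w) = κ' w := by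
  rw [transport_of_isNormal (Q.source.kappa_normal hB hw), Q.map_kappa hB hN hw]

/-- In Y_ee = ΔY/2 - sY + 2κ everything is carried to its counterpart except the coefficient s,
which changes by a. -/
theorem transport_left_left (hw : w ∈ U) :
    transport B e f A Y κ Y' w (pd e (pd e Y) w) = pd e (pd e Y') w + a • Y' w := by
  rw [Q.source.ee_eq hw, Q.target.ee_eq hw, Q.re_eq w hw, map_add, map_sub, map_smul, map_smul,
    map_smul, Q.transport_point hB hN hw, Q.transport_lap hB hN hw, Q.transport_kappa hB hN hw]
  module

theorem transport_right_right (hw : w ∈ U) :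
    transport B e f A Y κ Y' w (pd f (pd f Y) w) = pd f (pd f Y') w - a • Y' w := by
  have := (Q.swap hB).transport_left_left hB hN hw
  rw [transport_swap] at this
  rw [this]
  module

omit hN in
theorem smooth_transport {ξ : ℂ → E} (hξ : ContDiffOn ℝ ∞ ξ U) :
    ContDiffOn ℝ ∞ (fun w => transport B e f A Y κ Y' w (ξ w)) U :=
  smooth_add (Q.source.smooth_frameComb hB Q.target.smooth hξ)
    (Q.corr.smooth _ (smooth_sub hξ (Q.source.smooth_frameComb hB Q.source.smooth hξ))
      fun w hw => Q.source.isNormal_sub_frameComb hB hw (ξ w))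

/-- By `form_pd_lap` both sides are four times the normal derivative of the Hopf differential, and A
respects the normal connection and carries κ to κ'. -/
theorem form_pd_lap_normal (hw : w ∈ U) {n : E} (hn : IsNormal B e f Y w n) :
    B (A w n) (pd e (lap e f Y') w) = B n (pd e (lap e f Y) w) := by
  have h := Q.corr.connection_left κ (Q.source.smooth_kappa hB)
    (fun w hw => Q.source.kappa_normal hB hw) w hw n hn
  rw [pd_congr Q.source.isOpen (fun w hw => Q.map_kappa hB hN hw) hw e] at h
  rw [hB, Q.target.form_pd_lap hB hw (Q.corr.map_normal w hw n hn), h, hB n,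
    Q.source.form_pd_lap hB hw hn]

/-- The correction is due to ⟨Y_e, (ΔY)_e⟩ = -⟨Y_ee, ΔY⟩ = -8⟨κ, κ⟩ - 2s, the one pairing with the
frame that contains s. -/
theorem transport_pd_lap (hw : w ∈ U) : pd e (lap e f Y') w + (2 * a) • pd e Y' w =
    transport B e f A Y κ Y' w (pd e (lap e f Y) w) := by
  have hU := Q.source.isOpen
  have hLY := smooth_lap hU Q.source.smooth e f
  have hLY' := smooth_lap hU Q.target.smooth e f
  have eL : ∀ {Y κ : ℂ → E} {s t : ℂ → ℝ}, IsothermicLift B U e f Y κ s t →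
      B (pd e (pd e Y) w) (lap e f Y w) = 8 * B (κ w) (κ w) + 2 * s w := by
    intro Y κ s t H
    rw [H.ee_eq hw]
    simp only [map_add, map_sub, map_smul, add_apply, sub_apply, smul_apply, smul_eq_mul,
      H.form_lap_lap hB hw, H.form_point_lap hB hw]
    rw [hB (κ w) (lap e f Y w), H.lap_kappa w hw]
    ring
  refine Q.eq_transport hB hN hw ?_ ?_ ?_ ?_ fun n hn => ?_
  · have h1 := pd_form_eq_zero B hU Q.source.smooth hLY
      (fun w hw => Q.source.form_point_lap hB hw) hw e
    have h2 := pd_form_eq_zero B hU Q.target.smooth hLY'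
      (fun w hw => Q.target.form_point_lap hB hw) hw e
    rw [Q.source.form_left_lap hB hw] at h1
    rw [Q.target.form_left_lap hB hw] at h2
    rw [map_add, map_smul, Q.target.form_point_pd hB e hw, smul_zero]
    linarith
  · have h1 := pd_form_eq_zero B hU Q.source.smooth_left hLY
      (fun w hw => Q.source.form_left_lap hB hw) hw e
    have h2 := pd_form_eq_zero B hU Q.target.smooth_left hLY'
      (fun w hw => Q.target.form_left_lap hB hw) hw e
    rw [eL Q.source] at h1
    rw [eL Q.target, Q.form_kappa hB hN hw, Q.re_eq w hw] at h2
    rw [map_add, map_smul, Q.target.unit_left w hw, smul_eq_mul]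
    linarith
  · have h1 := pd_form_eq_zero B hU Q.source.smooth_right hLY
      (fun w hw => Q.source.form_right_lap hB hw) hw e
    have h2 := pd_form_eq_zero B hU Q.target.smooth_right hLY'
      (fun w hw => Q.target.form_right_lap hB hw) hw e
    rw [Q.source.mixed w hw, map_smul, smul_apply, Q.source.form_point_lap hB hw] at h1
    rw [Q.target.mixed w hw, map_smul, smul_apply, Q.target.form_point_lap hB hw,
      Q.im_eq w hw] at h2
    rw [map_add, map_smul, hB (pd f Y' w) (pd e Y' w), Q.target.ortho w hw, smul_zero]
    linarith
  · have h1 := pd_form B hU hLY hLY hw e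
    have h2 := pd_form B hU hLY' hLY' hw e
    have h3 : pd e (fun w => B (lap e f Y' w) (lap e f Y' w)) w =
        pd e (fun w => B (lap e f Y w) (lap e f Y w)) w := by
      refine pd_congr hU (fun w hw => ?_) hw e
      rw [Q.source.form_lap_lap hB hw, Q.target.form_lap_lap hB hw, Q.form_kappa hB hN hw]
    rw [hB] at h1 h2
    rw [map_add, map_smul, hB (lap e f Y' w) (pd e Y' w), Q.target.form_left_lap hB hw, smul_zero]
    linarith
  · rw [map_add, map_smul, hB _ (pd e Y' w), (Q.corr.map_normal w hw n hn).left, smul_zero,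
      add_zero, Q.form_pd_lap_normal hB hN hw hn]

/-- For normal fields there is no error term: the tangential part of dν is governed by ⟨κ, ν⟩ and
the derivative of ΔY, whose pairings with ν are preserved. These fields serve as test fields for
`pd_left_transport`. -/
theorem pd_left_normal {ν : ℂ → E} (hν : ContDiffOn ℝ ∞ ν U)
    (hn : ∀ w ∈ U, IsNormal B e f Y w (ν w)) (hw : w ∈ U) :
    pd e (fun w => A w (ν w)) w = transport B e f A Y κ Y' w (pd e ν w) := by
  have hU := Q.source.isOpen
  have hn' := fun w hw => Q.corr.map_normal w hw _ (hn w hw)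
  have hν' := Q.corr.smooth ν hν hn
  refine Q.eq_transport hB hN hw ?_ ?_ ?_ ?_ fun n h => ?_
  · have h1 := pd_form_eq_zero B hU Q.source.smooth hν (fun w hw => (hn w hw).point) hw e
    have h2 := pd_form_eq_zero B hU Q.target.smooth hν' (fun w hw => (hn' w hw).point) hw e
    rw [(hn w hw).left] at h1
    rw [(hn' w hw).left] at h2
    linarith
  · have h1 := pd_form_eq_zero B hU Q.source.smooth_left hν (fun w hw => (hn w hw).left) hw e
    have h2 := pd_form_eq_zero B hU Q.target.smooth_left hν' (fun w hw => (hn' w hw).left) hw e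
    have h3 := Q.corr.hopf w hw _ (hn w hw)
    rw [Q.source.ee_eq hw] at h1
    rw [Q.target.ee_eq hw] at h2
    simp only [map_add, map_sub, map_smul, add_apply, sub_apply, smul_apply, smul_eq_mul,
      (hn w hw).point, (hn w hw).lap, (hn' w hw).point, (hn' w hw).lap] at h1 h2
    linarith
  · have h1 := pd_form_eq_zero B hU Q.source.smooth_right hν (fun w hw => (hn w hw).right) hw e
    have h2 := pd_form_eq_zero B hU Q.target.smooth_right hν' (fun w hw => (hn' w hw).right) hw e
    rw [Q.source.mixed w hw, map_smul, smul_apply, (hn w hw).point, smul_zero] at h1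
    rw [Q.target.mixed w hw, map_smul, smul_apply, (hn' w hw).point, smul_zero] at h2
    linarith
  · have h1 := pd_form_eq_zero B hU (smooth_lap hU Q.source.smooth e f) hν
      (fun w hw => (hn w hw).lap) hw e
    have h2 := pd_form_eq_zero B hU (smooth_lap hU Q.target.smooth e f) hν'
      (fun w hw => (hn' w hw).lap) hw e
    rw [hB, ← Q.form_pd_lap_normal hB hN hw (hn w hw), hB] at h1
    linarith
  · rw [hB, Q.corr.connection_left ν hν hn w hw n h, hB]

/-- The derivative of the transport of a vector field. -/
theorem pd_left_transport {ξ : ℂ → E} (hξ : ContDiffOn ℝ ∞ ξ U) (hw : w ∈ U) :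
    pd e (fun w => transport B e f A Y κ Y' w (ξ w)) w =
      transport B e f A Y κ Y' w (pd e ξ w) +
        a • (B (Y w) (ξ w) • pd e Y' w - B (pd e Y w) (ξ w) • Y' w) := by
  have hU := Q.source.isOpen
  have hG := Q.smooth_transport hB hξ
  -- Differentiating ⟨X', Gξ⟩ = ⟨X, ξ⟩ for each frame or normal field X with counterpart X' reduces
  -- the derivative of Gξ to the known ones of the frame.
  have hd : ∀ {X X' : ℂ → E}, ContDiffOn ℝ ∞ X U → ContDiffOn ℝ ∞ X' U →
      (∀ w ∈ U, B (X' w) (transport B e f A Y κ Y' w (ξ w)) = B (X w) (ξ w)) →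
      B (pd e X' w) (transport B e f A Y κ Y' w (ξ w)) +
        B (X' w) (pd e (fun w => transport B e f A Y κ Y' w (ξ w)) w) =
      B (pd e X w) (ξ w) + B (X w) (pd e ξ w) := by
    intro X X' hX hX' h
    rw [← pd_form B hU hX' hG hw, ← pd_form B hU hX hξ hw]
    exact pd_congr hU h hw e
  rw [← sub_eq_iff_eq_add]
  have eY := hB (pd e Y' w) (Y' w)
  have fY := hB (pd f Y' w) (Y' w)
  have fe := hB (pd f Y' w) (pd e Y' w)
  have LY := hB (lap e f Y' w) (Y' w)
  have Le := hB (lap e f Y' w) (pd e Y' w)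
  rw [Q.target.form_point_pd hB _ hw] at eY fY
  rw [Q.target.ortho w hw] at fe
  rw [Q.target.form_point_lap hB hw] at LY
  rw [Q.target.form_left_lap hB hw] at Le
  refine Q.eq_transport hB hN hw ?_ ?_ ?_ ?_ fun n hn => ?_
  · have h1 := hd Q.source.smooth Q.target.smooth fun w hw => Q.form_point_transport hB hw _
    rw [Q.form_left_transport hB hw] at h1
    simp only [map_sub, map_smul, smul_eq_mul, Q.target.null w hw, Q.target.form_point_pd hB e hw]
    linarith
  · have h1 := hd Q.source.smooth_left Q.target.smooth_left
      fun w hw => Q.form_left_transport hB hw _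
    have h2 : B (pd e (pd e Y') w) (transport B e f A Y κ Y' w (ξ w)) =
        B (pd e (pd e Y) w) (ξ w) - a * B (Y w) (ξ w) := by
      rw [← Q.form_transport hB hN hw (pd e (pd e Y) w), Q.transport_left_left hB hN hw, map_add,
        map_smul, add_apply, smul_apply, Q.form_point_transport hB hw, smul_eq_mul]
      ring
    simp only [map_sub, map_smul, smul_eq_mul, eY, Q.target.unit_left w hw]
    linarith
  · have h1 := hd Q.source.smooth_right Q.target.smooth_right
      fun w hw => Q.form_right_transport hB hw _
    rw [Q.source.mixed w hw, Q.target.mixed w hw, Q.im_eq w hw, map_smul, map_smul, smul_apply,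
      smul_apply, Q.form_point_transport hB hw] at h1
    simp only [map_sub, map_smul, smul_eq_mul, fY, fe]
    linarith
  · have h1 := hd (smooth_lap hU Q.source.smooth e f) (smooth_lap hU Q.target.smooth e f)
      fun w hw => Q.form_lap_transport hB hN hw _
    have h2 : B (pd e (lap e f Y') w) (transport B e f A Y κ Y' w (ξ w)) =
        B (pd e (lap e f Y) w) (ξ w) - 2 * a * B (pd e Y w) (ξ w) := by
      rw [← Q.form_transport hB hN hw (pd e (lap e f Y) w), ← Q.transport_pd_lap hB hN hw, map_add,
        map_smul, add_apply, smul_apply, Q.form_left_transport hB hw, smul_eq_mul]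
      ring
    simp only [map_sub, map_smul, smul_eq_mul, LY, Le]
    linarith
  -- The vector n is normal at one point only; its normal projection at the other points extends it
  -- to a normal field.
  · have hν : ContDiffOn ℝ ∞ (fun w => n - frameComb B e f Y κ Y w n) U :=
      smooth_sub contDiffOn_const
        (Q.source.smooth_frameComb hB Q.source.smooth (ξ := fun _ => n) contDiffOn_const)
    have hνn := fun w hw => Q.source.isNormal_sub_frameComb hB (w := w) hw n
    have hνw : n - frameComb B e f Y κ Y w n = n := by
      rw [frameComb_of_isNormal hn, sub_zero]
    have h1 := hd hν (Q.corr.smooth _ hν hνn) fun w hw => Q.form_normal_transport hB hw (hνn w hw) _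
    rw [Q.pd_left_normal hB hN hν hνn hw, Q.form_transport hB hN hw] at h1
    simp only [hνw] at h1
    have hn' := Q.corr.map_normal w hw n hn
    have nY := hB (A w n) (Y' w)
    have ne := hB (A w n) (pd e Y' w)
    rw [hn'.point] at nY
    rw [hn'.left] at ne
    simp only [map_sub, map_smul, smul_eq_mul, nY, ne]
    linarith

theorem pd_right_transport {ξ : ℂ → E} (hξ : ContDiffOn ℝ ∞ ξ U) (hw : w ∈ U) :
    pd f (fun w => transport B e f A Y κ Y' w (ξ w)) w =
      transport B e f A Y κ Y' w (pd f ξ w) -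
        a • (B (Y w) (ξ w) • pd f Y' w - B (pd f Y w) (ξ w) • Y' w) := by
  have := (Q.swap hB).pd_left_transport hB hN hξ hw
  rw [transport_swap] at this
  rw [this]
  module

end SpectralPair

end Spectral

/-! ### Identification of the normal bundles of the two polar surfaces -/

section PolarSpectral

variable {E : Type*} [NormedAddCommGroup E] [NormedSpace ℝ E]

/-- The identification of the normal bundles of the polar surfaces of a surface and of its spectral
transform. -/
noncomputable def polarMap (B : E →L[ℝ] E →L[ℝ] ℝ) (e f : ℂ) (a : ℝ) (A : ℂ → E →ₗ[ℝ] E)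
    (Y κ Y' ψ : ℂ → E) (w : ℂ) : E →ₗ[ℝ] E :=
  transport B e f A Y κ Y' w +
    -- For x normal to Ψ, ⟨ΔΨ', Gx⟩ = 2a⟨Y, x⟩, while ⟨ΔΨ', ψ'⟩ = -4ρ. The factor a/(2ρ) makes the
    -- sum orthogonal to ΔΨ'.
    ((a * (2 * B (κ w) (ψ w))⁻¹) • (B (Y w)).toLinearMap).smulRight (A w (ψ w))

theorem polarMap_apply (B : E →L[ℝ] E →L[ℝ] ℝ) (e f : ℂ) (a : ℝ) (A : ℂ → E →ₗ[ℝ] E)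
    (Y κ Y' ψ : ℂ → E) (w : ℂ) (x : E) : polarMap B e f a A Y κ Y' ψ w x =
      transport B e f A Y κ Y' w x +
        (a * (2 * B (κ w) (ψ w))⁻¹ * B (Y w) x) • A w (ψ w) := rfl

namespace SpectralPair

variable {B : E →L[ℝ] E →L[ℝ] ℝ} {U : Set ℂ} {e f : ℂ} {a : ℝ} {A : ℂ → E →ₗ[ℝ] E}
  {Y κ Y' κ' ψ : ℂ → E} {s t s' t' : ℂ → ℝ} {w : ℂ}

variable (Q : SpectralPair B U e f a A Y κ s t Y' κ' s' t') (P : IsParallelNull B U e f Y κ ψ)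
  (hB : ∀ x y, B x y = B y x) (hN : ∀ x, (∀ y, B x y = 0) → x = 0)

include Q

omit P in
/-- The transform of a parallel section. -/
theorem isParallelSection_map (P : IsParallelSection B U e f Y ψ) :
    IsParallelSection B U e f Y' (fun w => A w (ψ w)) where
  smooth := Q.corr.smooth ψ P.smooth P.normal
  normal w hw := Q.corr.map_normal w hw _ (P.normal w hw)
  parallel_left w hw n' hn' := by
    obtain ⟨n, hn, rfl⟩ := Q.corr.surj w hw n' hn'
    rw [Q.corr.connection_left ψ P.smooth P.normal w hw n hn, P.parallel_left w hw n hn]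
  parallel_right w hw n' hn' := by
    obtain ⟨n, hn, rfl⟩ := Q.corr.surj w hw n' hn'
    rw [Q.corr.connection_right ψ P.smooth P.normal w hw n hn, P.parallel_right w hw n hn]

include P

theorem pairing_eq (hw : w ∈ U) : B (κ' w) (A w (ψ w)) = B (κ w) (ψ w) :=
  Q.corr.hopf w hw _ (P.normal w hw)

/-- The transform of a parallel null section. -/
theorem isParallelNull_map : IsParallelNull B U e f Y' κ' (fun w => A w (ψ w)) where
  toIsParallelSection := Q.isParallelSection_map P.toIsParallelSection
  null w hw := by
    rw [Q.corr.isometry w hw _ (P.normal w hw) _ (P.normal w hw), P.null w hw]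
  pairing_ne w hw := by
    rw [Q.pairing_eq P hw]
    exact P.pairing_ne w hw

theorem logPd_eq (h : ℂ) (hw : w ∈ U) :
    logPd B κ' (fun w => A w (ψ w)) h w = logPd B κ ψ h w := by
  rw [logPd, logPd, Q.pairing_eq P hw,
    pd_congr Q.source.isOpen (fun w hw => Q.pairing_eq P hw) hw h]

theorem pd_logPd_eq (h : ℂ) (hw : w ∈ U) :
    pd h (logPd B κ' (fun w => A w (ψ w)) h) w = pd h (logPd B κ ψ h) w :=
  pd_congr Q.source.isOpen (fun _ hw => Q.logPd_eq P h hw) hw h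

theorem transport_polarLift (hw : w ∈ U) : transport B e f A Y κ Y' w (polarLift B κ ψ w) =
    polarLift B κ' (fun w => A w (ψ w)) w := by
  rw [polarLift, polarLift, Q.pairing_eq P hw, map_smul, transport_of_isNormal (P.normal w hw)]

include hB hN

theorem transport_polarLift_left (hw : w ∈ U) :
    transport B e f A Y κ Y' w (pd e (polarLift B κ ψ) w) =
      pd e (polarLift B κ' (fun w => A w (ψ w))) w := by
  rw [P.polarLift_left Q.source hB hN hw,
    (Q.isParallelNull_map P).polarLift_left Q.target hB hN hw, Q.logPd_eq P e hw, map_sub, map_smul,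
    map_sub, Q.transport_point hB hN hw, Q.transport_left hB hN hw, Q.transport_polarLift P hw]

theorem transport_polarLift_right (hw : w ∈ U) :
    transport B e f A Y κ Y' w (pd f (polarLift B κ ψ) w) =
      pd f (polarLift B κ' (fun w => A w (ψ w))) w := by
  rw [P.polarLift_right Q.source hB hN hw,
    (Q.isParallelNull_map P).polarLift_right Q.target hB hN hw, Q.logPd_eq P f hw, map_sub,
    map_smul, map_add, Q.transport_point hB hN hw, Q.transport_right hB hN hw,
    Q.transport_polarLift P hw]

/-- Ψ_ee contains -Y_ee and Ψ_ff contains +Y_ff, and transport shifts Y_ee and Y_ff by +aY' and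
-aY'. Both errors are therefore -aY': they add up in ΔΨ and cancel in the Hopf differential. -/
theorem transport_polarLift_left_left (hw : w ∈ U) :
    transport B e f A Y κ Y' w (pd e (pd e (polarLift B κ ψ)) w) =
      pd e (pd e (polarLift B κ' (fun w => A w (ψ w)))) w - a • Y' w := by
  rw [P.polarLift_left_left Q.source hB hN hw,
    (Q.isParallelNull_map P).polarLift_left_left Q.target hB hN hw, Q.logPd_eq P e hw,
    Q.pd_logPd_eq P e hw]
  simp only [map_sub, map_add, map_smul, Q.transport_point hB hN hw, Q.transport_left hB hN hw,
    Q.transport_polarLift P hw, Q.transport_left_left hB hN hw]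
  module

theorem transport_polarLift_right_right (hw : w ∈ U) :
    transport B e f A Y κ Y' w (pd f (pd f (polarLift B κ ψ)) w) =
      pd f (pd f (polarLift B κ' (fun w => A w (ψ w)))) w - a • Y' w := by
  rw [P.polarLift_right_right Q.source hB hN hw,
    (Q.isParallelNull_map P).polarLift_right_right Q.target hB hN hw, Q.logPd_eq P f hw,
    Q.pd_logPd_eq P f hw]
  simp only [map_sub, map_add, map_smul, Q.transport_point hB hN hw, Q.transport_right hB hN hw,
    Q.transport_polarLift P hw, Q.transport_right_right hB hN hw]
  module

omit Q
include P

/-- The pairing of the section with the second derivatives of the lift of its polar surface. -/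
theorem _root_.PolarIsothermic.IsParallelNull.form_polarLift_second
    (H : IsothermicLift B U e f Y κ s t) (hw : w ∈ U) :
    B (pd e (pd e (polarLift B κ ψ)) w) (ψ w) = -2 * B (κ w) (ψ w) ∧
    B (pd f (pd f (polarLift B κ ψ)) w) (ψ w) = -2 * B (κ w) (ψ w) := by
  have hn := P.normal w hw
  have h2 : B (polarLift B κ ψ w) (ψ w) = 0 := by
    rw [polarLift, map_smul, smul_apply, P.null w hw, smul_zero]
  rw [P.polarLift_left_left H hB hN hw, P.polarLift_right_right H hB hN hw]
  simp only [map_sub, map_add, map_smul, sub_apply, add_apply, smul_apply, smul_eq_mul,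
    hn.point, hn.left, hn.right, h2, P.form_ee H hB hw, P.form_ff H hB hw]
  constructor <;> ring

theorem _root_.PolarIsothermic.IsParallelNull.form_polarLift_first
    (H : IsothermicLift B U e f Y κ s t) (hw : w ∈ U) :
    B (polarLift B κ ψ w) (ψ w) = 0 ∧ B (pd e (polarLift B κ ψ) w) (ψ w) = 0 ∧
    B (pd f (polarLift B κ ψ) w) (ψ w) = 0 := by
  have hn := P.normal w hw
  have h2 : B (polarLift B κ ψ w) (ψ w) = 0 := by
    rw [polarLift, map_smul, smul_apply, P.null w hw, smul_zero]
  rw [P.polarLift_left H hB hN hw, P.polarLift_right H hB hN hw]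
  simp only [map_sub, map_add, map_smul, sub_apply, add_apply, smul_apply, smul_eq_mul,
    hn.point, hn.left, hn.right, h2]
  refine ⟨trivial, ?_, ?_⟩ <;> ring

/-- Orthogonality to Ψ and to Ψ_e = p(Y - Ψ) - Y_e says ⟨Y_e, x⟩ = p⟨Y, x⟩, and similarly for f.
These proportionalities cancel the error term in the derivative of `transport`. -/
theorem _root_.PolarIsothermic.IsParallelNull.form_of_isNormal_polarLift
    (H : IsothermicLift B U e f Y κ s t) (hw : w ∈ U) {x : E}
    (hx : IsNormal B e f (polarLift B κ ψ) w x) :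
    B (ψ w) x = 0 ∧ B (pd e Y w) x = logPd B κ ψ e w * B (Y w) x ∧
    B (pd f Y w) x = logPd B κ ψ f w * B (Y w) x ∧ B (pd e ψ w) x = 0 ∧ B (pd f ψ w) x = 0 := by
  have h0 := P.pairing_ne w hw
  have hψ : ψ w = (2 * B (κ w) (ψ w)) • polarLift B κ ψ w := by
    rw [polarLift, smul_smul, mul_inv_cancel₀ (mul_ne_zero two_ne_zero h0), one_smul]
  have h1 := hx.left
  have h2 := hx.right
  rw [P.polarLift_left H hB hN hw] at h1
  rw [P.polarLift_right H hB hN hw] at h2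
  simp only [map_sub, map_add, map_smul, sub_apply, add_apply, smul_apply, smul_eq_mul,
    hx.point] at h1 h2
  refine ⟨?_, by linarith, by linarith, ?_, ?_⟩
  · rw [hψ, map_smul, smul_apply, hx.point, smul_zero]
  · rw [P.pd_left H hB hN hw, P.pd_pairing H hB e hw]
    simp only [map_sub, map_smul, sub_apply, smul_apply, smul_eq_mul]
    linear_combination (2 * B (κ w) (ψ w)) * h1
  · rw [P.pd_right H hB hN hw, P.pd_pairing H hB f hw]
    simp only [map_add, map_smul, add_apply, smul_apply, smul_eq_mul]
    linear_combination (2 * B (κ w) (ψ w)) * h2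

include Q

theorem isNormal_polarMap (hw : w ∈ U) {x : E} (hx : IsNormal B e f (polarLift B κ ψ) w x) :
    IsNormal B e f (polarLift B κ' (fun w => A w (ψ w))) w
      (polarMap B e f a A Y κ Y' ψ w x) := by
  have P' := Q.isParallelNull_map P
  obtain ⟨f0, f1, f2⟩ := P'.form_polarLift_first hB hN Q.target hw
  obtain ⟨g1, g2⟩ := P'.form_polarLift_second hB hN Q.target hw
  have h0 := P.pairing_ne w hw
  rw [polarMap_apply]
  refine ⟨?_, ?_, ?_, ?_⟩
  · rw [map_add, map_smul, f0, ← Q.transport_polarLift P hw, Q.form_transport hB hN hw, hx.point,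
      smul_zero, add_zero]
  · rw [map_add, map_smul, f1, ← Q.transport_polarLift_left P hB hN hw,
      Q.form_transport hB hN hw, hx.left, smul_zero, add_zero]
  · rw [map_add, map_smul, f2, ← Q.transport_polarLift_right P hB hN hw,
      Q.form_transport hB hN hw, hx.right, smul_zero, add_zero]
  · have h1 := Q.form_transport hB hN hw (lap e f (polarLift B κ ψ) w) x
    rw [hx.lap, lap, map_add, Q.transport_polarLift_left_left P hB hN hw,
      Q.transport_polarLift_right_right P hB hN hw] at h1
    simp only [map_add, map_sub, map_smul, add_apply, sub_apply, smul_apply, smul_eq_mul,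
      Q.form_point_transport hB hw] at h1
    rw [map_add, map_smul, lap, map_add, add_apply, add_apply, g1, g2, Q.pairing_eq P hw,
      smul_eq_mul]
    have h2 : a * (2 * B (κ w) (ψ w))⁻¹ * B (Y w) x *
        (-2 * B (κ w) (ψ w) + -2 * B (κ w) (ψ w)) = -2 * a * B (Y w) x := by
      field_simp
      ring
    linarith

theorem polarMap_surj (hw : w ∈ U) {x' : E}
    (hx' : IsNormal B e f (polarLift B κ' (fun w => A w (ψ w))) w x') :
    ∃ x, IsNormal B e f (polarLift B κ ψ) w x ∧ polarMap B e f a A Y κ Y' ψ w x = x' := by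
  obtain ⟨y, rfl⟩ := Q.transport_surjective hB hN hw x'
  obtain ⟨f0, f1, f2⟩ := P.form_polarLift_first hB hN Q.source hw
  obtain ⟨g1, g2⟩ := P.form_polarLift_second hB hN Q.source hw
  have h0 := P.pairing_ne w hw
  -- As ⟨Y, ψ⟩ = 0 and `transport` takes ψ to ψ', subtracting this multiple of ψ undoes the
  -- correction in `polarMap`.
  refine ⟨y - (a * (2 * B (κ w) (ψ w))⁻¹ * B (Y w) y) • ψ w, ⟨?_, ?_, ?_, ?_⟩, ?_⟩
  · rw [map_sub, map_smul, f0, ← Q.form_transport hB hN hw, Q.transport_polarLift P hw, hx'.point,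
      smul_zero, sub_zero]
  · rw [map_sub, map_smul, f1, ← Q.form_transport hB hN hw,
      Q.transport_polarLift_left P hB hN hw, hx'.left, smul_zero, sub_zero]
  · rw [map_sub, map_smul, f2, ← Q.form_transport hB hN hw,
      Q.transport_polarLift_right P hB hN hw, hx'.right, smul_zero, sub_zero]
  · have h1 := Q.form_transport hB hN hw (lap e f (polarLift B κ ψ) w) y
    have h3 := hx'.lap
    rw [lap, map_add, Q.transport_polarLift_left_left P hB hN hw,
      Q.transport_polarLift_right_right P hB hN hw] at h1
    rw [lap] at h3
    simp only [map_add, map_sub, map_smul, add_apply, sub_apply, smul_apply, smul_eq_mul,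
      Q.form_point_transport hB hw] at h1 h3
    rw [map_sub, map_smul, lap, map_add, add_apply, add_apply, g1, g2, smul_eq_mul]
    have h2 : a * (2 * B (κ w) (ψ w))⁻¹ * B (Y w) y *
        (-2 * B (κ w) (ψ w) + -2 * B (κ w) (ψ w)) = -2 * a * B (Y w) y := by
      field_simp
      ring
    linarith
  · rw [polarMap_apply, map_sub, map_smul, map_sub, map_smul, (P.normal w hw).point,
      transport_of_isNormal (P.normal w hw)]
    module

theorem form_transport_section (hw : w ∈ U) {x : E}
    (hx : IsNormal B e f (polarLift B κ ψ) w x) :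
    B (transport B e f A Y κ Y' w x) (A w (ψ w)) = 0 := by
  rw [← transport_of_isNormal (κ := κ) (Y' := Y') (P.normal w hw), Q.form_transport hB hN hw, hB,
    (P.form_of_isNormal_polarLift hB hN Q.source hw hx).1]

/-- `transport` is an isometry, and the added multiples of ψ' are null and orthogonal to the
transported vectors. -/
theorem form_polarMap (hw : w ∈ U) {x y : E} (hx : IsNormal B e f (polarLift B κ ψ) w x)
    (hy : IsNormal B e f (polarLift B κ ψ) w y) :
    B (polarMap B e f a A Y κ Y' ψ w x) (polarMap B e f a A Y κ Y' ψ w y) = B x y := by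
  have h1 := Q.form_transport_section P hB hN hw hx
  have h2 := Q.form_transport_section P hB hN hw hy
  rw [hB] at h2
  rw [polarMap_apply, polarMap_apply]
  simp only [map_add, map_smul, add_apply, smul_apply, smul_eq_mul, h1, h2,
    (Q.isParallelNull_map P).null w hw, Q.form_transport hB hN hw]
  ring

/-- The errors -aY' of the two second derivatives cancel in their difference, and ψ' pairs equally
with Ψ'_ee and Ψ'_ff. -/
theorem hopf_polarMap (hw : w ∈ U) {x : E} (hx : IsNormal B e f (polarLift B κ ψ) w x) :
    B (polarKappa B e f κ' (fun w => A w (ψ w)) s' w) (polarMap B e f a A Y κ Y' ψ w x) =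
      B (polarKappa B e f κ ψ s w) x := by
  obtain ⟨g1, g2⟩ := (Q.isParallelNull_map P).form_polarLift_second hB hN Q.target hw
  have hx' := Q.isNormal_polarMap P hB hN hw hx
  have h1 := Q.form_transport hB hN hw (pd e (pd e (polarLift B κ ψ)) w) x
  have h2 := Q.form_transport hB hN hw (pd f (pd f (polarLift B κ ψ)) w) x
  rw [Q.transport_polarLift_left_left P hB hN hw] at h1
  rw [Q.transport_polarLift_right_right P hB hN hw] at h2
  simp only [map_sub, map_smul, sub_apply, smul_apply, smul_eq_mul] at h1 h2
  rw [polarKappa, polarKappa]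
  simp only [map_add, map_sub, map_smul, add_apply, sub_apply, smul_apply, smul_eq_mul, hx'.point,
    hx.point]
  rw [polarMap_apply]
  simp only [map_add, map_smul, smul_eq_mul, g1, g2]
  linarith

omit hN in
theorem smooth_polarMap {ξ : ℂ → E} (hξ : ContDiffOn ℝ ∞ ξ U) :
    ContDiffOn ℝ ∞ (fun w => polarMap B e f a A Y κ Y' ψ w (ξ w)) U :=
  smooth_add (Q.smooth_transport hB hξ) (smooth_smul ((contDiffOn_const.mul
    (P.smooth_inv_pairing Q.source hB)).mul (smooth_form B Q.source.smooth hξ))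
    (Q.isParallelNull_map P).smooth)

omit hN in
-- The values of b and c are irrelevant, since ψ' and its derivatives are orthogonal to the normal
-- vectors of the polar surface.
theorem pd_polarMap {ξ : ℂ → E} (hξ : ContDiffOn ℝ ∞ ξ U) (h : ℂ) (hw : w ∈ U) :
    ∃ b c : ℝ, pd h (fun w => polarMap B e f a A Y κ Y' ψ w (ξ w)) w =
      pd h (fun w => transport B e f A Y κ Y' w (ξ w)) w + b • A w (ψ w) +
        c • pd h (fun w => A w (ψ w)) w := by
  have hU := Q.source.isOpen
  have hτ : ContDiffOn ℝ ∞ (fun w => a * (2 * B (κ w) (ψ w))⁻¹ * B (Y w) (ξ w)) U :=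
    (contDiffOn_const.mul (P.smooth_inv_pairing Q.source hB)).mul
      (smooth_form B Q.source.smooth hξ)
  have hψ' := (Q.isParallelNull_map P).smooth
  have key := pd_add hU (Q.smooth_transport hB hξ) (smooth_smul hτ hψ') hw h
  rw [pd_smul hU hτ hψ' hw, ← add_assoc] at key
  exact ⟨_, _, key⟩

/-- For normal n', the error term pairs to a(⟨Y, ξ⟩⟨Y'_e, n'⟩ - ⟨Y_e, ξ⟩⟨Y', n'⟩). It vanishes
because both factors with Y_e are p times those with Y, with the same p on both surfaces. -/
theorem connection_polarMap_left {ξ : ℂ → E} (hξ : ContDiffOn ℝ ∞ ξ U)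
    (hn : ∀ w ∈ U, IsNormal B e f (polarLift B κ ψ) w (ξ w)) (hw : w ∈ U) {n : E}
    (h : IsNormal B e f (polarLift B κ ψ) w n) :
    B (pd e (fun w => polarMap B e f a A Y κ Y' ψ w (ξ w)) w) (polarMap B e f a A Y κ Y' ψ w n) =
      B (pd e ξ w) n := by
  obtain ⟨b, c, hbc⟩ := Q.pd_polarMap P hB hξ e hw
  have P' := Q.isParallelNull_map P
  obtain ⟨m0, m1, m2, m3, m4⟩ := P'.form_of_isNormal_polarLift hB hN Q.target hw
    (Q.isNormal_polarMap P hB hN hw h)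
  obtain ⟨n0, n1, n2, n3, n4⟩ := P.form_of_isNormal_polarLift hB hN Q.source hw (hn w hw)
  have h1 := pd_form_eq_zero B Q.source.isOpen P.smooth hξ
    (fun w hw => (P.form_of_isNormal_polarLift hB hN Q.source hw (hn w hw)).1) hw e
  rw [n3, zero_add, hB] at h1
  have h2 : B (transport B e f A Y κ Y' w (pd e ξ w)) (A w (ψ w)) = 0 := by
    rw [← transport_of_isNormal (κ := κ) (Y' := Y') (P.normal w hw), Q.form_transport hB hN hw, h1]
  rw [hbc, Q.pd_left_transport hB hN hξ hw]
  simp only [map_add, map_sub, map_smul, add_apply, sub_apply, smul_apply, smul_eq_mul, m0, m1,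
    m3, n1]
  rw [polarMap_apply, map_add, map_smul, h2, Q.form_transport hB hN hw, Q.logPd_eq P e hw,
    smul_zero]
  ring

theorem connection_polarMap_right {ξ : ℂ → E} (hξ : ContDiffOn ℝ ∞ ξ U)
    (hn : ∀ w ∈ U, IsNormal B e f (polarLift B κ ψ) w (ξ w)) (hw : w ∈ U) {n : E}
    (h : IsNormal B e f (polarLift B κ ψ) w n) :
    B (pd f (fun w => polarMap B e f a A Y κ Y' ψ w (ξ w)) w) (polarMap B e f a A Y κ Y' ψ w n) =
      B (pd f ξ w) n := by
  obtain ⟨b, c, hbc⟩ := Q.pd_polarMap P hB hξ f hw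
  have P' := Q.isParallelNull_map P
  obtain ⟨m0, m1, m2, m3, m4⟩ := P'.form_of_isNormal_polarLift hB hN Q.target hw
    (Q.isNormal_polarMap P hB hN hw h)
  obtain ⟨n0, n1, n2, n3, n4⟩ := P.form_of_isNormal_polarLift hB hN Q.source hw (hn w hw)
  have h1 := pd_form_eq_zero B Q.source.isOpen P.smooth hξ
    (fun w hw => (P.form_of_isNormal_polarLift hB hN Q.source hw (hn w hw)).1) hw f
  rw [n4, zero_add, hB] at h1
  have h2 : B (transport B e f A Y κ Y' w (pd f ξ w)) (A w (ψ w)) = 0 := by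
    rw [← transport_of_isNormal (κ := κ) (Y' := Y') (P.normal w hw), Q.form_transport hB hN hw, h1]
  rw [hbc, Q.pd_right_transport hB hN hξ hw]
  simp only [map_add, map_sub, map_smul, add_apply, sub_apply, smul_apply, smul_eq_mul, m0, m2,
    m4, n2]
  rw [polarMap_apply, map_add, map_smul, h2, Q.form_transport hB hN hw, Q.logPd_eq P f hw,
    smul_zero]
  ring

/-- The polar surface of the spectral transform is a spectral transform, with the same parameter, of
the polar surface. -/
theorem polar : SpectralPair B U e f a (polarMap B e f a A Y κ Y' ψ)
    (polarLift B κ ψ) (polarKappa B e f κ ψ s) (polarS B e f κ ψ s) (polarT B e f κ ψ t)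
    (polarLift B κ' (fun w => A w (ψ w))) (polarKappa B e f κ' (fun w => A w (ψ w)) s')
    (polarS B e f κ' (fun w => A w (ψ w)) s') (polarT B e f κ' (fun w => A w (ψ w)) t') where
  source := P.isothermicLift_polarLift Q.source hB hN
  target := (Q.isParallelNull_map P).isothermicLift_polarLift Q.target hB hN
  corr :=
    { map_normal := fun w hw x hx => Q.isNormal_polarMap P hB hN hw hx
      surj := fun w hw x' hx' => Q.polarMap_surj P hB hN hw hx'
      isometry := fun w hw x hx y hy => Q.form_polarMap P hB hN hw hx hy
      hopf := fun w hw x hx => Q.hopf_polarMap P hB hN hw hx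
      smooth := fun ξ hξ _ => Q.smooth_polarMap P hB hξ
      connection_left := fun ξ hξ hn w hw n h => Q.connection_polarMap_left P hB hN hξ hn hw h
      connection_right := fun ξ hξ hn w hw n h => Q.connection_polarMap_right P hB hN hξ hn hw h }
  re_eq w hw := by
    rw [polarS, polarS, Q.pd_logPd_eq P e hw, Q.pd_logPd_eq P f hw, Q.re_eq w hw]
    ring
  im_eq w hw := by
    rw [polarT, polarT, Q.logPd_eq P e hw, Q.logPd_eq P f hw, Q.im_eq w hw]

end SpectralPair

end PolarSpectral

/-! ### Changes of coordinate: the normal bundle is independent of the lift -/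

section Reparametrization

variable {E : Type*} [NormedAddCommGroup E] [NormedSpace ℝ E]

theorem pd_real_comp {W U : Set ℂ} (hW : IsOpen W) (hU : IsOpen U) {h : ℂ → ℂ} {Y : ℂ → E}
    (hh : ContDiffOn ℝ ∞ h W) (hmaps : Set.MapsTo h W U) (hY : ContDiffOn ℝ ∞ Y U) {v : ℂ}
    (hv : v ∈ W) (k : ℂ) : pd k (fun v => Y (h v)) v = pd (pd k h v) Y (h v) := by
  have := ((differentiableAt_of_smooth hU hY (hmaps hv)).hasFDerivAt.comp v
    (differentiableAt_of_smooth hW hh hv).hasFDerivAt).fderiv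
  exact congrArg (fun S => S k) this

/-- At a critical point of g the second derivatives of h drop out of the chain rule. -/
theorem pd_pd_real_comp {W U : Set ℂ} (hW : IsOpen W) (hU : IsOpen U) {h : ℂ → ℂ} {g : ℂ → ℝ}
    (hh : ContDiffOn ℝ ∞ h W) (hmaps : Set.MapsTo h W U) (hg : ContDiffOn ℝ ∞ g U) {v : ℂ}
    (hv : v ∈ W) (h1 : pd 1 g (h v) = 0) (h2 : pd Complex.I g (h v) = 0) (k : ℂ) :
    pd k (pd k (fun v => g (h v))) v =
      (pd k h v).re ^ 2 * pd 1 (pd 1 g) (h v) +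
      2 * ((pd k h v).re * (pd k h v).im) * pd 1 (pd Complex.I g) (h v) +
      (pd k h v).im ^ 2 * pd Complex.I (pd Complex.I g) (h v) := by
  have hk := smooth_pd hW hh k
  have hre : ContDiffOn ℝ ∞ (fun v => (pd k h v).re) W :=
    Complex.reCLM.contDiff.comp_contDiffOn hk
  have him : ContDiffOn ℝ ∞ (fun v => (pd k h v).im) W :=
    Complex.imCLM.contDiff.comp_contDiffOn hk
  have hgc : ∀ l, ContDiffOn ℝ ∞ (fun v => pd l g (h v)) W := fun l =>
    (smooth_pd hU hg l).comp hh hmaps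
  have e1 : ∀ v ∈ W, pd k (fun v => g (h v)) v =
      (pd k h v).re • pd 1 g (h v) + (pd k h v).im • pd Complex.I g (h v) := by
    intro v hv
    rw [pd_real_comp hW hU hh hmaps hg hv, pd_eq_re_im]
  rw [pd_congr hW e1 hv, pd_add hW (smooth_smul hre (hgc _)) (smooth_smul him (hgc _)) hv,
    pd_smul hW hre (hgc _) hv, pd_smul hW him (hgc _) hv, h1, h2,
    pd_real_comp hW hU hh hmaps (smooth_pd hU hg _) hv,
    pd_real_comp hW hU hh hmaps (smooth_pd hU hg _) hv, pd_eq_re_im (pd 1 g),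
    pd_eq_re_im (pd Complex.I g), pd_comm hU hg (hmaps hv) 1 Complex.I]
  simp only [smul_eq_mul]
  ring

theorem pd_pd_smul_of_critical {W : Set ℂ} (hW : IsOpen W) {a g : ℂ → ℝ}
    (ha : ContDiffOn ℝ ∞ a W) (hg : ContDiffOn ℝ ∞ g W) {v : ℂ} (hv : v ∈ W) (h0 : g v = 0) (k : ℂ)
    (h1 : pd k g v = 0) : pd k (pd k (fun v => a v • g v)) v = a v * pd k (pd k g) v := by
  rw [pd_congr hW (fun v hv => pd_smul hW ha hg hv k) hv,
    pd_add hW (smooth_smul (smooth_pd hW ha k) hg) (smooth_smul ha (smooth_pd hW hg k)) hv,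
    pd_smul hW (smooth_pd hW ha k) hg hv, pd_smul hW ha (smooth_pd hW hg k) hv, h0, h1]
  simp

/-- A real linear similarity of the plane preserves the Laplacian up to a factor. -/
theorem laplacian_similarity {k l : ℂ} {N : ℝ} (hN : N ≠ 0) (hk : k.re ^ 2 + k.im ^ 2 = N)
    (hl : l.re ^ 2 + l.im ^ 2 = N) (hkl : k.re * l.re + k.im * l.im = 0) {p q r : ℝ}
    (h : p + r = 0) :
    (k.re ^ 2 * p + 2 * (k.re * k.im) * q + k.im ^ 2 * r) +
      (l.re ^ 2 * p + 2 * (l.re * l.im) * q + l.im ^ 2 * r) = 0 := by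
  -- D is the determinant of (k, l), and D² = N². So l is k turned by a right angle in either sense;
  -- orientation is not assumed to be preserved.
  set D := k.re * l.im - k.im * l.re with hD
  have h1 : l.re * D = -k.im * N := by rw [hD, ← hl]; linear_combination l.im * hkl
  have h2 : l.im * D = k.re * N := by rw [hD, ← hl]; linear_combination (-l.re) * hkl
  have h3 : D ^ 2 = N ^ 2 := by
    have : D ^ 2 + (k.re * l.re + k.im * l.im) ^ 2 =
        (k.re ^ 2 + k.im ^ 2) * (l.re ^ 2 + l.im ^ 2) := by rw [hD]; ring
    rw [hkl, hk, hl] at this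
    linarith
  have hN2 : N ^ 2 ≠ 0 := pow_ne_zero 2 hN
  have h4 : l.re ^ 2 = k.im ^ 2 := by
    apply mul_right_cancel₀ hN2
    linear_combination (l.re * D - k.im * N) * h1 - l.re ^ 2 * h3
  have h5 : l.im ^ 2 = k.re ^ 2 := by
    apply mul_right_cancel₀ hN2
    linear_combination (l.im * D + k.re * N) * h2 - l.im ^ 2 * h3
  have h6 : l.re * l.im = -(k.re * k.im) := by
    apply mul_right_cancel₀ hN2
    linear_combination (l.im * D) * h1 - k.im * N * h2 - l.re * l.im * h3
  linear_combination (k.re ^ 2 + k.im ^ 2) * h + p * h4 + r * h5 + 2 * q * h6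

/-- The change of conformal lifts of a surface which belongs to the change `h` of coordinates. -/
structure LiftChange (B : E →L[ℝ] E →L[ℝ] ℝ) (U₁ U₂ W : Set ℂ) (h : ℂ → ℂ) (Y₁ Y₂ : ℂ → E) :
    Prop where
  left : ConformalLift B U₁ 1 Complex.I Y₁
  right : ConformalLift B U₂ 1 Complex.I Y₂
  isOpen : IsOpen W
  subset : W ⊆ U₂
  smooth : ContDiffOn ℝ ∞ h W
  mapsTo : Set.MapsTo h W U₁
  eq : ∀ v ∈ W, ∃ c : ℝ, Y₂ v = c • Y₁ (h v)

/-- The factor between two lifts. -/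
noncomputable def liftFactor (B : E →L[ℝ] E →L[ℝ] ℝ) (h : ℂ → ℂ) (Y₁ Y₂ : ℂ → E) : ℂ → ℝ :=
  fun v => -(1 / 2) * B (Y₂ v) (lap 1 Complex.I Y₁ (h v))

theorem ConformalLift.form_pd_pd {B : E →L[ℝ] E →L[ℝ] ℝ} {U : Set ℂ} {Y : ℂ → E} {w : ℂ}
    (H : ConformalLift B U 1 Complex.I Y) (hB : ∀ x y, B x y = B y x) (hw : w ∈ U) (k l : ℂ) :
    B (pd k Y w) (pd l Y w) = k.re * l.re + k.im * l.im := by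
  have h := hB (pd Complex.I Y w) (pd 1 Y w)
  rw [H.ortho w hw] at h
  rw [pd_eq_re_im Y k, pd_eq_re_im Y l]
  simp only [map_add, map_smul, add_apply, smul_apply, smul_eq_mul, H.unit_left w hw,
    H.unit_right w hw, H.ortho w hw, h]
  ring

namespace LiftChange

variable {B : E →L[ℝ] E →L[ℝ] ℝ} {U₁ U₂ W : Set ℂ} {h : ℂ → ℂ} {Y₁ Y₂ : ℂ → E} {v : ℂ}

variable (R : LiftChange B U₁ U₂ W h Y₁ Y₂) (hB : ∀ x y, B x y = B y x)

include R hB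

theorem eq_factor (hv : v ∈ W) : Y₂ v = liftFactor B h Y₁ Y₂ v • Y₁ (h v) := by
  obtain ⟨c, hc⟩ := R.eq v hv
  rw [liftFactor, hc, map_smul, smul_apply, R.left.form_point_lap hB (R.mapsTo hv), smul_eq_mul]
  module

omit hB in
theorem smooth_factor : ContDiffOn ℝ ∞ (liftFactor B h Y₁ Y₂) W :=
  contDiffOn_const.mul (smooth_form B (R.right.smooth.mono R.subset)
    ((smooth_lap R.left.isOpen R.left.smooth _ _).comp R.smooth R.mapsTo))

theorem pd_lift (hv : v ∈ W) (k : ℂ) : pd k Y₂ v =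
    pd k (liftFactor B h Y₁ Y₂) v • Y₁ (h v) +
      liftFactor B h Y₁ Y₂ v • pd (pd k h v) Y₁ (h v) := by
  rw [pd_congr R.isOpen (fun v hv => R.eq_factor hB hv) hv k,
    pd_smul R.isOpen R.smooth_factor (f := fun v => Y₁ (h v))
      (R.left.smooth.comp R.smooth R.mapsTo) hv,
    pd_real_comp R.isOpen R.left.isOpen R.smooth R.mapsTo R.left.smooth hv]

/-- Y₁ is null and orthogonal to its derivatives, so the derivative of the factor does not
contribute to ⟨dY₂, dY₂⟩. -/
theorem similarity (hv : v ∈ W) (k l : ℂ) :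
    liftFactor B h Y₁ Y₂ v ^ 2 * ((pd k h v).re * (pd l h v).re + (pd k h v).im * (pd l h v).im) =
      k.re * l.re + k.im * l.im := by
  have hw := R.mapsTo hv
  have h1 := R.right.form_pd_pd hB (R.subset hv) k l
  have h2 := hB (pd (pd k h v) Y₁ (h v)) (Y₁ (h v))
  rw [R.left.form_point_pd hB _ hw] at h2
  rw [R.pd_lift hB hv, R.pd_lift hB hv] at h1
  simp only [map_add, map_smul, add_apply, smul_apply, smul_eq_mul, R.left.null _ hw,
    R.left.form_point_pd hB _ hw, h2, R.left.form_pd_pd hB hw] at h1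
  linear_combination h1

theorem factor_ne_zero (hv : v ∈ W) : liftFactor B h Y₁ Y₂ v ≠ 0 := by
  intro h0
  have := R.similarity hB hv 1 1
  simp [h0] at this

/-- The bundle of normal vectors does not depend on the coordinate. -/
theorem isNormal (hv : v ∈ W) {x : E} (hx : IsNormal B 1 Complex.I Y₁ (h v) x) :
    IsNormal B 1 Complex.I Y₂ v x := by
  have hw := R.mapsTo hv
  have hU₁ := R.left.isOpen
  have h0 := R.factor_ne_zero hB hv
  set μ := liftFactor B h Y₁ Y₂ with hμ
  have hpd : ∀ k, B (pd k Y₁ (h v)) x = 0 := by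
    intro k
    rw [pd_eq_re_im]
    simp only [map_add, map_smul, add_apply, smul_apply, hx.left, hx.right, smul_zero, add_zero]
  have hpd2 : ∀ k, B (pd k Y₂ v) x = 0 := by
    intro k
    rw [R.pd_lift hB hv]
    simp only [map_add, map_smul, add_apply, smul_apply, hx.point, hpd, smul_zero, add_zero]
  refine ⟨?_, hpd2 _, hpd2 _, ?_⟩
  · rw [R.eq_factor hB hv, map_smul, smul_apply, hx.point, smul_zero]
  -- With g = ⟨Y₁, x⟩, normality says that g, dg and Δg vanish at the point. Since ⟨Y₂, x⟩ is the
  -- factor times g ∘ h and dh is a similarity, its Laplacian is a multiple of Δg there.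
  set T : E →L[ℝ] ℝ := B.flip x with hT
  have hT1 : ∀ y, B y x = T y := fun y => rfl
  have hg : ContDiffOn ℝ ∞ (fun w => T (Y₁ w)) U₁ := T.contDiff.comp_contDiffOn R.left.smooth
  have hgpd : ∀ k, ∀ w ∈ U₁, pd k (fun w => T (Y₁ w)) w = T (pd k Y₁ w) := fun k w hw =>
    pd_clm hU₁ R.left.smooth T hw k
  have hgpp : ∀ k, ∀ w ∈ U₁, pd k (pd k (fun w => T (Y₁ w))) w = T (pd k (pd k Y₁) w) :=
    fun k w hw => by
      rw [pd_congr hU₁ (hgpd k) hw, pd_clm hU₁ (smooth_pd hU₁ R.left.smooth k) T hw]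
  have hU₂ := R.right.isOpen
  have hv2 := R.subset hv
  have hlap2 : ∀ k, T (pd k (pd k Y₂) v) = μ v * pd k (pd k (fun v => T (Y₁ (h v)))) v := by
    intro k
    have e1 : T (pd k (pd k Y₂) v) = pd k (pd k (fun v => T (Y₂ v))) v := by
      rw [pd_congr hU₂ (fun v hv => pd_clm hU₂ R.right.smooth T hv k) hv2,
        pd_clm hU₂ (smooth_pd hU₂ R.right.smooth k) T hv2]
    have e2 : ∀ v ∈ W, T (Y₂ v) = μ v • T (Y₁ (h v)) := fun v hv => by
      rw [← map_smul, ← R.eq_factor hB hv]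
    rw [e1, pd_congr R.isOpen (fun v hv => pd_congr R.isOpen e2 hv k) hv]
    refine pd_pd_smul_of_critical R.isOpen R.smooth_factor (hg.comp R.smooth R.mapsTo) hv ?_ k ?_
    · exact hx.point
    · refine (pd_real_comp R.isOpen hU₁ R.smooth R.mapsTo hg hv k).trans ?_
      rw [hgpd _ _ hw]
      exact hpd _
  have hcrit : ∀ k, pd k (fun w => T (Y₁ w)) (h v) = 0 := fun k => by
    rw [hgpd _ _ hw]
    exact hpd k
  have hlap1 := hx.lap
  rw [lap, map_add, add_apply, hT1, hT1] at hlap1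
  rw [lap, map_add, add_apply, hT1, hT1, hlap2, hlap2, ← mul_add,
    pd_pd_real_comp R.isOpen hU₁ R.smooth R.mapsTo hg hv (hcrit _) (hcrit _),
    pd_pd_real_comp R.isOpen hU₁ R.smooth R.mapsTo hg hv (hcrit _) (hcrit _), hgpp _ _ hw,
    hgpp _ _ hw]
  have s11 := R.similarity hB hv 1 1
  have s22 := R.similarity hB hv Complex.I Complex.I
  have s12 := R.similarity hB hv 1 Complex.I
  simp only [Complex.one_re, Complex.one_im, Complex.I_re, Complex.I_im] at s11 s22 s12
  have hμ2 : μ v ^ 2 ≠ 0 := pow_ne_zero 2 h0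
  rw [laplacian_similarity (N := (μ v ^ 2)⁻¹) (inv_ne_zero hμ2) ?_ ?_ ?_ hlap1, mul_zero]
  · apply eq_inv_of_mul_eq_one_left
    linear_combination s11
  · apply eq_inv_of_mul_eq_one_left
    linear_combination s22
  · apply mul_left_cancel₀ hμ2
    linear_combination s12

end LiftChange

end Reparametrization

/-! ### The transport and the identification of polar normal bundles do not depend on the coordinate
-/

section ChangeOfCoordinate

variable {E : Type*} [NormedAddCommGroup E] [NormedSpace ℝ E]

theorem IsParallelNull.form_pd_pd {B : E →L[ℝ] E →L[ℝ] ℝ} {U : Set ℂ} {Y κ ψ : ℂ → E}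
    {s t : ℂ → ℝ} {w : ℂ} (P : IsParallelNull B U 1 Complex.I Y κ ψ)
    (H : IsothermicLift B U 1 Complex.I Y κ s t) (hB : ∀ x y, B x y = B y x) (hw : w ∈ U)
    (k l : ℂ) : B (pd k Y w) (pd l ψ w) =
      -2 * B (κ w) (ψ w) * (k.re * l.re - k.im * l.im) := by
  have h1 := P.swap.form_left_left (H.swap hB) hB hw
  have h2 := P.swap.form_right_left (H.swap hB) hB hw
  rw [map_neg, neg_apply] at h1
  rw [pd_eq_re_im Y k, pd_eq_re_im ψ l]
  simp only [map_add, map_smul, add_apply, smul_apply, smul_eq_mul, P.form_left_left H hB hw,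
    P.form_right_left H hB hw, h1, h2]
  ring

theorem IsParallelNull.form_point_pd_section {B : E →L[ℝ] E →L[ℝ] ℝ} {U : Set ℂ} {Y κ ψ : ℂ → E}
    {s t : ℂ → ℝ} {w : ℂ} (P : IsParallelNull B U 1 Complex.I Y κ ψ)
    (H : IsothermicLift B U 1 Complex.I Y κ s t) (hB : ∀ x y, B x y = B y x) (hw : w ∈ U)
    (l : ℂ) : B (Y w) (pd l ψ w) = 0 := by
  rw [pd_eq_re_im ψ l, map_add, map_smul, map_smul, P.form_point_left H hB hw,
    P.swap.form_point_left (H.swap hB) hB hw, smul_zero, smul_zero, add_zero]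

/-- Compare ⟨dY, dψ⟩ = -2ρ(du² - dv²) in the two coordinates: Y is rescaled, ψ is not. -/
theorem LiftChange.form_pd_section {B : E →L[ℝ] E →L[ℝ] ℝ} {U₁ U₂ W : Set ℂ} {h : ℂ → ℂ}
    {Y₁ κ₁ ψ₁ Y₂ κ₂ ψ₂ : ℂ → E} {s₁ t₁ s₂ t₂ : ℂ → ℝ} {v : ℂ}
    (R : LiftChange B U₁ U₂ W h Y₁ Y₂) (hB : ∀ x y, B x y = B y x)
    (P₁ : IsParallelNull B U₁ 1 Complex.I Y₁ κ₁ ψ₁) (P₂ : IsParallelNull B U₂ 1 Complex.I Y₂ κ₂ ψ₂)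
    (H₁ : IsothermicLift B U₁ 1 Complex.I Y₁ κ₁ s₁ t₁)
    (H₂ : IsothermicLift B U₂ 1 Complex.I Y₂ κ₂ s₂ t₂)
    (hψ : ∀ v ∈ W, ψ₂ v = ψ₁ (h v)) (hv : v ∈ W) :
    B (κ₂ v) (ψ₂ v) = liftFactor B h Y₁ Y₂ v *
      (B (κ₁ (h v)) (ψ₁ (h v)) * ((pd 1 h v).re ^ 2 - (pd 1 h v).im ^ 2)) := by
  have hw := R.mapsTo hv
  have e1 := P₂.form_pd_pd H₂ hB (R.subset hv) 1 1
  rw [R.pd_lift hB hv, pd_congr R.isOpen hψ hv 1,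
    pd_real_comp R.isOpen R.left.isOpen R.smooth R.mapsTo P₁.smooth hv] at e1
  simp only [map_add, map_smul, add_apply, smul_apply, smul_eq_mul,
    P₁.form_point_pd_section H₁ hB hw, P₁.form_pd_pd H₁ hB hw, Complex.one_re, Complex.one_im] at e1
  linear_combination (1 / 2) * e1

namespace SpectralPair

variable {B : E →L[ℝ] E →L[ℝ] ℝ} {U₁ U₂ W : Set ℂ} {h : ℂ → ℂ} {a : ℝ} {A₁ A₂ : ℂ → E →ₗ[ℝ] E}
  {Y₁ κ₁ ψ₁ Y₁' κ₁' Y₂ κ₂ ψ₂ Y₂' κ₂' : ℂ → E} {s₁ t₁ s₁' t₁' s₂ t₂ s₂' t₂' : ℂ → ℝ} {v : ℂ}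

variable (Q₁ : SpectralPair B U₁ 1 Complex.I a A₁ Y₁ κ₁ s₁ t₁ Y₁' κ₁' s₁' t₁')
  (Q₂ : SpectralPair B U₂ 1 Complex.I a A₂ Y₂ κ₂ s₂ t₂ Y₂' κ₂' s₂' t₂')
  (P₁ : IsParallelNull B U₁ 1 Complex.I Y₁ κ₁ ψ₁) (P₂ : IsParallelNull B U₂ 1 Complex.I Y₂ κ₂ ψ₂)
  (R : LiftChange B U₁ U₂ W h Y₁ Y₂) (R' : LiftChange B U₁ U₂ W h Y₁' Y₂')
  (hA : ∀ v ∈ W, A₂ v = A₁ (h v)) (hψ : ∀ v ∈ W, ψ₂ v = ψ₁ (h v))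
  (hn : ∀ v ∈ W, ∀ n, IsNormal B 1 Complex.I Y₂ v n → IsNormal B 1 Complex.I Y₁ (h v) n)
  (hB : ∀ x y, B x y = B y x) (hN : ∀ x, (∀ y, B x y = 0) → x = 0)

include Q₁ Q₂ P₁ P₂ R R' hA hψ hB

/-- The signs of the canonical lifts of the two surfaces might change differently. By
`form_pd_section` the factor is determined by ρ in the two coordinates, and ρ is nonzero and shared
by both surfaces. -/
theorem liftFactor_eq (hv : v ∈ W) : liftFactor B h Y₁' Y₂' v = liftFactor B h Y₁ Y₂ v := by
  have e1 := R.form_pd_section hB P₁ P₂ Q₁.source Q₂.source hψ hv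
  have e2 := R'.form_pd_section hB (Q₁.isParallelNull_map P₁) (Q₂.isParallelNull_map P₂) Q₁.target
    Q₂.target (fun v hv => by rw [hA v hv, hψ v hv]) hv
  rw [Q₁.pairing_eq P₁ (R.mapsTo hv), Q₂.pairing_eq P₂ (R.subset hv), e1] at e2
  have h0 := P₂.pairing_ne v (R.subset hv)
  rw [e1] at h0
  exact (mul_right_cancel₀ (right_ne_zero_of_mul h0) e2).symm

include hN

theorem transport_pd (hv : v ∈ W) (k : ℂ) :
    transport B 1 Complex.I A₁ Y₁ κ₁ Y₁' (h v) (pd k Y₂ v) = pd k Y₂' v := by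
  have hw := R.mapsTo hv
  rw [R.pd_lift hB hv, R'.pd_lift hB hv,
    liftFactor_eq Q₁ Q₂ P₁ P₂ R R' hA hψ hB hv, map_add, map_smul, map_smul,
    Q₁.transport_point hB hN hw, pd_congr R.isOpen
      (fun v hv => liftFactor_eq Q₁ Q₂ P₁ P₂ R R' hA hψ hB hv) hv k,
    pd_eq_re_im Y₁, pd_eq_re_im Y₁', map_add, map_smul, map_smul, Q₁.transport_left hB hN hw,
    Q₁.transport_right hB hN hw]

theorem transport_change_point (hv : v ∈ W) :
    transport B 1 Complex.I A₁ Y₁ κ₁ Y₁' (h v) (Y₂ v) = Y₂' v := by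
  have hw := R.mapsTo hv
  rw [R.eq_factor hB hv, R'.eq_factor hB hv,
    liftFactor_eq Q₁ Q₂ P₁ P₂ R R' hA hψ hB hv, map_smul, Q₁.transport_point hB hN hw]

include hn

theorem form_normal_transport_change (hv : v ∈ W) {n : E} (h2 : IsNormal B 1 Complex.I Y₂ v n)
    (x : E) : B (A₂ v n) (transport B 1 Complex.I A₁ Y₁ κ₁ Y₁' (h v) x) = B n x := by
  rw [hA v hv, Q₁.form_normal_transport hB (R.mapsTo hv) (hn v hv n h2)]

/-- The pairings with Y₂', its first derivatives and the normal vectors leave an ambiguity in the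
direction of Y₂'. It is removed by ⟨ΔY, ΔY⟩ = 16⟨κ, κ⟩, which agrees for both surfaces. -/
theorem transport_change_lap (hv : v ∈ W) :
    transport B 1 Complex.I A₁ Y₁ κ₁ Y₁' (h v) (lap 1 Complex.I Y₂ v) = lap 1 Complex.I Y₂' v := by
  have hw := R.mapsTo hv
  have hv2 := R.subset hv
  have hY := transport_change_point Q₁ Q₂ P₁ P₂ R R' hA hψ hB hN hv
  have hd := transport_pd Q₁ Q₂ P₁ P₂ R R' hA hψ hB hN hv
  set G := transport B 1 Complex.I A₁ Y₁ κ₁ Y₁' (h v) with hG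
  have hG2 : ∀ x y, B (G x) (G y) = B x y := Q₁.form_transport hB hN hw
  set b := B (lap 1 Complex.I Y₂' v) (G (lap 1 Complex.I Y₂ v)) -
    B (lap 1 Complex.I Y₂' v) (lap 1 Complex.I Y₂' v) with hb
  have key : G (lap 1 Complex.I Y₂ v) = lap 1 Complex.I Y₂' v + (-(1 / 2) * b) • Y₂' v := by
    refine Q₂.target.ext_frame hB hN hv2 ?_ ?_ ?_ ?_ fun n' hn' => ?_
    · rw [← hY, hG2, hY, map_add, map_smul, Q₂.target.null v hv2,
        Q₂.target.form_point_lap hB hv2, Q₂.source.form_point_lap hB hv2, smul_zero, add_zero]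
    · rw [← hd, hG2, hd, map_add, map_smul, hB _ (Y₂' v), Q₂.target.form_point_pd hB _ hv2,
        Q₂.target.form_left_lap hB hv2, Q₂.source.form_left_lap hB hv2, smul_zero, add_zero]
    · rw [← hd, hG2, hd, map_add, map_smul, hB _ (Y₂' v), Q₂.target.form_point_pd hB _ hv2,
        Q₂.target.form_right_lap hB hv2, Q₂.source.form_right_lap hB hv2, smul_zero, add_zero]
    · rw [map_add, map_smul, hB _ (Y₂' v), Q₂.target.form_point_lap hB hv2, smul_eq_mul, hb]
      ring
    · obtain ⟨n, h2, rfl⟩ := Q₂.corr.surj v hv2 n' hn'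
      rw [form_normal_transport_change Q₁ Q₂ P₁ P₂ R R' hA hψ hn hB hN hv h2, map_add, map_smul,
        hB n, h2.lap, hB _ (lap 1 Complex.I Y₂' v), hn'.lap, hB _ (Y₂' v), hn'.point, smul_zero,
        add_zero]
  have h1 := hG2 (lap 1 Complex.I Y₂ v) (lap 1 Complex.I Y₂ v)
  rw [key] at h1
  have h3 := hB (lap 1 Complex.I Y₂' v) (Y₂' v)
  rw [Q₂.target.form_point_lap hB hv2] at h3
  simp only [map_add, map_smul, add_apply, smul_apply, smul_eq_mul, Q₂.target.null v hv2, h3,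
    Q₂.target.form_point_lap hB hv2, Q₂.target.form_lap_lap hB hv2,
    Q₂.source.form_lap_lap hB hv2, Q₂.form_kappa hB hN hv2] at h1
  have hb0 : b = 0 := by linarith
  rw [key, hb0]
  simp

/-- The transport map does not depend on the coordinate. -/
theorem transport_change (hv : v ∈ W) (x : E) :
    transport B 1 Complex.I A₁ Y₁ κ₁ Y₁' (h v) x =
      transport B 1 Complex.I A₂ Y₂ κ₂ Y₂' v x := by
  have hw := R.mapsTo hv
  have hv2 := R.subset hv
  have hd := transport_pd Q₁ Q₂ P₁ P₂ R R' hA hψ hB hN hv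
  refine Q₂.eq_transport hB hN hv2 ?_ ?_ ?_ ?_ fun n h2 => ?_
  · rw [← transport_change_point Q₁ Q₂ P₁ P₂ R R' hA hψ hB hN hv, Q₁.form_transport hB hN hw]
  · rw [← hd, Q₁.form_transport hB hN hw]
  · rw [← hd, Q₁.form_transport hB hN hw]
  · rw [← transport_change_lap Q₁ Q₂ P₁ P₂ R R' hA hψ hn hB hN hv, Q₁.form_transport hB hN hw]
  · exact form_normal_transport_change Q₁ Q₂ P₁ P₂ R R' hA hψ hn hB hN hv h2 x

/-- The identification of the normal bundles of the polar surfaces does not depend on the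
coordinate. -/
theorem polarMap_change
    (S : ∀ v ∈ W, ∀ x, IsNormal B 1 Complex.I (polarLift B κ₂ ψ₂) v x →
      IsNormal B 1 Complex.I (polarLift B κ₁ ψ₁) (h v) x)
    (S' : ∀ v ∈ W, ∀ x, IsNormal B 1 Complex.I (polarLift B κ₁' fun w => A₁ w (ψ₁ w)) (h v) x →
      IsNormal B 1 Complex.I (polarLift B κ₂' fun w => A₂ w (ψ₂ w)) v x)
    (hv : v ∈ W) {x : E} (hx : IsNormal B 1 Complex.I (polarLift B κ₂ ψ₂) v x) :
    polarMap B 1 Complex.I a A₁ Y₁ κ₁ Y₁' ψ₁ (h v) x =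
      polarMap B 1 Complex.I a A₂ Y₂ κ₂ Y₂' ψ₂ v x := by
  have hw := R.mapsTo hv
  have hv2 := R.subset hv
  have h1 := S' v hv _ (Q₁.isNormal_polarMap P₁ hB hN hw (S v hv x hx))
  have h2 := Q₂.isNormal_polarMap P₂ hB hN hv2 hx
  -- The two images differ by a multiple of ψ', and both are normal to the polar surface Ψ'. Since
  -- ⟨ΔΨ', ψ'⟩ = -4ρ ≠ 0, the multiple is zero.
  have h3 := (h1.sub h2).lap
  have h0 := P₂.pairing_ne v hv2
  obtain ⟨g1, g2⟩ := (Q₂.isParallelNull_map P₂).form_polarLift_second hB hN Q₂.target hv2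
  rw [polarMap_apply, polarMap_apply, transport_change Q₁ Q₂ P₁ P₂ R R' hA hψ hn hB hN hv, ← hA v hv,
    ← hψ v hv, add_sub_add_left_eq_sub, ← sub_smul, map_smul, lap, map_add, add_apply, g1, g2,
    Q₂.pairing_eq P₂ hv2, smul_eq_mul] at h3
  have h4 := (mul_eq_zero.1 h3).resolve_right (by
    intro h
    apply h0
    linarith)
  rw [polarMap_apply, polarMap_apply, transport_change Q₁ Q₂ P₁ P₂ R R' hA hψ hn hB hN hv,
    ← hA v hv, ← hψ v hv, sub_eq_zero.1 h4]

end SpectralPair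

end ChangeOfCoordinate

/-! ### Gluing over the surface -/

section Global

variable {E : Type*} [NormedAddCommGroup E] [NormedSpace ℝ E]

theorem NormalCorr.congr {B : E →L[ℝ] E →L[ℝ] ℝ} {U : Set ℂ} {e f : ℂ} {A A' : ℂ → E →ₗ[ℝ] E}
    {Y κ Y' κ' : ℂ → E} (hU : IsOpen U) (C : NormalCorr B U e f A Y κ Y' κ')
    (h : ∀ w ∈ U, ∀ x, IsNormal B e f Y w x → A' w x = A w x) :
    NormalCorr B U e f A' Y κ Y' κ' where
  map_normal w hw x hx := by
    rw [h w hw x hx]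
    exact C.map_normal w hw x hx
  surj w hw x' hx' := by
    obtain ⟨x, hx, hA⟩ := C.surj w hw x' hx'
    exact ⟨x, hx, by rw [h w hw x hx, hA]⟩
  isometry w hw x hx y hy := by
    rw [h w hw x hx, h w hw y hy]
    exact C.isometry w hw x hx y hy
  hopf w hw x hx := by
    rw [h w hw x hx]
    exact C.hopf w hw x hx
  smooth ξ hξ hn := (C.smooth ξ hξ hn).congr fun w hw => h w hw _ (hn w hw)
  connection_left ξ hξ hn w hw n hnw := by
    rw [h w hw n hnw, pd_congr hU (fun w hw => h w hw _ (hn w hw)) hw]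
    exact C.connection_left ξ hξ hn w hw n hnw
  connection_right ξ hξ hn w hw n hnw := by
    rw [h w hw n hnw, pd_congr hU (fun w hw => h w hw _ (hn w hw)) hw]
    exact C.connection_right ξ hξ hn w hw n hnw

variable {M : Type*} [TopologicalSpace M]

/-- In the coordinate `z`, the vectors `Y` are nonzero multiples of `L`. -/
def IsMultiple (z : OpenPartialHomeomorph M ℂ) (L : M → E) (Y : ℂ → E) : Prop :=
  ∀ w ∈ z.target, ∃ θ : ℝ, θ ≠ 0 ∧ Y w = θ • L (z.symm w)

variable [ChartedSpace ℂ M] [IsManifold 𝓘(ℝ, ℂ) ∞ M]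

theorem contDiffOn_transition {z₁ z₂ : OpenPartialHomeomorph M ℂ}
    (h₁ : z₁ ∈ IsManifold.maximalAtlas 𝓘(ℝ, ℂ) ∞ M)
    (h₂ : z₂ ∈ IsManifold.maximalAtlas 𝓘(ℝ, ℂ) ∞ M) :
    ContDiffOn ℝ ∞ (fun w => z₁ (z₂.symm w)) (z₂.symm.trans z₁).source := by
  have h := IsManifold.compatible_of_mem_maximalAtlas h₂ h₁
  rw [contDiffGroupoid, mem_groupoid_of_pregroupoid] at h
  have h' := h.1
  simpa [contDiffPregroupoid, Function.comp_def] using h'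

theorem liftChange_of_isMultiple {B : E →L[ℝ] E →L[ℝ] ℝ} {z₁ z₂ : OpenPartialHomeomorph M ℂ}
    (h₁ : z₁ ∈ IsManifold.maximalAtlas 𝓘(ℝ, ℂ) ∞ M)
    (h₂ : z₂ ∈ IsManifold.maximalAtlas 𝓘(ℝ, ℂ) ∞ M) {L : M → E} {Y₁ Y₂ : ℂ → E}
    (H₁ : ConformalLift B z₁.target 1 Complex.I Y₁) (H₂ : ConformalLift B z₂.target 1 Complex.I Y₂)
    (L₁ : IsMultiple z₁ L Y₁) (L₂ : IsMultiple z₂ L Y₂) :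
    LiftChange B z₁.target z₂.target (z₂.symm.trans z₁).source (fun w => z₁ (z₂.symm w)) Y₁ Y₂ where
  left := H₁
  right := H₂
  isOpen := (z₂.symm.trans z₁).open_source
  subset w hw := by simpa using hw.1
  smooth := contDiffOn_transition h₁ h₂
  mapsTo w hw := z₁.map_source (by simpa using hw.2)
  eq w hw := by
    have hw1 : z₂.symm w ∈ z₁.source := by simpa using hw.2
    obtain ⟨θ₂, -, e₂⟩ := L₂ w (by simpa using hw.1)
    obtain ⟨θ₁, h0, e₁⟩ := L₁ (z₁ (z₂.symm w)) (z₁.map_source hw1)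
    refine ⟨θ₂ * θ₁⁻¹, ?_⟩
    rw [e₁, e₂, z₁.left_inv hw1, smul_smul, inv_mul_cancel_right₀ h0]

theorem isNormal_of_isMultiple {B : E →L[ℝ] E →L[ℝ] ℝ} (hB : ∀ x y, B x y = B y x)
    {z₁ z₂ : OpenPartialHomeomorph M ℂ}
    (h₁ : z₁ ∈ IsManifold.maximalAtlas 𝓘(ℝ, ℂ) ∞ M)
    (h₂ : z₂ ∈ IsManifold.maximalAtlas 𝓘(ℝ, ℂ) ∞ M) {L : M → E} {Y₁ Y₂ : ℂ → E}
    (H₁ : ConformalLift B z₁.target 1 Complex.I Y₁) (H₂ : ConformalLift B z₂.target 1 Complex.I Y₂)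
    (L₁ : IsMultiple z₁ L Y₁) (L₂ : IsMultiple z₂ L Y₂) {p : M} (hp₁ : p ∈ z₁.source)
    (hp₂ : p ∈ z₂.source) {x : E} :
    IsNormal B 1 Complex.I Y₁ (z₁ p) x ↔ IsNormal B 1 Complex.I Y₂ (z₂ p) x := by
  constructor
  · intro hx
    refine (liftChange_of_isMultiple h₁ h₂ H₁ H₂ L₁ L₂).isNormal hB ?_ ?_
    · simp [hp₁, hp₂]
    · simpa [hp₂] using hx
  · intro hx
    refine (liftChange_of_isMultiple h₂ h₁ H₂ H₁ L₂ L₁).isNormal hB ?_ ?_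
    · simp [hp₁, hp₂]
    · simpa [hp₁] using hx

omit [ChartedSpace ℂ M] [IsManifold 𝓘(ℝ, ℂ) ∞ M] in
theorem IsParallelNull.isMultiple_polarLift {B : E →L[ℝ] E →L[ℝ] ℝ}
    {z : OpenPartialHomeomorph M ℂ} {X : M → E} {Y κ ψ : ℂ → E}
    (P : IsParallelNull B z.target 1 Complex.I Y κ ψ) (hψ : ∀ w ∈ z.target, ψ w = X (z.symm w)) :
    IsMultiple z X (polarLift B κ ψ) := fun w hw =>
  ⟨_, inv_ne_zero (mul_ne_zero two_ne_zero (P.pairing_ne w hw)), by rw [polarLift, hψ w hw]⟩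

theorem polarMap_transition {B : E →L[ℝ] E →L[ℝ] ℝ} (hB : ∀ x y, B x y = B y x)
    (hN : ∀ x, (∀ y, B x y = 0) → x = 0) {z₁ z₂ : OpenPartialHomeomorph M ℂ}
    (h₁ : z₁ ∈ IsManifold.maximalAtlas 𝓘(ℝ, ℂ) ∞ M)
    (h₂ : z₂ ∈ IsManifold.maximalAtlas 𝓘(ℝ, ℂ) ∞ M) {L L' X : M → E} {Φ : M → E →ₗ[ℝ] E} {a : ℝ}
    {Y₁ κ₁ Y₁' κ₁' Y₂ κ₂ Y₂' κ₂' : ℂ → E} {s₁ t₁ s₁' t₁' s₂ t₂ s₂' t₂' : ℂ → ℝ}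
    (Q₁ : SpectralPair B z₁.target 1 Complex.I a (fun w => Φ (z₁.symm w)) Y₁ κ₁ s₁ t₁
      Y₁' κ₁' s₁' t₁')
    (Q₂ : SpectralPair B z₂.target 1 Complex.I a (fun w => Φ (z₂.symm w)) Y₂ κ₂ s₂ t₂
      Y₂' κ₂' s₂' t₂')
    (P₁ : IsParallelNull B z₁.target 1 Complex.I Y₁ κ₁ (fun w => X (z₁.symm w)))
    (P₂ : IsParallelNull B z₂.target 1 Complex.I Y₂ κ₂ (fun w => X (z₂.symm w)))
    (hL₁ : IsMultiple z₁ L Y₁) (hL₂ : IsMultiple z₂ L Y₂) (hL₁' : IsMultiple z₁ L' Y₁')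
    (hL₂' : IsMultiple z₂ L' Y₂') {w : ℂ} (hw : w ∈ z₂.target) (hw₁ : z₂.symm w ∈ z₁.source) {x : E}
    (hx : IsNormal B 1 Complex.I (polarLift B κ₂ (fun w => X (z₂.symm w))) w x) :
    polarMap B 1 Complex.I a (fun w => Φ (z₁.symm w)) Y₁ κ₁ Y₁' (fun w => X (z₁.symm w))
        (z₁ (z₂.symm w)) x =
      polarMap B 1 Complex.I a (fun w => Φ (z₂.symm w)) Y₂ κ₂ Y₂' (fun w => X (z₂.symm w)) w x := by
  have T₁ := P₁.isothermicLift_polarLift Q₁.source hB hN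
  have T₂ := P₂.isothermicLift_polarLift Q₂.source hB hN
  have P₁' := Q₁.isParallelNull_map P₁
  have P₂' := Q₂.isParallelNull_map P₂
  have T₁' := P₁'.isothermicLift_polarLift Q₁.target hB hN
  have T₂' := P₂'.isothermicLift_polarLift Q₂.target hB hN
  have M₁ := P₁.isMultiple_polarLift (X := X) fun w _ => rfl
  have M₂ := P₂.isMultiple_polarLift (X := X) fun w _ => rfl
  have M₁' := P₁'.isMultiple_polarLift (X := fun p => Φ p (X p)) fun w _ => rfl
  have M₂' := P₂'.isMultiple_polarLift (X := fun p => Φ p (X p)) fun w _ => rfl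
  have hsrc : ∀ v ∈ (z₂.symm.trans z₁).source, z₂.symm v ∈ z₁.source ∧
      z₂.symm v ∈ z₂.source ∧ z₂ (z₂.symm v) = v := by
    intro v hv
    have h1 : v ∈ z₂.target := by simpa using hv.1
    exact ⟨by simpa using hv.2, z₂.map_target h1, z₂.right_inv h1⟩
  have hww : w ∈ (z₂.symm.trans z₁).source := by simp [hw, hw₁]
  have R := liftChange_of_isMultiple h₁ h₂ Q₁.source.toConformalLift Q₂.source.toConformalLift
    hL₁ hL₂
  have R' := liftChange_of_isMultiple h₁ h₂ Q₁.target.toConformalLift Q₂.target.toConformalLift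
    hL₁' hL₂'
  have hA : ∀ v ∈ (z₂.symm.trans z₁).source,
      Φ (z₂.symm v) = Φ (z₁.symm (z₁ (z₂.symm v))) := fun v hv => by
    rw [z₁.left_inv (hsrc v hv).1]
  have hψ : ∀ v ∈ (z₂.symm.trans z₁).source,
      X (z₂.symm v) = X (z₁.symm (z₁ (z₂.symm v))) := fun v hv => by
    rw [z₁.left_inv (hsrc v hv).1]
  have hn : ∀ {Y₁ Y₂ : ℂ → E} {L : M → E}, ConformalLift B z₁.target 1 Complex.I Y₁ →
      ConformalLift B z₂.target 1 Complex.I Y₂ → IsMultiple z₁ L Y₁ → IsMultiple z₂ L Y₂ →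
      ∀ v ∈ (z₂.symm.trans z₁).source, ∀ n,
        IsNormal B 1 Complex.I Y₂ v n ↔ IsNormal B 1 Complex.I Y₁ (z₁ (z₂.symm v)) n := by
    intro Y₁ Y₂ L H₁ H₂ L₁ L₂ v hv n
    have := isNormal_of_isMultiple hB h₁ h₂ H₁ H₂ L₁ L₂ (hsrc v hv).1 (hsrc v hv).2.1 (x := n)
    rw [(hsrc v hv).2.2] at this
    exact this.symm
  exact SpectralPair.polarMap_change Q₁ Q₂ P₁ P₂ R R' hA hψ
    (fun v hv n => (hn Q₁.source.toConformalLift Q₂.source.toConformalLift hL₁ hL₂ v hv n).1)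
    hB hN (fun v hv n => (hn T₁.toConformalLift T₂.toConformalLift M₁ M₂ v hv n).1)
    (fun v hv n => (hn T₁'.toConformalLift T₂'.toConformalLift M₁' M₂' v hv n).2) hww hx

/-- The polar surfaces of a surface and of its spectral transform, over a surface `M` covered by
coordinates. -/
theorem exists_polar_spectralPair {B : E →L[ℝ] E →L[ℝ] ℝ} (hB : ∀ x y, B x y = B y x)
    (hN : ∀ x, (∀ y, B x y = 0) → x = 0) {Z : Set (OpenPartialHomeomorph M ℂ)}
    (hZ : IsCoordinateCover Z) (L L' X : M → E) (Φ : M → E →ₗ[ℝ] E) (a : ℝ)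
    (hyp : ∀ z ∈ Z, ∃ (Y κ : ℂ → E) (s t : ℂ → ℝ) (Y' κ' : ℂ → E) (s' t' : ℂ → ℝ),
      SpectralPair B z.target 1 Complex.I a (fun w => Φ (z.symm w)) Y κ s t Y' κ' s' t' ∧
      IsParallelNull B z.target 1 Complex.I Y κ (fun w => X (z.symm w)) ∧
      IsMultiple z L Y ∧ IsMultiple z L' Y') :
    ∃ Ψ : M → E →ₗ[ℝ] E, ∀ z ∈ Z,
      ∃ (Y κ : ℂ → E) (s t : ℂ → ℝ) (Y' κ' : ℂ → E) (s' t' : ℂ → ℝ),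
      SpectralPair B z.target 1 Complex.I a (fun w => Ψ (z.symm w)) Y κ s t Y' κ' s' t' ∧
      IsMultiple z X Y ∧ IsMultiple z (fun p => Φ p (X p)) Y' := by
  choose! Y κ s t Y' κ' s' t' hyp using hyp
  -- The coordinate picked at a point need not vary continuously. On normal vectors the resulting
  -- map agrees with the one built in any z ∈ Z, which carries the smoothness.
  choose c hc hcs using hZ.cover
  refine ⟨fun p => polarMap B 1 Complex.I a (fun w => Φ ((c p).symm w)) (Y (c p)) (κ (c p))
    (Y' (c p)) (fun w => X ((c p).symm w)) (c p p), fun z hz => ?_⟩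
  obtain ⟨Q, P, hL, hL'⟩ := hyp z hz
  have D := Q.polar P hB hN
  refine ⟨polarLift B (κ z) _, _, _, _, polarLift B (κ' z) _, _, _, _,
    ⟨D.source, D.target, D.corr.congr D.source.isOpen fun w hw x hx => ?_, D.re_eq, D.im_eq⟩,
    P.isMultiple_polarLift fun w _ => rfl, (Q.isParallelNull_map P).isMultiple_polarLift fun w _ => rfl⟩
  obtain ⟨Q₁, P₁, hL₁, hL₁'⟩ := hyp _ (hc (z.symm w))
  exact polarMap_transition hB hN (hZ.smooth _ (hc (z.symm w))) (hZ.smooth z hz) Q₁ Q P₁ P hL₁ hL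
    hL₁' hL' hw (hcs _) hx

end Global

/-! ### Translation between the complex definitions and the real structure equations -/

section Conversion

variable {m s : ℕ}

theorem form_apply (m s : ℕ) (x y : Fin m → ℝ) :
    form m s x y = ∑ i, (if i.val + s < m then (1 : ℝ) else -1) * (x i * y i) := by
  rw [form, Matrix.toBilin'_apply']
  simp only [Matrix.mulVec_diagonal, dotProduct]
  exact Finset.sum_congr rfl fun i _ => by ring

theorem form_comm (m s : ℕ) (x y : Fin m → ℝ) : form m s x y = form m s y x := by
  simp only [form_apply, mul_comm]

theorem eq_zero_of_form (m s : ℕ) (x : Fin m → ℝ) (h : ∀ y, form m s x y = 0) : x = 0 := by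
  funext i
  have := h (Pi.single i 1)
  rw [form_apply, Finset.sum_eq_single i] at this
  · split_ifs at this <;> simpa using this
  · intro j _ hj
    simp [hj]
  · simp

/-- The scalar product as a continuous bilinear map. -/
noncomputable def formL (m s : ℕ) : (Fin m → ℝ) →L[ℝ] (Fin m → ℝ) →L[ℝ] ℝ :=
  LinearMap.toContinuousLinearMap
    ((LinearMap.toContinuousLinearMap : ((Fin m → ℝ) →ₗ[ℝ] ℝ) ≃ₗ[ℝ] _).toLinearMap ∘ₗ form m s)

theorem formL_apply (x y : Fin m → ℝ) : formL m s x y = form m s x y := rfl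

theorem formL_comm (x y : Fin m → ℝ) : formL m s x y = formL m s y x := form_comm m s x y

theorem eq_zero_of_formL (x : Fin m → ℝ) (h : ∀ y, formL m s x y = 0) : x = 0 :=
  eq_zero_of_form m s x h

theorem form_nondegenerate (m s : ℕ) : (form m s).Nondegenerate :=
  ⟨fun x h => eq_zero_of_form m s x h,
    fun y h => eq_zero_of_form m s y fun x => (form_comm m s y x).trans (h x)⟩

theorem form_isRefl (m s : ℕ) : (form m s).IsRefl := fun x y h => (form_comm m s y x).trans h

variable {U : Set ℂ} {Y : ℂ → Fin m → ℝ} {w : ℂ}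

theorem smooth_toC (hY : ContDiffOn ℝ ∞ Y U) : ContDiffOn ℝ ∞ (toC Y) U :=
  (ContinuousLinearMap.pi fun i : Fin m =>
    Complex.ofRealCLM.comp (ContinuousLinearMap.proj (R := ℝ) i)).contDiff.comp_contDiffOn hY

theorem pd_toC (hU : IsOpen U) (hY : ContDiffOn ℝ ∞ Y U) (hw : w ∈ U) (h : ℂ) :
    pd h (toC Y) w = toC (pd h Y) w :=
  pd_clm hU hY (ContinuousLinearMap.pi fun i : Fin m =>
    Complex.ofRealCLM.comp (ContinuousLinearMap.proj (R := ℝ) i)) hw h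

theorem dz_toC (hU : IsOpen U) (hY : ContDiffOn ℝ ∞ Y U) (hw : w ∈ U) :
    dz (toC Y) w = (1 / 2 : ℂ) • (toC (pd 1 Y) w - Complex.I • toC (pd Complex.I Y) w) := by
  rw [← pd_toC hU hY hw, ← pd_toC hU hY hw]
  rfl

theorem pd_dz_toC (hU : IsOpen U) (hY : ContDiffOn ℝ ∞ Y U) (hw : w ∈ U) (h : ℂ) :
    pd h (dz (toC Y)) w =
      (1 / 2 : ℂ) • (toC (pd h (pd 1 Y)) w - Complex.I • toC (pd h (pd Complex.I Y)) w) := by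
  have h1 := smooth_pd hU hY 1
  have h2 := smooth_pd hU hY Complex.I
  have d1 := differentiableAt_of_smooth hU (smooth_toC h1) hw
  have d2 := differentiableAt_of_smooth hU (smooth_toC h2) hw
  rw [pd_congr hU (fun w hw => dz_toC hU hY hw) hw, ← pd_toC hU h1 hw, ← pd_toC hU h2 hw]
  simp only [pd]
  have d3 : DifferentiableAt ℝ (fun w => Complex.I • toC (pd Complex.I Y) w) w :=
    d2.const_smul Complex.I
  have d4 : DifferentiableAt ℝ
    (fun w => toC (pd 1 Y) w - Complex.I • toC (pd Complex.I Y) w) w := d1.sub d3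
  rw [fderiv_fun_const_smul d4, fderiv_fun_sub d1 d3, fderiv_fun_const_smul d2]
  rfl

theorem toC_pd_comm (hU : IsOpen U) (hY : ContDiffOn ℝ ∞ Y U) (hw : w ∈ U) (e h : ℂ) :
    toC (pd h (pd e Y)) w = toC (pd e (pd h Y)) w := by
  funext i
  simp only [toC, pd_comm hU hY hw e h]

theorem dz_dz_toC (hU : IsOpen U) (hY : ContDiffOn ℝ ∞ Y U) (hw : w ∈ U) (i : Fin m) :
    dz (dz (toC Y)) w i = (1 / 4 : ℂ) *
      (((pd 1 (pd 1 Y) w - pd Complex.I (pd Complex.I Y) w) i : ℝ) -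
        2 * Complex.I * (pd 1 (pd Complex.I Y) w i : ℝ)) := by
  have h1 := pd_dz_toC hU hY hw 1
  have h2 := pd_dz_toC hU hY hw Complex.I
  have h3 : dz (dz (toC Y)) w =
    (1 / 2 : ℂ) • (pd 1 (dz (toC Y)) w - Complex.I • pd Complex.I (dz (toC Y)) w) := rfl
  rw [h3, h1, h2, toC_pd_comm hU hY hw 1 Complex.I]
  simp only [toC, Pi.smul_apply, Pi.sub_apply, smul_eq_mul, Complex.ofReal_sub]
  linear_combination (1 / 4 : ℂ) * (pd Complex.I (pd Complex.I Y) w i : ℂ) * Complex.I_sq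

theorem dzbar_dz_toC (hU : IsOpen U) (hY : ContDiffOn ℝ ∞ Y U) (hw : w ∈ U) (i : Fin m) :
    dzbar (dz (toC Y)) w i = ((1 / 4 : ℝ) * lap 1 Complex.I Y w i : ℝ) := by
  have h1 := pd_dz_toC hU hY hw 1
  have h2 := pd_dz_toC hU hY hw Complex.I
  have h3 : dzbar (dz (toC Y)) w =
    (1 / 2 : ℂ) • (pd 1 (dz (toC Y)) w + Complex.I • pd Complex.I (dz (toC Y)) w) := rfl
  rw [h3, h1, h2, toC_pd_comm hU hY hw 1 Complex.I, lap]
  simp only [toC, Pi.smul_apply, Pi.sub_apply, Pi.add_apply, smul_eq_mul]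
  push_cast
  linear_combination (-1 / 4 : ℂ) * (pd Complex.I (pd Complex.I Y) w i : ℂ) * Complex.I_sq

theorem tangentV_eq (hU : IsOpen U) (hY : ContDiffOn ℝ ∞ Y U) (hw : w ∈ U) :
    tangentV Y w = Submodule.span ℝ {Y w, (1 / 2 : ℝ) • pd 1 Y w,
      (-1 / 2 : ℝ) • pd Complex.I Y w, (1 / 4 : ℝ) • lap 1 Complex.I Y w} := by
  have h1 : (fun i => (dz (toC Y) w i).re) = (1 / 2 : ℝ) • pd 1 Y w := by
    funext i
    rw [dz_toC hU hY hw]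
    simp [toC]
  have h2 : (fun i => (dz (toC Y) w i).im) = (-1 / 2 : ℝ) • pd Complex.I Y w := by
    funext i
    rw [dz_toC hU hY hw]
    simp [toC]
    ring
  have h3 : (fun i => (dzbar (dz (toC Y)) w i).re) = (1 / 4 : ℝ) • lap 1 Complex.I Y w := by
    funext i
    rw [dzbar_dz_toC hU hY hw]
    rfl
  rw [tangentV, h1, h2, h3]

theorem mem_normalV_iff (hU : IsOpen U) (hY : ContDiffOn ℝ ∞ Y U) (hw : w ∈ U)
    {x : Fin m → ℝ} : x ∈ normalV s Y w ↔ IsNormal (formL m s) 1 Complex.I Y w x := by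
  rw [normalV, tangentV_eq hU hY hw, LinearMap.BilinForm.mem_orthogonal_iff]
  constructor
  · intro h
    have hm : ∀ n ∈ ({Y w, (1 / 2 : ℝ) • pd 1 Y w, (-1 / 2 : ℝ) • pd Complex.I Y w,
        (1 / 4 : ℝ) • lap 1 Complex.I Y w} : Set (Fin m → ℝ)), formL m s n x = 0 :=
      fun n hn => h n (Submodule.subset_span hn)
    simp only [Set.mem_insert_iff, Set.mem_singleton_iff, forall_eq_or_imp, forall_eq, map_smul,
      smul_apply, smul_eq_mul] at hm
    obtain ⟨h0, h1, h2, h3⟩ := hm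
    exact ⟨h0, by linarith, by linarith, by linarith⟩
  · intro h n hn
    change formL m s n x = 0
    induction hn using Submodule.span_induction with
    | mem n hn =>
      simp only [Set.mem_insert_iff, Set.mem_singleton_iff] at hn
      rcases hn with rfl | rfl | rfl | rfl
      · exact h.point
      · rw [map_smul, smul_apply, h.left, smul_zero]
      · rw [map_smul, smul_apply, h.right, smul_zero]
      · rw [map_smul, smul_apply, h.lap, smul_zero]
    | zero => simp
    | add a b _ _ ha hb => rw [map_add, add_apply, ha, hb, add_zero]
    | smul c a _ ha => rw [map_smul, smul_apply, ha, smul_zero]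

/-- V equals its double orthogonal complement, the form being nondegenerate. -/
theorem mem_tangentV_iff (hU : IsOpen U) (hY : ContDiffOn ℝ ∞ Y U) (hw : w ∈ U)
    {x : Fin m → ℝ} : x ∈ tangentV Y w ↔
      ∀ n, IsNormal (formL m s) 1 Complex.I Y w n → formL m s x n = 0 := by
  rw [← LinearMap.BilinForm.orthogonal_orthogonal (form_nondegenerate m s) (form_isRefl m s)
    (tangentV Y w), LinearMap.BilinForm.mem_orthogonal_iff]
  refine forall_congr' fun n => ?_
  rw [← mem_normalV_iff hU hY hw, normalV, formL_comm]
  rfl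

theorem isNormalDeriv_iff (hU : IsOpen U) (hY : ContDiffOn ℝ ∞ Y U) (hw : w ∈ U)
    {ξ : ℂ → Fin m → ℝ} {h : ℂ} {η : Fin m → ℝ} : IsNormalDeriv s Y ξ w h η ↔
      IsNormal (formL m s) 1 Complex.I Y w η ∧
        ∀ n, IsNormal (formL m s) 1 Complex.I Y w n → formL m s (pd h ξ w) n = formL m s η n := by
  rw [IsNormalDeriv, mem_normalV_iff hU hY hw, mem_tangentV_iff (s := s) hU hY hw]
  refine and_congr_right fun _ => forall₂_congr fun n _ => ?_
  rw [map_sub, sub_apply, sub_eq_zero]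
  rfl

variable {M : Type*} [TopologicalSpace M] {z : OpenPartialHomeomorph M ℂ} {y : M → ProjCone m s}

theorem IsCanonicalLift.isMultiple (h : IsCanonicalLift z y Y) :
    IsMultiple z (fun p => (y p).1.rep) Y := by
  intro w hw
  obtain ⟨h0, e⟩ := h.lift w hw
  obtain ⟨a, ha⟩ := Projectivization.exists_smul_eq_mk_rep ℝ (Y w) h0
  refine ⟨(a⁻¹ : ℝˣ), (a⁻¹).ne_zero, ?_⟩
  change Y w = ((a⁻¹ : ℝˣ) : ℝ) • (y (z.symm w)).1.rep
  rw [e, ← ha, ← Units.smul_def, inv_smul_smul]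

theorem IsCanonicalLift.conformalLift (h : IsCanonicalLift z y Y) :
    ConformalLift (formL m s) z.target 1 Complex.I Y := by
  have hu : ∀ w ∈ z.target, formL m s (pd 1 Y w) (pd 1 Y w) = 1 := fun w hw => 
    (h.metric w hw 1).trans (by simp)
  have hv : ∀ w ∈ z.target, formL m s (pd Complex.I Y w) (pd Complex.I Y w) = 1 := fun w hw => 
    (h.metric w hw Complex.I).trans (by simp)
  refine ⟨z.open_target, h.smooth, fun w hw => ?_, hu, hv, fun w hw => ?_⟩
  · obtain ⟨h0, e⟩ := h.lift w hw
    apply (y (z.symm w)).2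
    rw [e, Projectivization.submodule_mk]
    exact Submodule.mem_span_singleton_self _
  -- The metric condition is quadratic; the direction 1 + i polarises it.
  · have h1 : formL m s (pd (1 + Complex.I) Y w) (pd (1 + Complex.I) Y w) =
        ‖(1 + Complex.I : ℂ)‖ ^ 2 := h.metric w hw (1 + Complex.I)
    have h2 := formL_comm (s := s) (pd Complex.I Y w) (pd 1 Y w)
    rw [pd_eq_re_im, Complex.sq_norm, Complex.normSq_apply] at h1
    simp only [Complex.add_re, Complex.one_re, Complex.I_re, Complex.add_im, Complex.one_im,
      Complex.I_im, add_zero, zero_add, one_smul, map_add, add_apply, hu w hw, hv w hw, h2] at h1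
    linarith

theorem IsAdaptedLift.isothermicLift {S : ℂ → ℂ} {κ : ℂ → Fin m → ℝ}
    (h : IsAdaptedLift z y Y S κ) :
    IsothermicLift (formL m s) z.target 1 Complex.I Y κ (fun w => (S w).re)
      (fun w => (S w).im) := by
  have hY := h.canonical.smooth
  have hU := z.open_target
  have key : ∀ w ∈ z.target, ∀ i, (1 / 4 : ℂ) *
      (((pd 1 (pd 1 Y) w - pd Complex.I (pd Complex.I Y) w) i : ℝ) -
        2 * Complex.I * (pd 1 (pd Complex.I Y) w i : ℝ)) = -(S w / 2) * (Y w i : ℝ) + (κ w i : ℝ) :=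
    fun w hw i => by
      rw [← dz_dz_toC hU hY hw, h.eq w hw]
      rfl
  refine { toConformalLift := h.canonical.conformalLift, hopf := fun w hw => ?_,
           mixed := fun w hw => ?_, lap_kappa := fun w hw => ?_ }
  · funext i
    have := congrArg Complex.re (key w hw i)
    simp at this
    simp
    linarith
  · funext i
    have := congrArg Complex.im (key w hw i)
    simp at this
    simp
    linarith
  · exact ((mem_normalV_iff hU hY hw).1 (h.normal w hw)).lap

theorem IsothermicLift.isAdaptedLift {f : M → ProjCone m s} {X : M → Fin m → ℝ}
    {κ : ℂ → Fin m → ℝ} {a b : ℂ → ℝ}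
    (H : IsothermicLift (formL m s) z.target 1 Complex.I Y κ a b) (hX : Represents X f)
    (hm : IsMultiple z X Y) : IsAdaptedLift z f Y (fun w => ⟨a w, b w⟩) κ := by
  refine ⟨⟨H.smooth, fun w hw => ?_, fun w hw h => ?_⟩, fun w hw => ?_, fun w hw => ?_⟩
  · obtain ⟨θ, h0, e⟩ := hm w hw
    obtain ⟨hX0, eX⟩ := hX (z.symm w)
    have hY0 : Y w ≠ 0 := by
      rw [e]
      exact smul_ne_zero h0 hX0
    refine ⟨hY0, ?_⟩
    rw [eX, Projectivization.mk_eq_mk_iff']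
    exact ⟨θ⁻¹, by rw [e, smul_smul, inv_mul_cancel₀ h0, one_smul]⟩
  · have := H.form_pd_pd formL_comm hw h h
    rw [Complex.sq_norm, Complex.normSq_apply]
    exact this
  · exact (mem_normalV_iff H.isOpen H.smooth hw).2 (H.kappa_normal formL_comm hw)
  · funext i
    rw [dz_dz_toC H.isOpen H.smooth hw, H.hopf w hw, H.mixed w hw]
    apply Complex.ext <;> simp [toC] <;> ring

theorem IsNormalCorrespondence.normalCorr {Φ : M → (Fin m → ℝ) →ₗ[ℝ] (Fin m → ℝ)}
    {κ Y' κ' : ℂ → Fin m → ℝ} {a b a' b' : ℂ → ℝ}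
    (C : IsNormalCorrespondence s z Φ Y κ Y' κ')
    (H : IsothermicLift (formL m s) z.target 1 Complex.I Y κ a b)
    (H' : IsothermicLift (formL m s) z.target 1 Complex.I Y' κ' a' b') :
    NormalCorr (formL m s) z.target 1 Complex.I (fun w => Φ (z.symm w)) Y κ Y' κ' := by
  have hU := H.isOpen
  have mem : ∀ {w}, w ∈ z.target → ∀ {x}, x ∈ normalV s Y w ↔
      IsNormal (formL m s) 1 Complex.I Y w x := fun hw _ => mem_normalV_iff hU H.smooth hw
  have mem' : ∀ {w}, w ∈ z.target → ∀ {x}, x ∈ normalV s Y' w ↔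
      IsNormal (formL m s) 1 Complex.I Y' w x := fun hw _ => mem_normalV_iff hU H'.smooth hw
  have hmap : ∀ w ∈ z.target, ∀ x, IsNormal (formL m s) 1 Complex.I Y w x →
      IsNormal (formL m s) 1 Complex.I Y' w (Φ (z.symm w) x) := fun w hw x hx => by
    rw [← mem' hw, ← C.map_eq w hw]
    exact Submodule.mem_map_of_mem ((mem hw).2 hx)
  have hiso : ∀ w ∈ z.target, ∀ x, IsNormal (formL m s) 1 Complex.I Y w x → ∀ y,
      IsNormal (formL m s) 1 Complex.I Y w y →
      formL m s (Φ (z.symm w) x) (Φ (z.symm w) y) = formL m s x y := by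
    intro w hw x hx y hy
    have h1 : formL m s _ _ = formL m s x x := C.isometry w hw x ((mem hw).2 hx)
    have h2 : formL m s _ _ = formL m s y y := C.isometry w hw y ((mem hw).2 hy)
    have h3 : formL m s _ _ = formL m s (x + y) (x + y) :=
      C.isometry w hw (x + y) ((mem hw).2 (hx.add hy))
    have h4 := formL_comm (s := s) y x
    have h5 := formL_comm (s := s) (Φ (z.symm w) y) (Φ (z.symm w) x)
    simp only [map_add, add_apply, h1, h2, h4, h5] at h3
    linarith
  have hconn : ∀ h : ℂ, ∀ ξ : ℂ → Fin m → ℝ, ContDiffOn ℝ ∞ ξ z.target →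
      (∀ w ∈ z.target, IsNormal (formL m s) 1 Complex.I Y w (ξ w)) →
      ∀ w ∈ z.target, ∀ n, IsNormal (formL m s) 1 Complex.I Y w n →
      formL m s (pd h (fun w => Φ (z.symm w) (ξ w)) w) (Φ (z.symm w) n) =
        formL m s (pd h ξ w) n := by
    intro h ξ hξ hn w hw n hnw
    -- The normal projection of the derivative is the vector η = D_h ξ to which the connection
    -- hypothesis applies.
    have hη := H.isNormal_sub_frameComb formL_comm hw (pd h ξ w)
    have hnorm : ∀ n, IsNormal (formL m s) 1 Complex.I Y w n → formL m s (pd h ξ w) n =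
        formL m s (pd h ξ w - frameComb (formL m s) 1 Complex.I Y κ Y w (pd h ξ w)) n := by
      intro n hnw
      rw [map_sub, sub_apply, formL_comm (frameComb _ _ _ _ _ _ _ _) n,
        IsothermicLift.form_frameComb_normal hnw formL_comm, sub_zero]
    have h1 := C.connection ξ hξ (fun w hw => (mem hw).2 (hn w hw)) w hw h _
      ((isNormalDeriv_iff hU H.smooth hw).2 ⟨hη, hnorm⟩)
    rw [((isNormalDeriv_iff hU H'.smooth hw).1 h1).2 _ (hmap w hw n hnw), hiso w hw _ hη n hnw,
      ← hnorm n hnw]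
  exact
    { map_normal := hmap
      surj := fun w hw x' hx' => by
        rw [← mem' hw, ← C.map_eq w hw] at hx'
        obtain ⟨x, hx, e⟩ := hx'
        exact ⟨x, (mem hw).1 hx, e⟩
      isometry := hiso
      hopf := fun w hw x hx => C.hopf w hw x ((mem hw).2 hx)
      smooth := fun ξ hξ hn => C.smooth ξ hξ fun w hw => (mem hw).2 (hn w hw)
      connection_left := hconn 1
      connection_right := hconn Complex.I }

theorem NormalCorr.form_pd {B : (Fin m → ℝ) →L[ℝ] (Fin m → ℝ) →L[ℝ] ℝ} {U : Set ℂ}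
    {A : ℂ → (Fin m → ℝ) →ₗ[ℝ] (Fin m → ℝ)} {Y κ Y' κ' : ℂ → Fin m → ℝ}
    (C : NormalCorr B U 1 Complex.I A Y κ Y' κ') {ξ : ℂ → Fin m → ℝ} (hξ : ContDiffOn ℝ ∞ ξ U)
    (hn : ∀ w ∈ U, IsNormal B 1 Complex.I Y w (ξ w)) {w : ℂ} (hw : w ∈ U) {n : Fin m → ℝ}
    (h : IsNormal B 1 Complex.I Y w n) (k : ℂ) :
    B (pd k (fun w => A w (ξ w)) w) (A w n) = B (pd k ξ w) n := by
  rw [pd_eq_re_im, pd_eq_re_im ξ]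
  simp only [map_add, map_smul, add_apply, smul_apply, C.connection_left ξ hξ hn w hw n h,
    C.connection_right ξ hξ hn w hw n h]

theorem NormalCorr.isNormalCorrespondence {Φ : M → (Fin m → ℝ) →ₗ[ℝ] (Fin m → ℝ)}
    {κ Y' κ' : ℂ → Fin m → ℝ}
    (C : NormalCorr (formL m s) z.target 1 Complex.I (fun w => Φ (z.symm w)) Y κ Y' κ')
    (hY : ContDiffOn ℝ ∞ Y z.target) (hY' : ContDiffOn ℝ ∞ Y' z.target) :
    IsNormalCorrespondence s z Φ Y κ Y' κ' := by
  have hU := z.open_target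
  have mem : ∀ {w}, w ∈ z.target → ∀ {x}, x ∈ normalV s Y w ↔
      IsNormal (formL m s) 1 Complex.I Y w x := fun hw _ => mem_normalV_iff hU hY hw
  have mem' : ∀ {w}, w ∈ z.target → ∀ {x}, x ∈ normalV s Y' w ↔
      IsNormal (formL m s) 1 Complex.I Y' w x := fun hw _ => mem_normalV_iff hU hY' hw
  refine ⟨fun w hw => ?_, fun w hw x hx => ?_, fun w hw x hx => ?_, fun ξ hξ hn => ?_,
    fun ξ hξ hn w hw h η hη => ?_⟩
  · ext x
    rw [mem' hw, Submodule.mem_map]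
    constructor
    · rintro ⟨n, hn, rfl⟩
      exact C.map_normal w hw n ((mem hw).1 hn)
    · intro hx
      obtain ⟨n, hn, e⟩ := C.surj w hw x hx
      exact ⟨n, (mem hw).2 hn, e⟩
  · exact C.isometry w hw x ((mem hw).1 hx) x ((mem hw).1 hx)
  · exact C.hopf w hw x ((mem hw).1 hx)
  · exact C.smooth ξ hξ fun w hw => (mem hw).1 (hn w hw)
  · rw [isNormalDeriv_iff hU hY hw] at hη
    rw [isNormalDeriv_iff hU hY' hw]
    refine ⟨C.map_normal w hw η hη.1, fun n' hn' => ?_⟩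
    obtain ⟨n, hnw, rfl⟩ := C.surj w hw n' hn'
    rw [C.form_pd hξ (fun w hw => (mem hw).1 (hn w hw)) hw hnw, hη.2 n hnw,
      C.isometry w hw η hη.1 n hnw]

end Conversion

/-! ### Adding a dimension to reduce c ≠ 0 to the null case -/

section Extension

variable {E F : Type*} [NormedAddCommGroup E] [NormedSpace ℝ E] [NormedAddCommGroup F]
  [NormedSpace ℝ F]

/-- The isometric embedding `J` has the left inverse `R`, and `x = J (R x) + T x • u`, where `u` is
orthogonal to the image of `J` and `⟨u, u⟩ = -c`. -/
structure IsExtension (B : E →L[ℝ] E →L[ℝ] ℝ) (B' : F →L[ℝ] F →L[ℝ] ℝ) (c : ℝ) (J : E →L[ℝ] F)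
    (R : F →L[ℝ] E) (T : F →L[ℝ] ℝ) (u : F) : Prop where
  left_inv : ∀ x, R (J x) = x
  decomp : ∀ x, x = J (R x) + T x • u
  left_u : R u = 0
  form_map : ∀ x y, B' (J x) (J y) = B x y
  form_map_u : ∀ x, B' (J x) u = 0
  form_u_map : ∀ x, B' u (J x) = 0
  form_u : B' u u = -c

variable {B : E →L[ℝ] E →L[ℝ] ℝ} {B' : F →L[ℝ] F →L[ℝ] ℝ} {c : ℝ} {J : E →L[ℝ] F}
  {R : F →L[ℝ] E} {T : F →L[ℝ] ℝ} {u : F}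

/-- The extension of a family of linear maps by the identity on the complement. -/
noncomputable def extendMap (J : E →L[ℝ] F) (R : F →L[ℝ] E) (T : F →L[ℝ] ℝ) (u : F)
    (A : E →ₗ[ℝ] E) : F →ₗ[ℝ] F :=
  J.toLinearMap ∘ₗ A ∘ₗ R.toLinearMap + T.toLinearMap.smulRight u

theorem extendMap_apply (A : E →ₗ[ℝ] E) (x : F) :
    extendMap J R T u A x = J (A (R x)) + T x • u := rfl

variable {U : Set ℂ} {e f : ℂ} {Y κ Y' κ' ψ : ℂ → E} {s t s' t' : ℂ → ℝ} {w : ℂ}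

theorem smooth_clm_comp (T : E →L[ℝ] F) (hY : ContDiffOn ℝ ∞ Y U) :
    ContDiffOn ℝ ∞ (fun w => T (Y w)) U := T.contDiff.comp_contDiffOn hY

theorem pd_pd_clm (hU : IsOpen U) (hY : ContDiffOn ℝ ∞ Y U) (T : E →L[ℝ] F) (hw : w ∈ U)
    (e h : ℂ) : pd h (pd e fun w => T (Y w)) w = T (pd h (pd e Y) w) := by
  rw [pd_congr hU (fun w hw => pd_clm hU hY T hw e) hw, pd_clm hU (smooth_pd hU hY e) T hw]

theorem lap_clm (hU : IsOpen U) (hY : ContDiffOn ℝ ∞ Y U) (T : E →L[ℝ] F) (hw : w ∈ U) :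
    lap e f (fun w => T (Y w)) w = T (lap e f Y w) := by
  rw [lap, lap, pd_pd_clm hU hY T hw, pd_pd_clm hU hY T hw, map_add]

namespace IsExtension

variable (X : IsExtension B B' c J R T u)
include X

theorem left_apply (x : E) (a : ℝ) : R (J x + a • u) = x := by
  rw [map_add, map_smul, X.left_inv, X.left_u, smul_zero, add_zero]

theorem form_left (x : E) (y : F) : B' (J x) y = B x (R y) := by
  conv_lhs => rw [X.decomp y]
  rw [map_add, map_smul, X.form_map, X.form_map_u, smul_zero, add_zero]

theorem form_add (x y : E) (a b : ℝ) :
    B' (J x + a • u) (J y + b • u) = B x y - c * (a * b) := by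
  simp only [map_add, map_smul, add_apply, smul_apply, smul_eq_mul, X.form_map, X.form_map_u,
    X.form_u_map, X.form_u]
  ring

theorem form_eq (x y : F) : B' x y = B (R x) (R y) - c * (T x * T y) := by
  conv_lhs => rw [X.decomp x, X.decomp y]
  rw [X.form_add]

theorem smul_T (x : E) (a : ℝ) : T (J x + a • u) • u = a • u := by
  have h := X.decomp (J x + a • u)
  rw [X.left_apply] at h
  exact (add_left_cancel h).symm

/-- The frame of JY is the image of the frame of Y, and u is orthogonal to it. -/
theorem isNormal_iff (hU : IsOpen U) (hY : ContDiffOn ℝ ∞ Y U) (hw : w ∈ U) {x : F} :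
    IsNormal B' e f (fun w => J (Y w)) w x ↔ IsNormal B e f Y w (R x) := by
  constructor
  · rintro ⟨h0, h1, h2, h3⟩
    rw [pd_clm hU hY J hw, X.form_left] at h1 h2
    rw [lap_clm hU hY J hw, X.form_left] at h3
    rw [X.form_left] at h0
    exact ⟨h0, h1, h2, h3⟩
  · rintro ⟨h0, h1, h2, h3⟩
    refine ⟨?_, ?_, ?_, ?_⟩
    · rw [X.form_left, h0]
    · rw [pd_clm hU hY J hw, X.form_left, h1]
    · rw [pd_clm hU hY J hw, X.form_left, h2]
    · rw [lap_clm hU hY J hw, X.form_left, h3]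

theorem isothermicLift (H : IsothermicLift B U e f Y κ s t) :
    IsothermicLift B' U e f (fun w => J (Y w)) (fun w => J (κ w)) s t where
  isOpen := H.isOpen
  smooth := smooth_clm_comp J H.smooth
  null w hw := by rw [X.form_map, H.null w hw]
  unit_left w hw := by rw [pd_clm H.isOpen H.smooth J hw, X.form_map, H.unit_left w hw]
  unit_right w hw := by rw [pd_clm H.isOpen H.smooth J hw, X.form_map, H.unit_right w hw]
  ortho w hw := by
    rw [pd_clm H.isOpen H.smooth J hw, pd_clm H.isOpen H.smooth J hw, X.form_map, H.ortho w hw]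
  hopf w hw := by
    rw [pd_pd_clm H.isOpen H.smooth J hw, pd_pd_clm H.isOpen H.smooth J hw, ← map_sub, H.hopf w hw,
      map_add, map_smul, map_smul]
  mixed w hw := by rw [pd_pd_clm H.isOpen H.smooth J hw, H.mixed w hw, map_smul]
  lap_kappa w hw := by rw [lap_clm H.isOpen H.smooth J hw, X.form_map, H.lap_kappa w hw]

theorem smooth_extendMap {A : ℂ → E →ₗ[ℝ] E} {ξ : ℂ → F} (hξ : ContDiffOn ℝ ∞ ξ U)
    (hA : ContDiffOn ℝ ∞ (fun w => A w (R (ξ w))) U) :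
    ContDiffOn ℝ ∞ (fun w => extendMap J R T u (A w) (ξ w)) U :=
  smooth_add (smooth_clm_comp J hA) (smooth_smul (smooth_clm_comp T hξ) contDiffOn_const)

theorem connection_extendMap (hU : IsOpen U) {A : ℂ → E →ₗ[ℝ] E} {ξ : ℂ → F}
    (hξ : ContDiffOn ℝ ∞ ξ U) (hA : ContDiffOn ℝ ∞ (fun w => A w (R (ξ w))) U) (hw : w ∈ U) (n : F)
    (h : ℂ) (hc : B (pd h (fun w => A w (R (ξ w))) w) (A w (R n)) =
      B (pd h (fun w => R (ξ w)) w) (R n)) :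
    B' (pd h (fun w => extendMap J R T u (A w) (ξ w)) w) (extendMap J R T u (A w) n) =
      B' (pd h ξ w) n := by
  have h1 := pd_add hU (smooth_clm_comp J hA)
    (smooth_smul (smooth_clm_comp T hξ) (contDiffOn_const (c := u))) hw h
  rw [pd_clm hU hA J hw, pd_smul hU (smooth_clm_comp T hξ) contDiffOn_const hw, pd_const,
    smul_zero, add_zero, pd_clm hU hξ T hw] at h1
  rw [pd_clm hU hξ R hw] at hc
  change pd h (fun w => extendMap J R T u (A w) (ξ w)) w = _ at h1
  rw [h1, extendMap_apply, X.form_add, hc, X.form_eq (pd h ξ w) n]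

theorem normalCorr {A : ℂ → E →ₗ[ℝ] E} (H : IsothermicLift B U e f Y κ s t)
    (H' : IsothermicLift B U e f Y' κ' s' t') (C : NormalCorr B U e f A Y κ Y' κ') :
    NormalCorr B' U e f (fun w => extendMap J R T u (A w)) (fun w => J (Y w)) (fun w => J (κ w))
      (fun w => J (Y' w)) (fun w => J (κ' w)) := by
  have hU := H.isOpen
  have mem : ∀ {w}, w ∈ U → ∀ {x}, IsNormal B' e f (fun w => J (Y w)) w x ↔
    IsNormal B e f Y w (R x) := fun hw _ => X.isNormal_iff hU H.smooth hw
  have mem' : ∀ {w}, w ∈ U → ∀ {x}, IsNormal B' e f (fun w => J (Y' w)) w x ↔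
    IsNormal B e f Y' w (R x) := fun hw _ => X.isNormal_iff hU H'.smooth hw
  have hR : ∀ {ξ : ℂ → F}, (∀ w ∈ U, IsNormal B' e f (fun w => J (Y w)) w (ξ w)) →
      ∀ w ∈ U, IsNormal B e f Y w (R (ξ w)) := fun hn w hw => (mem hw).1 (hn w hw)
  refine ⟨fun w hw x hx => ?_, fun w hw x' hx' => ?_, fun w hw x hx y hy => ?_, fun w hw x hx => ?_,
    fun ξ hξ hn => ?_, fun ξ hξ hn w hw n hnw => ?_, fun ξ hξ hn w hw n hnw => ?_⟩
  · rw [mem' hw, extendMap_apply, X.left_apply]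
    exact C.map_normal w hw _ ((mem hw).1 hx)
  · obtain ⟨n, hn, h⟩ := C.surj w hw _ ((mem' hw).1 hx')
    refine ⟨J n + T x' • u, ?_, ?_⟩
    · rw [mem hw, X.left_apply]
      exact hn
    · rw [extendMap_apply, X.left_apply, X.smul_T, h, ← X.decomp]
  · rw [extendMap_apply, extendMap_apply, X.form_add,
      C.isometry w hw _ ((mem hw).1 hx) _ ((mem hw).1 hy), ← X.form_eq]
  · rw [X.form_left, X.form_left, extendMap_apply, X.left_apply]
    exact C.hopf w hw _ ((mem hw).1 hx)
  · exact X.smooth_extendMap hξ (C.smooth _ (smooth_clm_comp R hξ) (hR hn))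
  · exact X.connection_extendMap hU hξ (C.smooth _ (smooth_clm_comp R hξ) (hR hn)) hw n e
      (C.connection_left _ (smooth_clm_comp R hξ) (hR hn) w hw _ ((mem hw).1 hnw))
  · exact X.connection_extendMap hU hξ (C.smooth _ (smooth_clm_comp R hξ) (hR hn)) hw n f
      (C.connection_right _ (smooth_clm_comp R hξ) (hR hn) w hw _ ((mem hw).1 hnw))

theorem spectralPair {a : ℝ} {A : ℂ → E →ₗ[ℝ] E}
    (Q : SpectralPair B U e f a A Y κ s t Y' κ' s' t') :
    SpectralPair B' U e f a (fun w => extendMap J R T u (A w)) (fun w => J (Y w))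
      (fun w => J (κ w)) s t (fun w => J (Y' w)) (fun w => J (κ' w)) s' t' where
  source := X.isothermicLift Q.source
  target := X.isothermicLift Q.target
  corr := X.normalCorr Q.source Q.target Q.corr
  re_eq := Q.re_eq
  im_eq := Q.im_eq

/-- The constant u contributes -c to the square and nothing to the derivative or to the pairing with
Jκ. -/
theorem isParallelNull (hU : IsOpen U) (hY : ContDiffOn ℝ ∞ Y U)
    (P : IsParallelSection B U e f Y ψ) (hc : ∀ w ∈ U, B (ψ w) (ψ w) = c)
    (h0 : ∀ w ∈ U, B (κ w) (ψ w) ≠ 0) :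
    IsParallelNull B' U e f (fun w => J (Y w)) (fun w => J (κ w)) (fun w => J (ψ w) + u) := by
  have hpd : ∀ h, ∀ w ∈ U, pd h (fun w => J (ψ w) + u) w = J (pd h ψ w) := fun h w hw => by
    rw [pd_add hU (smooth_clm_comp J P.smooth) contDiffOn_const hw, pd_clm hU P.smooth J hw,
      pd_const, add_zero]
  have hR : ∀ w, R (J (ψ w) + u) = ψ w := fun w => by
    have := X.left_apply (ψ w) 1
    rwa [one_smul] at this
  refine ⟨⟨smooth_add (smooth_clm_comp J P.smooth) contDiffOn_const, fun w hw => ?_,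
    fun w hw n hn => ?_, fun w hw n hn => ?_⟩, fun w hw => ?_, fun w hw => ?_⟩
  · rw [X.isNormal_iff hU hY hw, hR]
    exact P.normal w hw
  · rw [hpd e w hw, X.form_left]
    exact P.parallel_left w hw _ ((X.isNormal_iff hU hY hw).1 hn)
  · rw [hpd f w hw, X.form_left]
    exact P.parallel_right w hw _ ((X.isNormal_iff hU hY hw).1 hn)
  · have := X.form_add (ψ w) (ψ w) 1 1
    rw [one_smul, hc w hw] at this
    rw [this]
    ring
  · rw [X.form_left, hR]
    exact h0 w hw

end IsExtension

/-- If the differential of a parallel section is injective, then its pairing with the Hopf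
differential has no zeros. -/
theorem IsParallelSection.pairing_ne (P : IsParallelSection B U 1 Complex.I Y ψ)
    (H : IsothermicLift B U 1 Complex.I Y κ s t) (hB : ∀ x y, B x y = B y x)
    (hN : ∀ x, (∀ y, B x y = 0) → x = 0) (hw : w ∈ U) (himm : ∀ h, pd h ψ w = 0 → h = 0) :
    B (κ w) (ψ w) ≠ 0 := by
  intro h0
  have h1 := P.pd_left_eq H hB hN hw
  have h2 := P.pd_right_eq H hB hN hw
  rw [h0, mul_zero, zero_smul, sub_zero] at h1
  rw [h0, mul_zero, zero_smul, add_zero] at h2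
  generalize -(1 / 2) * B (lap 1 Complex.I Y w) (pd 1 ψ w) = b₁ at h1
  generalize -(1 / 2) * B (lap 1 Complex.I Y w) (pd Complex.I ψ w) = b₂ at h2
  -- If ρ = 0, the derivatives are ψ_u = b₁Y and ψ_v = b₂Y, so the direction (b₂, -b₁) lies in the
  -- kernel of dψ.
  have h3 : (⟨b₂, -b₁⟩ : ℂ) = 0 := himm _ (by
    rw [pd_eq_re_im, h1, h2]
    module)
  have h4 : b₁ = 0 := by simpa using congrArg Complex.im h3
  rw [h4, zero_smul] at h1
  exact one_ne_zero (himm 1 h1)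

end Extension

/-! ### Assembly of the three cases c = 0, c > 0, c < 0 -/

section Final

variable {M : Type*} [TopologicalSpace M] [ChartedSpace ℂ M] [IsManifold 𝓘(ℝ, ℂ) ∞ M]
  {Z : Set (OpenPartialHomeomorph M ℂ)}

omit [TopologicalSpace M] [ChartedSpace ℂ M] [IsManifold 𝓘(ℝ, ℂ) ∞ M] in
theorem exists_represents {m s : ℕ} (X : M → Fin m → ℝ) (h0 : ∀ p, X p ≠ 0)
    (hX : ∀ p, formL m s (X p) (X p) = 0) : ∃ f : M → ProjCone m s, Represents X f := by
  refine ⟨fun p => ⟨Projectivization.mk ℝ (X p) (h0 p), fun x hx => ?_⟩, fun p => ⟨h0 p, rfl⟩⟩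
  rw [Projectivization.submodule_mk, Submodule.mem_span_singleton] at hx
  obtain ⟨t, rfl⟩ := hx
  change formL m s (t • X p) (t • X p) = 0
  rw [map_smul, map_smul, smul_apply, hX p, smul_zero, smul_zero]

/-- Serves all signs of c: J and u encode the conformal embedding of the quadric, and in the larger
space the section ψ + u is null. -/
theorem exists_isSpectralTransform {m s m' s' : ℕ} {c : ℝ} {J : (Fin m → ℝ) →L[ℝ] (Fin m' → ℝ)}
    {R : (Fin m' → ℝ) →L[ℝ] (Fin m → ℝ)} {T : (Fin m' → ℝ) →L[ℝ] ℝ} {u : Fin m' → ℝ}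
    (X : IsExtension (formL m s) (formL m' s') c J R T u) (hZ : IsCoordinateCover Z)
    {L L' ψ : M → Fin m → ℝ} {Φ : M → (Fin m → ℝ) →ₗ[ℝ] (Fin m → ℝ)} {a : ℝ}
    (hyp : ∀ z ∈ Z, ∃ (Y κ : ℂ → Fin m → ℝ) (b d : ℂ → ℝ) (Y' κ' : ℂ → Fin m → ℝ) (b' d' : ℂ → ℝ),
      SpectralPair (formL m s) z.target 1 Complex.I a (fun w => Φ (z.symm w)) Y κ b d Y' κ' b' d' ∧
      IsParallelSection (formL m s) z.target 1 Complex.I Y (fun w => ψ (z.symm w)) ∧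
      (∀ w ∈ z.target, formL m s (κ w) (ψ (z.symm w)) ≠ 0) ∧
      IsMultiple z L Y ∧ IsMultiple z L' Y')
    (hc : ∀ p, formL m s (ψ p) (ψ p) = c) :
    ∃ f f' : M → ProjCone m' s', Represents (fun p => J (ψ p) + u) f ∧
      Represents (fun p => J (Φ p (ψ p)) + u) f' ∧ IsSpectralTransform Z a f f' := by
  have hext : ∀ p, extendMap J R T u (Φ p) (J (ψ p) + u) = J (Φ p (ψ p)) + u := fun p => by
    have h1 := X.left_apply (ψ p) 1
    have h2 := X.smul_T (ψ p) 1
    rw [one_smul] at h1 h2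
    rw [extendMap_apply, h1, h2]
  have hyp' : ∀ z ∈ Z, ∃ (Y κ : ℂ → Fin m' → ℝ) (b d : ℂ → ℝ) (Y' κ' : ℂ → Fin m' → ℝ)
      (b' d' : ℂ → ℝ), SpectralPair (formL m' s') z.target 1 Complex.I a
        (fun w => extendMap J R T u (Φ (z.symm w))) Y κ b d Y' κ' b' d' ∧
      IsParallelNull (formL m' s') z.target 1 Complex.I Y κ (fun w => J (ψ (z.symm w)) + u) ∧
      IsMultiple z (fun p => J (L p)) Y ∧ IsMultiple z (fun p => J (L' p)) Y' := by
    intro z hz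
    obtain ⟨Y, κ, b, d, Y', κ', b', d', Q, P, h0, hL, hL'⟩ := hyp z hz
    refine ⟨_, _, _, _, _, _, _, _, X.spectralPair Q,
      X.isParallelNull z.open_target Q.source.smooth P (fun w _ => hc _) h0, fun w hw => ?_,
      fun w hw => ?_⟩
    · obtain ⟨θ, hθ, e⟩ := hL w hw
      exact ⟨θ, hθ, by simp only [e, map_smul]⟩
    · obtain ⟨θ, hθ, e⟩ := hL' w hw
      exact ⟨θ, hθ, by simp only [e, map_smul]⟩
  have hpt : ∀ p, (J (ψ p) + u ≠ 0 ∧ formL m' s' (J (ψ p) + u) (J (ψ p) + u) = 0) ∧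
      (J (Φ p (ψ p)) + u ≠ 0 ∧
        formL m' s' (J (Φ p (ψ p)) + u) (J (Φ p (ψ p)) + u) = 0) := by
    intro p
    obtain ⟨z, hz, hp⟩ := hZ.cover p
    obtain ⟨Y, κ, b, d, Y', κ', b', d', Q, P, -, -⟩ := hyp' z hz
    have P' := Q.isParallelNull_map P
    have hw := z.map_source hp
    have h1 := P.null _ hw
    have h2 := P'.null _ hw
    have h3 := P.pairing_ne _ hw
    have h4 := P'.pairing_ne _ hw
    -- The nonzero pairings with the Hopf differentials show that neither section vanishes, so both
    -- define points of the light cone.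
    simp only [z.left_inv hp, hext] at h1 h2 h3 h4
    refine ⟨⟨fun h => h3 ?_, h1⟩, ⟨fun h => h4 ?_, h2⟩⟩
    · rw [h, map_zero]
    · rw [h, map_zero]
  obtain ⟨f, hf⟩ := exists_represents _ (fun p => (hpt p).1.1) (fun p => (hpt p).1.2)
  obtain ⟨f', hf'⟩ := exists_represents _ (fun p => (hpt p).2.1) (fun p => (hpt p).2.2)
  refine ⟨f, f', hf, hf', ?_⟩
  obtain ⟨Ψ, hΨ⟩ := exists_polar_spectralPair formL_comm eq_zero_of_formL hZ (fun p => J (L p))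
    (fun p => J (L' p)) (fun p => J (ψ p) + u) (fun p => extendMap J R T u (Φ p)) a hyp'
  refine ⟨Ψ, fun z hz => ?_⟩
  obtain ⟨Y, κ, b, d, Y', κ', b', d', Q, hm, hm'⟩ := hΨ z hz
  simp only [hext] at hm'
  refine ⟨Y, _, κ, Y', _, κ', Q.source.isAdaptedLift hf hm, Q.target.isAdaptedLift hf' hm',
    Q.corr.isNormalCorrespondence Q.source.smooth Q.target.smooth, fun w hw => ?_⟩
  apply Complex.ext
  · simp [Q.re_eq w hw]
  · simp [Q.im_eq w hw]

theorem isExtension_id (m s : ℕ) : IsExtension (formL m s) (formL m s) 0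
    (ContinuousLinearMap.id ℝ _) (ContinuousLinearMap.id ℝ _) 0 0 := by
  constructor <;> simp

/-- The new coordinate is the last one and negative, so u = (0, √c) has square -c. -/
theorem isExtension_snoc (m s : ℕ) {c : ℝ} (hc : 0 < c) :
    ∃ J R T, (∀ x, J x + Fin.snoc (α := fun _ => ℝ) 0 (√c) =
        Fin.snoc (α := fun _ => ℝ) x (√c)) ∧
      IsExtension (formL m s) (formL (m + 1) (s + 1)) c J R T
        (Fin.snoc (α := fun _ => ℝ) 0 (√c)) := by
  have hc0 : √c ≠ 0 := (Real.sqrt_pos.2 hc).ne'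
  have hf : ∀ (x y : Fin m → ℝ) (a b : ℝ), formL (m + 1) (s + 1)
      (Fin.snoc (α := fun _ => ℝ) x a) (Fin.snoc (α := fun _ => ℝ) y b) =
        formL m s x y - a * b := by
    intro x y a b
    rw [formL_apply, formL_apply, form_apply, form_apply, Fin.sum_univ_castSucc]
    simp only [Fin.val_castSucc, Fin.snoc_castSucc, Fin.val_last, Fin.snoc_last]
    rw [if_neg (by omega), neg_one_mul, ← sub_eq_add_neg]
    congr 1
    refine Finset.sum_congr rfl fun i _ => ?_
    congr 2
    exact propext (by omega)
  let J : (Fin m → ℝ) →ₗ[ℝ] (Fin (m + 1) → ℝ) :=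
    { toFun := fun x => Fin.snoc (α := fun _ => ℝ) x 0
      map_add' := fun x y => by
        funext i
        refine Fin.lastCases ?_ (fun j => ?_) i <;> simp
      map_smul' := fun a x => by
        funext i
        refine Fin.lastCases ?_ (fun j => ?_) i <;> simp }
  let R : (Fin (m + 1) → ℝ) →ₗ[ℝ] (Fin m → ℝ) := LinearMap.funLeft ℝ ℝ Fin.castSucc
  let T : (Fin (m + 1) → ℝ) →ₗ[ℝ] ℝ := (√c)⁻¹ • LinearMap.proj (Fin.last m)
  have hJ : ∀ x, LinearMap.toContinuousLinearMap J x = Fin.snoc (α := fun _ => ℝ) x 0 :=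
    fun x => rfl
  have hR : ∀ x i, LinearMap.toContinuousLinearMap R x i = x i.castSucc := fun x i => rfl
  have hT : ∀ x, LinearMap.toContinuousLinearMap T x = (√c)⁻¹ * x (Fin.last m) := fun x => rfl
  refine ⟨LinearMap.toContinuousLinearMap J, LinearMap.toContinuousLinearMap R,
    LinearMap.toContinuousLinearMap T, fun x => ?_, ⟨fun x => ?_, fun x => ?_, ?_, fun x y => ?_,
    fun x => ?_, fun x => ?_, ?_⟩⟩
  · rw [hJ]
    funext i
    refine Fin.lastCases ?_ (fun j => ?_) i <;> simp
  · funext i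
    rw [hR, hJ, Fin.snoc_castSucc]
  · rw [hT, hJ]
    funext i
    refine Fin.lastCases ?_ (fun j => ?_) i
    · simp only [Pi.add_apply, Pi.smul_apply, Fin.snoc_last, smul_eq_mul, zero_add]
      field_simp
    · simp
      rfl
  · funext i
    rw [hR, Fin.snoc_castSucc]
  · rw [hJ, hJ, hf]
    ring
  · rw [hJ, hf, map_zero]
    ring
  · rw [hJ, hf, map_zero, zero_apply]
    ring
  · rw [hf, map_zero, Real.mul_self_sqrt hc.le]
    ring

theorem isExtension_cons (m s : ℕ) (hs : s ≤ m) {c : ℝ} (hc : c < 0) :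
    ∃ J R T, (∀ x, J x + Fin.cons (α := fun _ => ℝ) (√(-c)) 0 =
        Fin.cons (α := fun _ => ℝ) (√(-c)) x) ∧
      IsExtension (formL m s) (formL (m + 1) s) c J R T
        (Fin.cons (α := fun _ => ℝ) (√(-c)) 0) := by
  have hc0 : √(-c) ≠ 0 := (Real.sqrt_pos.2 (neg_pos.2 hc)).ne'
  have hf : ∀ (x y : Fin m → ℝ) (a b : ℝ), formL (m + 1) s
      (Fin.cons (α := fun _ => ℝ) a x) (Fin.cons (α := fun _ => ℝ) b y) =
        a * b + formL m s x y := by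
    intro x y a b
    rw [formL_apply, formL_apply, form_apply, form_apply, Fin.sum_univ_succ]
    simp only [Fin.val_succ, Fin.cons_succ, Fin.cons_zero]
    -- The new first coordinate is positive because s ≤ m; hence u = (√(-c), 0) has square -c.
    rw [if_pos (by simp only [Fin.val_zero]; omega), one_mul]
    congr 1
    refine Finset.sum_congr rfl fun i _ => ?_
    congr 2
    exact propext (by omega)
  let J : (Fin m → ℝ) →ₗ[ℝ] (Fin (m + 1) → ℝ) :=
    { toFun := fun x => Fin.cons (α := fun _ => ℝ) 0 x
      map_add' := fun x y => by
        funext i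
        refine Fin.cases ?_ (fun j => ?_) i <;> simp
      map_smul' := fun a x => by
        funext i
        refine Fin.cases ?_ (fun j => ?_) i <;> simp }
  let R : (Fin (m + 1) → ℝ) →ₗ[ℝ] (Fin m → ℝ) := LinearMap.funLeft ℝ ℝ Fin.succ
  let T : (Fin (m + 1) → ℝ) →ₗ[ℝ] ℝ := (√(-c))⁻¹ • LinearMap.proj 0
  have hJ : ∀ x, LinearMap.toContinuousLinearMap J x = Fin.cons (α := fun _ => ℝ) 0 x :=
    fun x => rfl
  have hR : ∀ x i, LinearMap.toContinuousLinearMap R x i = x i.succ := fun x i => rfl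
  have hT : ∀ x, LinearMap.toContinuousLinearMap T x = (√(-c))⁻¹ * x 0 := fun x => rfl
  refine ⟨LinearMap.toContinuousLinearMap J, LinearMap.toContinuousLinearMap R,
    LinearMap.toContinuousLinearMap T, fun x => ?_, ⟨fun x => ?_, fun x => ?_, ?_, fun x y => ?_,
    fun x => ?_, fun x => ?_, ?_⟩⟩
  · rw [hJ]
    funext i
    refine Fin.cases ?_ (fun j => ?_) i <;> simp
  · funext i
    rw [hR, hJ, Fin.cons_succ]
  · rw [hT, hJ]
    funext i
    refine Fin.cases ?_ (fun j => ?_) i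
    · simp only [Pi.add_apply, Pi.smul_apply, Fin.cons_zero, smul_eq_mul, zero_add]
      field_simp
    · simp
      rfl
  · funext i
    rw [hR, Fin.cons_succ]
  · rw [hJ, hJ, hf]
    ring
  · rw [hJ, hf, map_zero]
    ring
  · rw [hJ, hf, map_zero, zero_apply]
    ring
  · rw [hf, map_zero, Real.mul_self_sqrt (neg_pos.2 hc).le]
    ring

omit [ChartedSpace ℂ M] [IsManifold 𝓘(ℝ, ℂ) ∞ M] in
theorem IsPolar.isParallelSection {m s : ℕ} {y : M → ProjCone m s} {c : ℝ} {ψ : M → Fin m → ℝ}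
    (hψ : IsPolar Z y c ψ) {z : OpenPartialHomeomorph M ℂ} (hz : z ∈ Z) {Y : ℂ → Fin m → ℝ}
    (hY : IsCanonicalLift z y Y) :
    IsParallelSection (formL m s) z.target 1 Complex.I Y (fun w => ψ (z.symm w)) := by
  have hpar : ∀ h : ℂ, ∀ w ∈ z.target, ∀ n, IsNormal (formL m s) 1 Complex.I Y w n →
      formL m s (pd h (fun w => ψ (z.symm w)) w) n = 0 := fun h w hw n hn => by
    have := ((isNormalDeriv_iff z.open_target hY.smooth hw).1 (hψ.parallel z hz Y hY w hw h)).2 n hn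
    rw [this, map_zero, zero_apply]
  exact ⟨hψ.smooth z hz, fun w hw =>
    (mem_normalV_iff z.open_target hY.smooth hw).1 (hψ.normal z hz Y hY w hw), hpar 1,
    hpar Complex.I⟩

/-- The change of coordinate with both coordinates equal to z. `IsPolar` speaks of all canonical
lifts, and this allows checking just one. -/
theorem isNormal_canonicalLift {m s : ℕ} {y : M → ProjCone m s} {z : OpenPartialHomeomorph M ℂ}
    (hz : z ∈ IsManifold.maximalAtlas 𝓘(ℝ, ℂ) ∞ M) {Y₁ Y₂ : ℂ → Fin m → ℝ}
    (h₁ : IsCanonicalLift z y Y₁) (h₂ : IsCanonicalLift z y Y₂) {w : ℂ} (hw : w ∈ z.target)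
    {x : Fin m → ℝ} :
    IsNormal (formL m s) 1 Complex.I Y₁ w x ↔ IsNormal (formL m s) 1 Complex.I Y₂ w x := by
  have := isNormal_of_isMultiple formL_comm hz hz h₁.conformalLift h₂.conformalLift h₁.isMultiple
    h₂.isMultiple (z.map_target hw) (z.map_target hw) (x := x)
  rwa [z.right_inv hw] at this

/-- A parallel section of the normal bundle gives a polar surface. -/
theorem isPolar_of_isParallelSection {m s : ℕ} (hZ : IsCoordinateCover Z) {y : M → ProjCone m s}
    (hy : IsIsothermic Z y) {c : ℝ} {ψ : M → Fin m → ℝ}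
    (hψ : ∀ z ∈ Z, ∃ Y, IsCanonicalLift z y Y ∧
      IsParallelSection (formL m s) z.target 1 Complex.I Y (fun w => ψ (z.symm w)))
    (hc : ∀ p, formL m s (ψ p) (ψ p) = c) (h0 : ∀ p, ψ p ≠ 0) : IsPolar Z y c ψ where
  isothermic := hy
  smooth z hz := by
    obtain ⟨Y, -, P⟩ := hψ z hz
    exact P.smooth
  normal z hz Y₁ hY₁ w hw := by
    obtain ⟨Y, hY, P⟩ := hψ z hz
    rw [mem_normalV_iff z.open_target hY₁.smooth hw,
      isNormal_canonicalLift (hZ.smooth z hz) hY₁ hY hw]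
    exact P.normal w hw
  parallel z hz Y₁ hY₁ w hw h := by
    obtain ⟨Y, hY, P⟩ := hψ z hz
    rw [isNormalDeriv_iff z.open_target hY₁.smooth hw]
    refine ⟨⟨map_zero _, map_zero _, map_zero _, map_zero _⟩, fun n hn => ?_⟩
    rw [isNormal_canonicalLift (hZ.smooth z hz) hY₁ hY hw] at hn
    rw [pd_eq_re_im]
    simp only [map_add, map_smul, map_zero, add_apply, smul_apply, zero_apply,
      P.parallel_left w hw n hn, P.parallel_right w hw n hn, smul_zero, add_zero]
  length := hc
  ne_zero _ := h0

end Final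

end PolarIsothermic

/-- The `c`-polar transforms and the spectral transforms of spacelike isothermic surfaces in
`Q^n_r` commute. -/
theorem mainTheorem3 (n r : ℕ) (hnr : r + 2 ≤ n)
    {M : Type*} [TopologicalSpace M] [ChartedSpace ℂ M] [IsManifold 𝓘(ℝ, ℂ) ∞ M]
    (Z : Set (OpenPartialHomeomorph M ℂ)) (hZ : PolarIsothermic.IsCoordinateCover Z)
    (y y' : M → PolarIsothermic.ProjCone (n + 2) (r + 1)) (a : ℝ)
    (hy : PolarIsothermic.IsIsothermic Z y) (hy' : PolarIsothermic.IsIsothermic Z y')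
    (hspec : PolarIsothermic.IsSpectralTransform Z a y y')
    (c : ℝ) (ψ : M → Fin (n + 2) → ℝ)
    (hψ : PolarIsothermic.IsPolar Z y c ψ) (hnd : PolarIsothermic.IsNondegenerate Z c ψ) :
    ∃ ψ' : M → Fin (n + 2) → ℝ, PolarIsothermic.IsPolar Z y' c ψ' ∧
      PolarIsothermic.IsPolarSpectralTransform (r + 1) Z a c ψ ψ' := by
  open PolarIsothermic in
  obtain ⟨Φ, hΦ⟩ := hspec
  have hc : ∀ p, formL (n + 2) (r + 1) (ψ p) (ψ p) = c := hψ.length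
  have himm : ∀ z ∈ Z, ∀ w ∈ z.target, ∀ h, pd h (fun w => ψ (z.symm w)) w = 0 → h = 0 := by
    intro z hz w hw h hh
    by_cases h0 : c = 0
    -- If [ψ] is an immersion, then so is ψ: the case t = 0.
    · exact hnd.of_eq_zero h0 z hz w hw h 0 (by rw [zero_smul]; exact hh)
    · exact hnd.of_ne_zero h0 z hz w hw h hh
  have hyp : ∀ z ∈ Z, ∃ (Y κ : ℂ → Fin (n + 2) → ℝ) (b d : ℂ → ℝ) (Y' κ' : ℂ → Fin (n + 2) → ℝ)
      (b' d' : ℂ → ℝ), (SpectralPair (formL (n + 2) (r + 1)) z.target 1 Complex.I a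
        (fun w => Φ (z.symm w)) Y κ b d Y' κ' b' d' ∧
      IsParallelSection (formL (n + 2) (r + 1)) z.target 1 Complex.I Y (fun w => ψ (z.symm w)) ∧
      (∀ w ∈ z.target, formL (n + 2) (r + 1) (κ w) (ψ (z.symm w)) ≠ 0) ∧
      IsMultiple z (fun p => (y p).1.rep) Y ∧ IsMultiple z (fun p => (y' p).1.rep) Y') ∧
      IsCanonicalLift z y' Y' := by
    intro z hz
    obtain ⟨Y, S, κ, Y', S', κ', hA, hA', hC, hS⟩ := hΦ z hz
    have H := hA.isothermicLift
    have H' := hA'.isothermicLift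
    have P := hψ.isParallelSection hz hA.canonical
    exact ⟨Y, κ, _, _, Y', κ', _, _, ⟨⟨H, H', hC.normalCorr H H',
      fun w hw => by simp [hS w hw], fun w hw => by simp [hS w hw]⟩, P,
      fun w hw => P.pairing_ne H formL_comm eq_zero_of_formL hw (himm z hz w hw),
      hA.canonical.isMultiple, hA'.canonical.isMultiple⟩, hA'.canonical⟩
  have hyp' : ∀ z ∈ Z, ∃ (Y κ : ℂ → Fin (n + 2) → ℝ) (b d : ℂ → ℝ) (Y' κ' : ℂ → Fin (n + 2) → ℝ)
      (b' d' : ℂ → ℝ), SpectralPair (formL (n + 2) (r + 1)) z.target 1 Complex.I a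
        (fun w => Φ (z.symm w)) Y κ b d Y' κ' b' d' ∧
      IsParallelSection (formL (n + 2) (r + 1)) z.target 1 Complex.I Y (fun w => ψ (z.symm w)) ∧
      (∀ w ∈ z.target, formL (n + 2) (r + 1) (κ w) (ψ (z.symm w)) ≠ 0) ∧
      IsMultiple z (fun p => (y p).1.rep) Y ∧ IsMultiple z (fun p => (y' p).1.rep) Y' := by
    intro z hz
    obtain ⟨Y, κ, b, d, Y', κ', b', d', h, -⟩ := hyp z hz
    exact ⟨Y, κ, b, d, Y', κ', b', d', h⟩
  refine ⟨fun p => Φ p (ψ p), isPolar_of_isParallelSection hZ hy' (fun z hz => ?_) (fun p => ?_)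
    (fun p hp => ?_), ⟨fun h0 => ?_, fun hpos => ?_, fun hneg => ?_⟩⟩
  · obtain ⟨Y, κ, b, d, Y', κ', b', d', ⟨Q, P, -⟩, hY'⟩ := hyp z hz
    exact ⟨Y', hY', Q.isParallelSection_map P⟩
  · obtain ⟨z, hz, hp⟩ := hZ.cover p
    obtain ⟨Y, κ, b, d, Y', κ', b', d', Q, P, -⟩ := hyp' z hz
    have hw := z.map_source hp
    have := Q.corr.isometry _ hw _ (P.normal _ hw) _ (P.normal _ hw)
    rw [z.left_inv hp, hc] at this
    exact this
  -- Φψ has no zeros because ⟨κ', Φψ⟩ = ⟨κ, ψ⟩ ≠ 0.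
  · obtain ⟨z, hz, hzp⟩ := hZ.cover p
    obtain ⟨Y, κ, b, d, Y', κ', b', d', Q, P, h0, -⟩ := hyp' z hz
    have hw := z.map_source hzp
    have h1 := Q.corr.hopf _ hw _ (P.normal _ hw)
    have h2 := h0 _ hw
    rw [← h1, z.left_inv hzp, hp, map_zero] at h2
    exact h2 rfl
  · subst h0
    have := exists_isSpectralTransform (isExtension_id (n + 2) (r + 1)) hZ hyp' hc
    simpa using this
  · obtain ⟨J, R, T, hJ, X⟩ := isExtension_snoc (n + 2) (r + 1) hpos
    have := exists_isSpectralTransform X hZ hyp' hc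
    simpa only [hJ] using this
  · obtain ⟨J, R, T, hJ, X⟩ := isExtension_cons (n + 2) (r + 1) (by omega) hneg
    have := exists_isSpectralTransform X hZ hyp' hc
    simpa only [hJ] using this
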